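/- Let $A,C\in\mathbb R^{m\times n}$ and $\beta\in\mathbb R^n$, and consider the polyhedra $$P=\{(y,\pi_1)\in\mathbb R^{n+1} : A_iy-\pi_1\le 0\ (1\le i\le m),\ y_j\ge 0\ (1\le j\le n),\ \textstyle\sum_j y_j=1\},$$ $$Q'=\{(x,\lambda,\pi_2)\in\mathbb R^{m+2} : x_i\ge 0\ (1\le i\le m),\ x^TC^j+\beta_j\lambda-\pi_2\le 0\ (1\le j\le n),\ \textstyle\sum_i x_i=1\}.$$ In both, number the inequalities $1,\dots,m+n$, those indexed by $i$ first, and let $L(\cdot)$ be the set of indices of the inequalities tight at a point. Assume that $P$ and $Q'$ are non-degenerate, i.e. $|L(v)|\le n$ for all $v\in P$ and $|L(w)|\le m+1$ for all $w\in Q'$, and that the minimum and the maximum of $\beta$ are each attained at exactly one index, $j_s$ and $j_e$ respectively, with $j_s\ne j_e$. Let $i_s,i_e$ be indices of the maximal entries of the columns $A^{j_s},A^{j_e}$, and let $v_s=(e_{j_s},a_{i_sj_s})$ and $v_e=(e_{j_e},a_{i_ej_e})$, which are vertices of $P$. Let $\mathcal N=\{(v,w)\in P\times Q' : L(v)\cup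 L(w)=\{1,\dots,m+n\}\}$, $\mathcal E_v=\{w : (v,w)\in\mathcal N\}$ and $\mathcal E_w=\{v : (v,w)\in\mathcal N\}$. A vertex of $\mathcal N$ is a pair $u=(v,w)\in\mathcal N$ of a vertex $v$ of $P$ and a vertex $w$ of $Q'$. The edges of $\mathcal N$ are the non-empty sets $\{v\}\times\mathcal E_v$ and $\mathcal E_w\times\{w\}$, written $(v,\mathcal E_v)$ and $(\mathcal E_w,w)$, with $v$ a vertex of $P$ and $w$ a vertex of $Q'$. Two distinct vertices are adjacent if they lie on a common edge. A direction of an edge is one of the two ways of ordering its two ends, where an end is a vertex of $\mathcal N$ on the edge or, for an edge that contains only one vertex, its infinite end. For a vertex $u=(v,w)$, $v=(y,\pi_1)$, $w=(x,\lambda,\pi_2)$, let $X=\{i : A_iy=\pi_1\}$ and $Y=\{j : x^TC^j+\beta_j\lambda=\pi_2\}$, in increasing order, with complements $-X$ and $-Y$, and let $l$ be the duplicate label, i.e. the unique element of $L(v)\cap L(w)$ (it belongs to $X$, or it is the label of an element of $Y$, which is then also denoted by $l$). Let $E(v)$ be the $(n+1)\times(n+1)$ matrix with columns for the variables $y_Y,y_{-Y},\pi_1$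 and rows formed, in this order, by the coefficients of the left-hand sides of the equations $\sum_j y_j=1$; $A_iy-\pi_1=0$ for $i\in X$; $-y_l=0$ if the duplicate label $l$ is in $Y$; $-y_j=0$ for $j\in -Y$. Let $E(w)$ be the $(m+2)\times(m+2)$ matrix with rows for the variables $\lambda,x_X,x_{-X},\pi_2$ and columns formed by the coefficients of $\sum_i x_i=1$; $x^TC^j+\beta_j\lambda-\pi_2=0$ for $j\in Y$; $-x_l=0$ if $l\in X$; $-x_i=0$ for $i\in -X$. Put $E(u)=\begin{pmatrix}E(v)&0\\0&E(w)^T\end{pmatrix}$ and $s(u)=\operatorname{sign}\det E(u)$. Then there is an orientation $\to$ of the edges of $\mathcal N$ (a choice of a direction for each edge) such that: 1. At every vertex $u=(v,w)$ with $s(u)=+1$, the edge $(\mathcal E_w,w)$ is directed away from $u$ and the edge $(v,\mathcal E_v)$ towards $u$; at every other vertex the edge $(\mathcal E_w,w)$ is directed towards $u$ and $(v,\mathcal E_v)$ away from $u$. 2. The orientation is efficiently computable: there are a single random access program, using register operations (addition and truncated subtraction), the field operations and sign tests, and a single polynomial $T$, both independent of $m,n,A,C,\beta$, such that, given $A,C,\beta$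 and an edge of $\mathcal N$ (described by one of its vertices $u$ and by which of the two edges at $u$ it is), the program decides whether the edge is directed away from $u$ or towards $u$. It performs at most $T(m+n)$ steps for real data; for rational data, its logarithmic cost (every step also pays for the bit length of the number it writes) is at most $T$ of the bit length of the input. 3. Adjacent vertices $u,u'$ of $\mathcal N$ have opposite signs: $s(u)\,s(u')=-1$. 4. Every cycle of $\mathcal N$ becomes a directed cycle. 5. The edges $(v_s,\mathcal E_{v_s})$ and $(v_e,\mathcal E_{v_e})$ contain exactly one vertex each, $u_s$ and $u_e$, and they are the only edges of $\mathcal N$ with an infinite end. There is a path of $\mathcal N$ from $u_s$ to $u_e$, and the path $\mathcal P$ formed by $(v_s,\mathcal E_{v_s})$, this path and $(v_e,\mathcal E_{v_e})$ becomes a directed path from $(v_s,\mathcal E_{v_s})$ to $(v_e,\mathcal E_{v_e})$: the first edge is directed towards $u_s$, all edges of the path from $u_s$ to $u_e$ are directed towards $u_e$, and the last edge is directed away from $u_e$. -/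

import Mathlib

/-! ## The polytopes, their labels and the set of fully-labeled pairs

Strategies of the row player are `Fin m`, those of the column player are `Fin n`; the label set
`{1, …, m + n}` is `Fin m ⊕ Fin n`. -/

/-- A point `(y, π₁)` of `ℝ^(n+1)`. -/
abbrev PPoint (n : ℕ) : Type := (Fin n → ℝ) × ℝ

/-- A point `(x, lam, π₂)` of `ℝ^(m+2)`. -/
abbrev QPoint (m : ℕ) : Type := (Fin m → ℝ) × ℝ × ℝ

/-- The best response polytope `P` of the row player. -/
def polyP {m n : ℕ} (A : Matrix (Fin m) (Fin n) ℝ) : Set (PPoint n) :=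
  {v | (∀ i, (∑ j, A i j * v.1 j) - v.2 ≤ 0) ∧ (∀ j, 0 ≤ v.1 j) ∧ ∑ j, v.1 j = 1}

/-- The polytope `Q'`. -/
def polyQ {m n : ℕ} (C : Matrix (Fin m) (Fin n) ℝ) (β : Fin n → ℝ) : Set (QPoint m) :=
  {w | (∀ i, 0 ≤ w.1 i) ∧ (∀ j, (∑ i, w.1 i * C i j) + β j * w.2.1 - w.2.2 ≤ 0) ∧
    ∑ i, w.1 i = 1}

/-- The label `L(v)`: the inequalities of `P` that are tight at `v`. -/
def labelP {m n : ℕ} (A : Matrix (Fin m) (Fin n) ℝ) (v : PPoint n) : Set (Fin m ⊕ Fin n) :=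
  {l | match l with
    | Sum.inl i => (∑ j, A i j * v.1 j) - v.2 = 0
    | Sum.inr j => v.1 j = 0}

/-- The label `L(w)`: the inequalities of `Q'` that are tight at `w`. -/
def labelQ {m n : ℕ} (C : Matrix (Fin m) (Fin n) ℝ) (β : Fin n → ℝ) (w : QPoint m) :
    Set (Fin m ⊕ Fin n) :=
  {l | match l with
    | Sum.inl i => w.1 i = 0
    | Sum.inr j => (∑ i, w.1 i * C i j) + β j * w.2.1 - w.2.2 = 0}

/-- Non-degeneracy of `P` (a polyhedron of dimension `n`). -/
def NondegP {m n : ℕ} (A : Matrix (Fin m) (Fin n) ℝ) : Prop :=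
  ∀ v ∈ polyP A, (labelP A v).ncard ≤ n

/-- Non-degeneracy of `Q'` (a polyhedron of dimension `m + 1`). -/
def NondegQ {m n : ℕ} (C : Matrix (Fin m) (Fin n) ℝ) (β : Fin n → ℝ) : Prop :=
  ∀ w ∈ polyQ C β, (labelQ C β w).ncard ≤ m + 1

/-- The set `𝒩` of fully-labeled pairs. -/
def fullyLabeled {m n : ℕ} (A C : Matrix (Fin m) (Fin n) ℝ) (β : Fin n → ℝ) :
    Set (PPoint n × QPoint m) :=
  {u | u.1 ∈ polyP A ∧ u.2 ∈ polyQ C β ∧ labelP A u.1 ∪ labelQ C β u.2 = Set.univ}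

/-- `ℰ_v = {w | (v, w) ∈ 𝒩}`. -/
def fiberP {m n : ℕ} (A C : Matrix (Fin m) (Fin n) ℝ) (β : Fin n → ℝ) (v : PPoint n) :
    Set (QPoint m) :=
  {w | (v, w) ∈ fullyLabeled A C β}

/-- `ℰ_w = {v | (v, w) ∈ 𝒩}`. -/
def fiberQ {m n : ℕ} (A C : Matrix (Fin m) (Fin n) ℝ) (β : Fin n → ℝ) (w : QPoint m) :
    Set (PPoint n) :=
  {v | (v, w) ∈ fullyLabeled A C β}

/-- The vertices of `𝒩`: fully-labeled pairs of vertices of `P` and `Q'`. -/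
def NVert {m n : ℕ} (A C : Matrix (Fin m) (Fin n) ℝ) (β : Fin n → ℝ) : Type :=
  {u : PPoint n × QPoint m // u ∈ fullyLabeled A C β ∧
    u.1 ∈ Set.extremePoints ℝ (polyP A) ∧ u.2 ∈ Set.extremePoints ℝ (polyQ C β)}

/-- The edges of `𝒩`: the nonempty sets `{v} × ℰ_v` and `ℰ_w × {w}`, for vertices `v` of `P` and
`w` of `Q'`. -/
def NEdges {m n : ℕ} (A C : Matrix (Fin m) (Fin n) ℝ) (β : Fin n → ℝ) :
    Set (Set (PPoint n × QPoint m)) :=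
  {e | e.Nonempty ∧
    ((∃ v ∈ Set.extremePoints ℝ (polyP A), e = {v} ×ˢ fiberP A C β v) ∨
     (∃ w ∈ Set.extremePoints ℝ (polyQ C β), e = fiberQ A C β w ×ˢ {w}))}

/-- The two kinds of edges at a vertex `u = (v, w)` of `𝒩`. -/
inductive EdgeKind : Type
  /-- the edge `(ℰ_w, w)`, along which the point of `P` moves -/
  | inP : EdgeKind
  /-- the edge `(v, ℰ_v)`, along which the point of `Q'` moves -/
  | inQ : EdgeKind

/-- The edge of the given kind at a vertex `u = (v, w)`, as a set. -/
def edgeSetAt {m n : ℕ} {A C : Matrix (Fin m) (Fin n) ℝ} {β : Fin n → ℝ}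
    (u : NVert A C β) : EdgeKind → Set (PPoint n × QPoint m)
  | EdgeKind.inP => fiberQ A C β u.1.2 ×ˢ {u.1.2}
  | EdgeKind.inQ => {u.1.1} ×ˢ fiberP A C β u.1.1

theorem edgeSetAt_mem {m n : ℕ} {A C : Matrix (Fin m) (Fin n) ℝ} {β : Fin n → ℝ}
    (u : NVert A C β) (k : EdgeKind) : edgeSetAt u k ∈ NEdges A C β := by
  cases k with
  | inP => exact ⟨⟨u.1, u.2.1, rfl⟩, Or.inr ⟨u.1.2, u.2.2.2, rfl⟩⟩
  | inQ => exact ⟨⟨u.1, rfl, u.2.1⟩, Or.inl ⟨u.1.1, u.2.2.1, rfl⟩⟩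

/-- The edge of the given kind at a vertex of `𝒩`. -/
def edgeAt {m n : ℕ} {A C : Matrix (Fin m) (Fin n) ℝ} {β : Fin n → ℝ}
    (u : NVert A C β) (k : EdgeKind) : NEdges A C β :=
  ⟨edgeSetAt u k, edgeSetAt_mem u k⟩

/-- The graph formed by the vertices of `𝒩` and its bounded edges. -/
def NGraph {m n : ℕ} (A C : Matrix (Fin m) (Fin n) ℝ) (β : Fin n → ℝ) :
    SimpleGraph (NVert A C β) where
  Adj u u' := u ≠ u' ∧ ∃ e ∈ NEdges A C β, u.1 ∈ e ∧ u'.1 ∈ e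
  symm := ⟨fun _ _ h => ⟨h.1.symm, h.2.imp fun _ he => ⟨he.1, he.2.2, he.2.1⟩⟩⟩
  loopless := ⟨fun _ h => h.1 rfl⟩

/-! ## Orientations -/

/-- `(t, h)` is one of the two directed versions of the edge `e`, with tail `t` and head `h`.
The value `none` stands for the infinite end of an edge with only one bounding vertex. -/
def IsDirectionOf {m n : ℕ} {A C : Matrix (Fin m) (Fin n) ℝ} {β : Fin n → ℝ}
    (d : Option (NVert A C β) × Option (NVert A C β)) (e : NEdges A C β) : Prop :=
  d.1 ≠ d.2 ∧ ∀ u : NVert A C β, u.1 ∈ e.1 ↔ (d.1 = some u ∨ d.2 = some u)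

/-- The edge joining `u` and `u'` exists and is directed from `u` to `u'`. -/
def DirectedFromTo {m n : ℕ} {A C : Matrix (Fin m) (Fin n) ℝ} {β : Fin n → ℝ}
    (dir : NEdges A C β → Option (NVert A C β) × Option (NVert A C β))
    (u u' : NVert A C β) : Prop :=
  ∃ e, dir e = (some u, some u')

/-! ## The sign of a vertex -/

/-- The variables of `P`. -/
inductive PVar (n : ℕ) : Type
  | y : Fin n → PVar n
  | pi1 : PVar n

/-- The variables of `Q'`. -/
inductive QVar (m : ℕ) : Type
  | lam : QVar m
  | x : Fin m → QVar m
  | pi2 : QVar m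

/-- Coefficients of `∑ y_j = 1`. -/
def sumRowP {n : ℕ} : PVar n → ℝ
  | .y _ => 1
  | .pi1 => 0

/-- Coefficients of `A_i y - π₁ = 0`. -/
def payRowP {m n : ℕ} (A : Matrix (Fin m) (Fin n) ℝ) (i : Fin m) : PVar n → ℝ
  | .y j => A i j
  | .pi1 => -1

/-- Coefficients of `- y_j = 0`. -/
def zeroRowP {n : ℕ} (j : Fin n) : PVar n → ℝ
  | .y j' => if j' = j then -1 else 0
  | .pi1 => 0

/-- Coefficients of `∑ x_i = 1`. -/
def sumColQ {m : ℕ} : QVar m → ℝ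
  | .lam => 0
  | .x _ => 1
  | .pi2 => 0

/-- Coefficients of `x^T C^j + β_j lam - π₂ = 0`. -/
def payColQ {m n : ℕ} (C : Matrix (Fin m) (Fin n) ℝ) (β : Fin n → ℝ) (j : Fin n) : QVar m → ℝ
  | .lam => β j
  | .x i => C i j
  | .pi2 => -1

/-- Coefficients of `- x_i = 0`. -/
def zeroColQ {m : ℕ} (i : Fin m) : QVar m → ℝ
  | .lam => 0
  | .x i' => if i' = i then -1 else 0
  | .pi2 => 0

/-- The `N × N` coefficient matrix whose rows are the given equations and whose columns are the
given variables, each in the order of its list (which is meant to have length `N`). -/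
def coeffMatrix {κ : Type} (N : ℕ) (eqs : List (κ → ℝ)) (vars : List κ) :
    Matrix (Fin N) (Fin N) ℝ :=
  fun r c => match eqs[(r : ℕ)]?, vars[(c : ℕ)]? with
    | some f, some z => f z
    | _, _ => 0

/-- The elements of `Fin k` that satisfy `p`, in increasing order. -/
noncomputable def sortedList {k : ℕ} (p : Fin k → Prop) : List (Fin k) :=
  open Classical in (List.finRange k).filter (fun i => decide (p i))

/-- `X = {i | A_i y = π₁}`. -/
def inX {m n : ℕ} (A : Matrix (Fin m) (Fin n) ℝ) (u : PPoint n × QPoint m) (i : Fin m) : Prop :=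
  Sum.inl i ∈ labelP A u.1

/-- `Y = {j | x^T C^j + β_j lam = π₂}`. -/
def inY {m n : ℕ} (C : Matrix (Fin m) (Fin n) ℝ) (β : Fin n → ℝ) (u : PPoint n × QPoint m)
    (j : Fin n) : Prop :=
  Sum.inr j ∈ labelQ C β u.2

/-- The matrix `E(v)`. Columns: `y_Y`, `y_{-Y}`, `π₁`. Rows: `∑ y_j = 1`; `A_i y = π₁` for
`i ∈ X`; `-y_l = 0` for the duplicate label `l` if `l ∈ Y` (no row if `l ∈ X`); `-y_j = 0` for
`j ∉ Y`. -/
noncomputable def matrixEv {m n : ℕ} (A C : Matrix (Fin m) (Fin n) ℝ) (β : Fin n → ℝ)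
    (u : PPoint n × QPoint m) : Matrix (Fin (n + 1)) (Fin (n + 1)) ℝ :=
  coeffMatrix (n + 1)
    ([sumRowP] ++ (sortedList (inX A u)).map (payRowP A) ++
      (sortedList (fun j => inY C β u j ∧ Sum.inr j ∈ labelP A u.1)).map zeroRowP ++
      (sortedList (fun j => ¬ inY C β u j)).map zeroRowP)
    ((sortedList (inY C β u)).map PVar.y ++ (sortedList (fun j => ¬ inY C β u j)).map PVar.y ++
      [PVar.pi1])

/-- The matrix `E(w)`. Rows: `lam`, `x_X`, `x_{-X}`, `π₂`. Columns: `∑ x_i = 1`;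
`x^T C^j + β_j lam = π₂` for `j ∈ Y`; `-x_l = 0` for the duplicate label `l` if `l ∈ X` (no column
if `l ∈ Y`); `-x_i = 0` for `i ∉ X`. -/
noncomputable def matrixEw {m n : ℕ} (A C : Matrix (Fin m) (Fin n) ℝ) (β : Fin n → ℝ)
    (u : PPoint n × QPoint m) : Matrix (Fin (m + 2)) (Fin (m + 2)) ℝ :=
  (coeffMatrix (m + 2)
    ([sumColQ] ++ (sortedList (inY C β u)).map (payColQ C β) ++
      (sortedList (fun i => inX A u i ∧ Sum.inl i ∈ labelQ C β u.2)).map zeroColQ ++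
      (sortedList (fun i => ¬ inX A u i)).map zeroColQ)
    ([QVar.lam] ++ (sortedList (inX A u)).map QVar.x ++
      (sortedList (fun i => ¬ inX A u i)).map QVar.x ++ [QVar.pi2])).transpose

/-- `E(u)`, block diagonal with blocks `E(v)` and the transpose of `E(w)`. -/
noncomputable def matrixE {m n : ℕ} (A C : Matrix (Fin m) (Fin n) ℝ) (β : Fin n → ℝ)
    (u : PPoint n × QPoint m) :
    Matrix (Fin (n + 1) ⊕ Fin (m + 2)) (Fin (n + 1) ⊕ Fin (m + 2)) ℝ :=
  Matrix.fromBlocks (matrixEv A C β u) 0 0 (matrixEw A C β u).transpose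

/-- `s(u) = sign (det E(u))`. -/
noncomputable def vertexSign {m n : ℕ} {A C : Matrix (Fin m) (Fin n) ℝ} {β : Fin n → ℝ}
    (u : NVert A C β) : SignType :=
  SignType.sign (matrixE A C β u.1).det

/-! ## The machine model

A random access machine over an ordered field `K`. It has registers holding natural numbers, and
two-dimensional arrays of elements of `K` that are addressed through the registers. Natural numbers
can be added and subtracted, but not multiplied; elements of `K` admit the field operations and
sign tests. Programs are structured, with counted loops. -/

/-- The memory cell of array `arr` at the position stored in the registers `row` and `col`. -/
structure Cell : Type where
  arr : ℕ
  row : ℕ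
  col : ℕ

/-- The operations on natural number registers. -/
inductive RegOp : Type
  | add | sub

/-- The operations on field elements. -/
inductive FieldOp : Type
  | add | sub | mul | div

/-- Programs. -/
inductive Prog : Type
  | skip : Prog
  /-- set a register to a constant -/
  | setReg (r c : ℕ) : Prog
  /-- `r := a op b`, on registers -/
  | regOp (op : RegOp) (r a b : ℕ) : Prog
  /-- set a cell to an integer constant -/
  | setCell (d : Cell) (c : ℤ) : Prog
  /-- `d := a op b`, on cells -/
  | cellOp (op : FieldOp) (d a b : Cell) : Prog
  | seq (p q : Prog) : Prog
  /-- `if register a < register b then p else q` -/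
  | ifRegLt (a b : ℕ) (p q : Prog) : Prog
  /-- `if 0 < cell a then p else q` -/
  | ifCellPos (a : Cell) (p q : Prog) : Prog
  /-- `for r = 0, …, b - 1 do p`, where `b` is the value of the register `b` on entry -/
  | forReg (r b : ℕ) (p : Prog) : Prog

/-- A machine configuration. -/
structure MState (K : Type) : Type where
  reg : ℕ → ℕ
  mem : ℕ → ℕ → ℕ → K

namespace MState

variable {K : Type}

/-- The content of a cell. -/
def read (s : MState K) (c : Cell) : K := s.mem c.arr (s.reg c.row) (s.reg c.col)

/-- Overwrite a cell. -/
def write (s : MState K) (c : Cell) (v : K) : MState K :=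
  { s with mem := fun a i j =>
      if a = c.arr ∧ i = s.reg c.row ∧ j = s.reg c.col then v else s.mem a i j }

/-- Overwrite a register. -/
def setReg (s : MState K) (r v : ℕ) : MState K :=
  { s with reg := Function.update s.reg r v }

end MState

/-- Semantics of the operations on registers (subtraction is truncated). -/
def RegOp.eval : RegOp → ℕ → ℕ → ℕ
  | .add, a, b => a + b
  | .sub, a, b => a - b

/-- Semantics of the field operations (with `a / 0 = 0`). -/
def FieldOp.eval {K : Type} [Field K] : FieldOp → K → K → K
  | .add, a, b => a + b
  | .sub, a, b => a - b
  | .mul, a, b => a * b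
  | .div, a, b => a / b

/-- Run a program: the final configuration and the running time. Every elementary step, every test
and every loop iteration takes one unit of time, and writing a field element `v` takes `sz v`
additional units. With `sz = 0` this is the number of steps; with `sz` the bit length it is the
logarithmic cost. -/
def Prog.run {K : Type} [Field K] [LinearOrder K] (sz : K → ℕ) :
    Prog → MState K → MState K × ℕ
  | .skip, s => (s, 1)
  | .setReg r c, s => (s.setReg r c, 1)
  | .regOp op r a b, s => (s.setReg r (op.eval (s.reg a) (s.reg b)), 1)
  | .setCell d c, s => (s.write d (c : K), 1 + sz (c : K))
  | .cellOp op d a b, s =>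
      (s.write d (op.eval (s.read a) (s.read b)), 1 + sz (op.eval (s.read a) (s.read b)))
  | .seq p q, s =>
      ((q.run sz (p.run sz s).1).1, (p.run sz s).2 + (q.run sz (p.run sz s).1).2)
  | .ifRegLt a b p q, s =>
      if s.reg a < s.reg b then ((p.run sz s).1, 1 + (p.run sz s).2)
      else ((q.run sz s).1, 1 + (q.run sz s).2)
  | .ifCellPos a p q, s =>
      if 0 < s.read a then ((p.run sz s).1, 1 + (p.run sz s).2)
      else ((q.run sz s).1, 1 + (q.run sz s).2)
  | .forReg r b p, s =>
      Nat.rec (motive := fun _ => MState K × ℕ) (s, 1)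
        (fun k acc =>
          ((p.run sz (acc.1.setReg r k)).1, acc.2 + (1 + (p.run sz (acc.1.setReg r k)).2)))
        (s.reg b)

/-- The numbers that describe a game space and a vertex `((y, π₁), (x, lam, π₂))`. -/
@[ext]
structure InputData (K : Type) (m n : ℕ) : Type where
  A : Matrix (Fin m) (Fin n) K
  C : Matrix (Fin m) (Fin n) K
  β : Fin n → K
  y : Fin n → K
  pi1 : K
  x : Fin m → K
  lam : K
  pi2 : K

/-- The input that describes a given vertex of `𝒩`. -/
def vertexInput {m n : ℕ} {A C : Matrix (Fin m) (Fin n) ℝ} {β : Fin n → ℝ}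
    (u : NVert A C β) : InputData ℝ m n where
  A := A
  C := C
  β := β
  y := u.1.1.1
  pi1 := u.1.1.2
  x := u.1.2.1
  lam := u.1.2.2.1
  pi2 := u.1.2.2.2

/-- Rational input data, read as real data. -/
def InputData.toReal {m n : ℕ} (I : InputData ℚ m n) : InputData ℝ m n where
  A := fun i j => (I.A i j : ℝ)
  C := fun i j => (I.C i j : ℝ)
  β := fun j => (I.β j : ℝ)
  y := fun j => (I.y j : ℝ)
  pi1 := (I.pi1 : ℝ)
  x := fun i => (I.x i : ℝ)
  lam := (I.lam : ℝ)
  pi2 := (I.pi2 : ℝ)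

/-- The array with the given entries, padded with zeros. -/
def padded {K : Type} [Zero K] {k l : ℕ} (M : Fin k → Fin l → K) (i j : ℕ) : K :=
  if h : i < k ∧ j < l then M ⟨i, h.1⟩ ⟨j, h.2⟩ else 0

/-- The initial configuration for the edge of kind `k` at the vertex described by `I`: registers
0, 1, 2 hold `m`, `n` and the kind (0 or 1), arrays 0 to 7 hold
`A`, `C`, `β`, `y`, `π₁`, `x`, `lam`, `π₂` (vectors as rows), everything else is zero. -/
def initState {K : Type} [Zero K] {m n : ℕ} (I : InputData K m n) (k : EdgeKind) : MState K where
  reg := fun r => match r with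
    | 0 => m
    | 1 => n
    | 2 => match k with
      | .inP => 0
      | .inQ => 1
    | _ => 0
  mem := fun a => match a with
    | 0 => padded I.A
    | 1 => padded I.C
    | 2 => padded (fun _ : Fin 1 => I.β)
    | 3 => padded (fun _ : Fin 1 => I.y)
    | 4 => padded (fun _ _ : Fin 1 => I.pi1)
    | 5 => padded (fun _ : Fin 1 => I.x)
    | 6 => padded (fun _ _ : Fin 1 => I.lam)
    | 7 => padded (fun _ _ : Fin 1 => I.pi2)
    | _ => fun _ _ => 0

/-- The bit length of a rational number: that of its numerator plus that of its denominator. -/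
def ratSize (q : ℚ) : ℕ := Nat.size q.num.natAbs + Nat.size q.den

/-- The bit length of rational input data (with the dimensions in unary). -/
def InputData.bitLength {m n : ℕ} (I : InputData ℚ m n) : ℕ :=
  m + n + (∑ i, ∑ j, ratSize (I.A i j)) + (∑ i, ∑ j, ratSize (I.C i j)) + (∑ j, ratSize (I.β j)) +
    (∑ j, ratSize (I.y j)) + ratSize I.pi1 + (∑ i, ratSize (I.x i)) + ratSize I.lam + ratSize I.pi2

/-- On input an edge of `𝒩`, given by one of its vertices `u` and its kind, the program `prog`
outputs (in register 0) whether the edge is directed away from `u` (1) or towards `u` (0). It uses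
a number of field and register operations bounded by `T (m + n)`, for real data; and on rational
data its logarithmic cost is bounded by `T` of the bit length of the input. -/
def ComputesDirection {m n : ℕ} {A C : Matrix (Fin m) (Fin n) ℝ} {β : Fin n → ℝ}
    (prog : Prog) (T : Polynomial ℕ)
    (dir : NEdges A C β → Option (NVert A C β) × Option (NVert A C β)) : Prop :=
  ∀ (u : NVert A C β) (k : EdgeKind),
    (((dir (edgeAt u k)).1 = some u →
        (prog.run (fun _ => 0) (initState (vertexInput u) k)).1.reg 0 = 1) ∧
      ((dir (edgeAt u k)).2 = some u →
        (prog.run (fun _ => 0) (initState (vertexInput u) k)).1.reg 0 = 0) ∧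
      (prog.run (fun _ => 0) (initState (vertexInput u) k)).2 ≤ T.eval (m + n)) ∧
    ∀ I : InputData ℚ m n, I.toReal = vertexInput u →
      ((dir (edgeAt u k)).1 = some u → (prog.run ratSize (initState I k)).1.reg 0 = 1) ∧
      ((dir (edgeAt u k)).2 = some u → (prog.run ratSize (initState I k)).1.reg 0 = 0) ∧
      (prog.run ratSize (initState I k)).2 ≤ T.eval I.bitLength

/-- The vertex of `P` with support pair `({i}, {j})`. -/
def pureVertex {m n : ℕ} (A : Matrix (Fin m) (Fin n) ℝ) (i : Fin m) (j : Fin n) : PPoint n :=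
  (Pi.single j 1, A i j)

/-! Geometry. Both polyhedra are pointed and simple, so a vertex is a point with exactly `n` (for
`P`) or `m + 1` (for `Q'`) tight inequalities, and these are linearly independent. A vertex `(v, w)`
of `𝒩` therefore carries `m + n + 1` labels, exactly one of them twice. Giving up the duplicate
label in `v` or in `w` produces the two edges at `(v, w)`. By the ratio test such an edge is a
segment with two vertices or a ray with one (`IsSimplePolyhedron.ray_or_segment`), so `𝒩` consists
of paths and cycles along which the two kinds of edges alternate. In `P` a ray would move `π₁`
alone, which is incompatible with `∑ x_i = 1` (`inP_segment`). In `Q'` a ray moves only `lam` and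
`π₂`, so `y` is supported where `β` is minimal or maximal; this leaves `v_s` and `v_e`
(`eq_pureVertex_of_ray`, `exists_end_vertex`). The handshaking lemma, applied to the component of
one ray, connects the two (`reachable_of_ray`).

Signs. All variables are collected in one square matrix with one row per label: the inequality of
`P` if the label is tight at `v`, that of `Q'` otherwise. The two normalising equations are added,
and in the last row the inequality of `Q'` for the duplicate label. Along an edge `(v, ℰ_v)` only
the last row changes, and the edge direction is annihilated by all other rows. By Cramer's rule
(`det_updateRow_mul_dotProduct`) the determinants at the two ends are in the ratio of the values of
the two last rows on this direction. One label is lost and the other gained along the edge, so these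
values have opposite signs (`det_mul_neg_inQ`). The edges `(ℰ_w, w)` are treated in the same way
after exchanging the roles of `P` and `Q'`, which is a single row transposition
(`det_pairMatrix_swap`, `det_mul_neg_inP`). A count of column exchanges shows that `det E(u)` is
this determinant times `-(-1)^(m+n)`, regardless of the side on which the duplicate label lies
(`det_matrixE`). Since sign and kind of edge both alternate along a trail, the local rule for
directions is globally consistent (`directed_trail`). The signs at the two rays follow from Cramer's
rule with the ray direction and an explicitly triangular matrix (`det_pairMatrix_single`).

Computation. The program rebuilds the matrix from the coordinates of `u` by sign tests on the slacks
and evaluates its determinant by the Faddeev–LeVerrier recursion (`flMatrix_det`). This recursion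
needs no pivoting and divides only by `1, …, N`. Hence a fixed power of one common denominator
clears all intermediate results, and bit lengths stay polynomial (`SizeGrading.rat`, `ratSize_le`).
The number of steps is bounded from the syntax alone, because the registers bounding the loops are
never changed inside them (`run_snd_le`). -/

/-! ## Polyhedra in standard form -/

/-- The polyhedron `{v | e v = 1, r ℓ v ≤ 0 for all ℓ}`. -/
def polyhedron {V ι : Type*} [AddCommGroup V] [Module ℝ V] (e : V →ₗ[ℝ] ℝ) (r : ι → V →ₗ[ℝ] ℝ) :
    Set V :=
  {v | e v = 1 ∧ ∀ ℓ, r ℓ v ≤ 0}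

/-- The inequalities of `polyhedron e r` that are tight at `v`. -/
def tight {V ι : Type*} [AddCommGroup V] [Module ℝ V] (r : ι → V →ₗ[ℝ] ℝ) (v : V) : Set ι :=
  {ℓ | r ℓ v = 0}

/-- A pointed polyhedron of dimension at most `d`, no point of which satisfies more than `d`
inequalities with equality. -/
structure IsSimplePolyhedron {V ι : Type*} [AddCommGroup V] [Module ℝ V] (e : V →ₗ[ℝ] ℝ)
    (r : ι → V →ₗ[ℝ] ℝ) (d : ℕ) : Prop where
  finiteDimensional : FiniteDimensional ℝ V
  finrank_eq : Module.finrank ℝ V = d + 1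
  pointed : ∀ z, e z = 0 → (∀ ℓ, r ℓ z = 0) → z = 0
  nondeg : ∀ v ∈ polyhedron e r, (tight r v).ncard ≤ d

section Polyhedron

variable {V ι : Type*} [AddCommGroup V] [Module ℝ V] {e : V →ₗ[ℝ] ℝ} {r : ι → V →ₗ[ℝ] ℝ} {d : ℕ}

theorem mem_tight {v : V} {ℓ : ι} : ℓ ∈ tight r v ↔ r ℓ v = 0 := Iff.rfl

/-- A small step along a direction that violates no tight inequality stays in the polyhedron. -/
theorem exists_small_step [Finite ι] {v z : V} (hv : v ∈ polyhedron e r) (hz : e z = 0)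
    (ht : ∀ ℓ ∈ tight r v, r ℓ z ≤ 0) : ∃ t : ℝ, 0 < t ∧ v + t • z ∈ polyhedron e r := by
  have key : ∀ᶠ t : ℝ in nhdsWithin 0 (Set.Ioi 0), ∀ ℓ, r ℓ v + t * r ℓ z ≤ 0 := by
    rw [Filter.eventually_all]
    intro ℓ
    rcases eq_or_lt_of_le (hv.2 ℓ) with h | h
    · filter_upwards [self_mem_nhdsWithin] with t (htp : 0 < t)
      rw [h, zero_add]
      exact mul_nonpos_of_nonneg_of_nonpos htp.le (ht ℓ h)
    · have hc : Continuous fun t : ℝ => r ℓ v + t * r ℓ z := by fun_prop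
      have : ∀ᶠ t : ℝ in nhds 0, r ℓ v + t * r ℓ z < 0 :=
        hc.continuousAt.eventually_lt continuousAt_const (by simpa using h)
      exact (this.filter_mono nhdsWithin_le_nhds).mono fun _ => le_of_lt
  obtain ⟨t, h1, h2⟩ := (key.and self_mem_nhdsWithin).exists
  refine ⟨t, h2, ?_, fun ℓ => ?_⟩
  · simp [hv.1, hz]
  · simpa using h1 ℓ

/-- The ratio test. -/
theorem exists_ratio_step [Finite ι] {v z : V} (hv : v ∈ polyhedron e r) (hz : e z = 0)
    (ht : ∀ ℓ ∈ tight r v, r ℓ z ≤ 0) (hp : ∃ ℓ, 0 < r ℓ z) :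
    ∃ t : ℝ, 0 < t ∧ v + t • z ∈ polyhedron e r ∧ ∃ ℓ, 0 < r ℓ z ∧ ℓ ∈ tight r (v + t • z) := by
  -- Among the inequalities that grow along `z`, the one with the least ratio of slack to growth is
  -- the first to become tight.
  obtain ⟨ℓ, hℓ, hmin⟩ := Set.exists_min_image {ℓ | 0 < r ℓ z} (fun ℓ => -r ℓ v / r ℓ z)
    (Set.toFinite _) hp
  have hneg : ∀ k, 0 < r k z → r k v < 0 := fun k hk =>
    lt_of_le_of_ne (hv.2 k) fun h => absurd (ht k h) (not_le.2 hk)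
  have hℓ' : 0 < r ℓ z := hℓ
  have htpos : 0 < -r ℓ v / r ℓ z := div_pos (neg_pos.2 (hneg ℓ hℓ)) hℓ
  refine ⟨_, htpos, ⟨by simp [hv.1, hz], fun k => ?_⟩, ℓ, hℓ, ?_⟩
  · simp only [map_add, map_smul, smul_eq_mul]
    rcases le_or_gt (r k z) 0 with h | h
    · have := mul_nonpos_of_nonneg_of_nonpos htpos.le h
      linarith [hv.2 k]
    · have := hmin k h
      rw [le_div_iff₀ h] at this
      linarith
  · change r ℓ _ = 0
    simp only [map_add, map_smul, smul_eq_mul]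
    field_simp
    ring

theorem tight_add_smul {v z : V} {ℓ : ι} (t : ℝ) (hℓ : ℓ ∈ tight r v) (hz : r ℓ z = 0) :
    ℓ ∈ tight r (v + t • z) := by
  have : r ℓ v = 0 := hℓ
  change r ℓ _ = 0
  simp [this, hz]

namespace IsSimplePolyhedron

/-- A direction along which no inequality grows in either orientation would be annihilated by all of
them, against pointedness. Thus one of `z`, `-z` is always open to the ratio test. -/
theorem exists_pos_dir (h : IsSimplePolyhedron e r d) {z : V} (hz : e z = 0) (h0 : z ≠ 0) :
    ∃ z' : V, (z' = z ∨ z' = -z) ∧ e z' = 0 ∧ ∃ ℓ, 0 < r ℓ z' := by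
  by_contra! hcon
  refine h0 (h.pointed z hz fun ℓ => le_antisymm (hcon z (Or.inl rfl) hz ℓ) ?_)
  simpa using hcon (-z) (Or.inr rfl) (by simp [hz]) ℓ

/-- A point with a nonzero direction that keeps all tight inequalities tight can be moved to a
point with more tight inequalities. -/
theorem exists_more_tight [Finite ι] (h : IsSimplePolyhedron e r d) {v z : V}
    (hv : v ∈ polyhedron e r) (hz : e z = 0) (ht : ∀ ℓ ∈ tight r v, r ℓ z = 0) (h0 : z ≠ 0) :
    ∃ v' ∈ polyhedron e r, tight r v ⊂ tight r v' := by
  obtain ⟨z', hz', hez', hp⟩ := h.exists_pos_dir hz h0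
  have ht' : ∀ ℓ ∈ tight r v, r ℓ z' = 0 := by
    rcases hz' with rfl | rfl
    · exact ht
    · intro ℓ hℓ
      simp [ht ℓ hℓ]
  obtain ⟨t, -, hmem, ℓ, hℓ, hℓ'⟩ := exists_ratio_step hv hez' (fun ℓ hℓ => (ht' ℓ hℓ).le) hp
  refine ⟨_, hmem, fun k hk => tight_add_smul t hk (ht' k hk), fun hsub => ?_⟩
  exact absurd (ht' ℓ (hsub hℓ')) hℓ.ne'

/-- At a point with `d` tight inequalities these are linearly independent. -/
theorem eq_zero_of_tight [Finite ι] (h : IsSimplePolyhedron e r d) {v z : V}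
    (hv : v ∈ polyhedron e r) (hd : (tight r v).ncard = d) (hz : e z = 0)
    (ht : ∀ ℓ ∈ tight r v, r ℓ z = 0) : z = 0 := by
  -- Moving along `z` or `-z` would keep the `d` tight inequalities and add one more, which
  -- non-degeneracy forbids.
  by_contra h0
  obtain ⟨v', hv', hss⟩ := h.exists_more_tight hv hz ht h0
  have := Set.ncard_lt_ncard hss (Set.toFinite _)
  have := h.nondeg v' hv'
  omega

/-- Dimension count: `e` and fewer than `d` inequalities are at most `d` linear conditions on a
space of dimension `d + 1`. -/
theorem exists_dir [Finite ι] (h : IsSimplePolyhedron e r d) {S : Set ι} (hS : S.ncard < d) :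
    ∃ z : V, z ≠ 0 ∧ e z = 0 ∧ ∀ ℓ ∈ S, r ℓ z = 0 := by
  classical
  have := h.finiteDimensional
  have := Fintype.ofFinite ι
  have : Fintype S := Fintype.ofFinite S
  let f : V →ₗ[ℝ] ℝ × (S → ℝ) := e.prod (LinearMap.pi fun ℓ : S => r ℓ)
  have hlt : Module.finrank ℝ (ℝ × (S → ℝ)) < Module.finrank ℝ V := by
    rw [h.finrank_eq, Module.finrank_prod, Module.finrank_self, Module.finrank_fintype_fun_eq_card,
      ← Nat.card_eq_fintype_card, Nat.card_coe_set_eq]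
    omega
  have hker := LinearMap.ker_ne_bot_of_finrank_lt (f := f) hlt
  obtain ⟨z, hz, h0⟩ := (Submodule.ne_bot_iff _).1 hker
  have hz' : e z = 0 ∧ (fun ℓ : S => r ℓ z) = 0 := by
    simpa [f, Prod.ext_iff, LinearMap.pi_apply, funext_iff] using hz
  exact ⟨z, h0, hz'.1, fun ℓ hℓ => congrFun hz'.2 ⟨ℓ, hℓ⟩⟩

/-- The vertices are the points with `d` tight inequalities. -/
theorem mem_extremePoints_iff [Finite ι] (h : IsSimplePolyhedron e r d) {v : V} :
    v ∈ Set.extremePoints ℝ (polyhedron e r) ↔ v ∈ polyhedron e r ∧ (tight r v).ncard = d := by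
  constructor
  · intro hv
    refine ⟨hv.1, le_antisymm (h.nondeg v hv.1) ?_⟩
    by_contra! hlt
    obtain ⟨z, h0, hz, ht⟩ := h.exists_dir hlt
    obtain ⟨t, htp, hmem⟩ := exists_small_step hv.1 hz fun ℓ hℓ => (ht ℓ hℓ).le
    obtain ⟨t', htp', hmem'⟩ := exists_small_step (z := -z) hv.1 (by simp [hz])
      fun ℓ hℓ => by simp [ht ℓ hℓ]
    have hseg : v ∈ openSegment ℝ (v + t • z) (v + t' • -z) := by
      -- The steps in the two directions may have different lengths `t` and `t'`; these weights make
      -- the displacements cancel.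
      refine ⟨t' / (t + t'), t / (t + t'), by positivity, by positivity, by field_simp; ring, ?_⟩
      have h1 : t' / (t + t') + t / (t + t') = 1 := by field_simp; ring
      have h2 : t' / (t + t') * t - t / (t + t') * t' = 0 := by field_simp; ring
      calc _ = (t' / (t + t') + t / (t + t')) • v +
            (t' / (t + t') * t - t / (t + t') * t') • z := by module
        _ = v := by rw [h1, h2]; simp
    have := hv.2 hmem hmem' hseg
    have : t • z = 0 := by simpa using this
    rcases smul_eq_zero.1 this with h' | h'
    · exact htp.ne' h'
    · exact h0 h'
  · rintro ⟨hv, hd⟩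
    refine ⟨hv, fun a ha b hb hseg => ?_⟩
    obtain ⟨s, t, hs, ht, hst, rfl⟩ := hseg
    -- A convex combination of nonpositive numbers with positive weights vanishes only if each of
    -- them does, so `a` satisfies all tight inequalities with equality too.
    have : a - (s • a + t • b) = 0 := by
      refine h.eq_zero_of_tight hv hd (by rw [map_sub, ha.1, hv.1, sub_self]) fun ℓ hℓ => ?_
      have h1 : r ℓ (s • a + t • b) = 0 := hℓ
      rw [map_sub, h1, sub_zero]
      simp only [map_add, map_smul, smul_eq_mul] at h1
      have h2 := mul_nonpos_of_nonneg_of_nonpos hs.le (ha.2 ℓ)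
      have h3 := mul_nonpos_of_nonneg_of_nonpos ht.le (hb.2 ℓ)
      have h4 : s * r ℓ a = 0 := by linarith
      rcases mul_eq_zero.1 h4 with h' | h'
      · exact absurd h' hs.ne'
      · exact h'
    exact sub_eq_zero.1 this

/-- The difference of the two points is annihilated by the `d` independent tight inequalities: a
vertex is determined by its labels. -/
theorem eq_of_tight_subset [Finite ι] (h : IsSimplePolyhedron e r d) {v v' : V}
    (hv : v ∈ polyhedron e r) (hd : (tight r v).ncard = d) (hv' : v' ∈ polyhedron e r)
    (hs : tight r v ⊆ tight r v') : v' = v := by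
  refine sub_eq_zero.1 (h.eq_zero_of_tight hv hd (by simp [hv.1, hv'.1]) fun ℓ hℓ => ?_)
  have h1 : r ℓ v = 0 := hℓ
  have h2 : r ℓ v' = 0 := hs hℓ
  simp [h1, h2]

theorem finite_extremePoints [Finite ι] (h : IsSimplePolyhedron e r d) :
    (Set.extremePoints ℝ (polyhedron e r)).Finite := by
  refine Set.Finite.of_finite_image (f := tight r) (Set.toFinite _) fun v hv v' hv' heq => ?_
  rw [h.mem_extremePoints_iff] at hv hv'
  exact (h.eq_of_tight_subset hv.1 hv.2 hv'.1 heq.le).symm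

/-- Every nonempty face contains a vertex. -/
theorem exists_vertex_of_face [Finite ι] (h : IsSimplePolyhedron e r d) {S : Set ι} {v : V}
    (hv : v ∈ polyhedron e r) (hS : S ⊆ tight r v) :
    ∃ v' ∈ polyhedron e r, S ⊆ tight r v' ∧ (tight r v').ncard = d := by
  have hfin : {T : Set ι | ∃ v ∈ polyhedron e r, S ⊆ T ∧ T = tight r v}.Finite := Set.toFinite _
  -- A point of the face with a maximal set of tight inequalities is a vertex, since with fewer than
  -- `d` of them the set could be enlarged.
  obtain ⟨T, hT⟩ := hfin.exists_maximal ⟨_, v, hv, hS, rfl⟩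
  obtain ⟨w, hw, hSw, rfl⟩ := hT.prop
  refine ⟨w, hw, hSw, le_antisymm (h.nondeg w hw) ?_⟩
  by_contra! hlt
  obtain ⟨z, h0, hz, ht⟩ := h.exists_dir hlt
  obtain ⟨w', hw', hss⟩ := h.exists_more_tight hw hz ht h0
  exact hss.2 (hT.le_of_ge ⟨w', hw', hSw.trans hss.1, rfl⟩ hss.1)

/-- The direction of the edge with label set `S` at a vertex. -/
theorem exists_edge_dir [Finite ι] (h : IsSimplePolyhedron e r d) {S : Set ι} {v : V} {l : ι}
    (hv : v ∈ polyhedron e r) (hd : (tight r v).ncard = d) (hl : l ∉ S)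
    (hS : tight r v = insert l S) :
    ∃ z : V, e z = 0 ∧ (∀ ℓ ∈ S, r ℓ z = 0) ∧ r l z = -1 ∧
      ∀ v' ∈ polyhedron e r, S ⊆ tight r v' → ∃ t : ℝ, 0 ≤ t ∧ v' = v + t • z := by
  have hcard : S.ncard < d := by
    rw [← hd, hS, Set.ncard_insert_of_notMem hl (Set.toFinite _)]
    omega
  obtain ⟨z, h0, hz, ht⟩ := h.exists_dir hcard
  have hlz : r l z ≠ 0 := by
    intro hcon
    refine h0 (h.eq_zero_of_tight hv hd hz fun ℓ hℓ => ?_)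
    rw [hS] at hℓ
    rcases hℓ with rfl | hℓ
    · exact hcon
    · exact ht ℓ hℓ
  -- The direction is scaled so that the dropped inequality `l` decreases at unit speed; the
  -- parameter of a point `v'` on the edge is then its slack `-r l v'`.
  refine ⟨(-(r l z)⁻¹) • z, by simp [hz], fun ℓ hℓ => by simp [ht ℓ hℓ], by simp [hlz],
    fun v' hv' hSv' => ⟨-r l v', by linarith [hv'.2 l], ?_⟩⟩
  have hlv : r l v = 0 := (hS ▸ Set.mem_insert l S : l ∈ tight r v)
  rw [smul_smul, ← sub_eq_zero]
  refine h.eq_zero_of_tight hv hd (by simp [hv.1, hv'.1, hz]) fun ℓ hℓ => ?_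
  have hℓv : r ℓ v = 0 := hℓ
  rw [hS] at hℓ
  rcases hℓ with rfl | hℓ
  · simp [hlv, hlz]
  · have : r ℓ v' = 0 := hSv' hℓ
    simp [this, hℓv, ht ℓ hℓ]

/-- An edge at a vertex contains a further point. -/
theorem exists_ne_of_edge [Finite ι] (h : IsSimplePolyhedron e r d) {S : Set ι} {v : V} {l : ι}
    (hv : v ∈ polyhedron e r) (hd : (tight r v).ncard = d) (hl : l ∉ S)
    (hS : tight r v = insert l S) : ∃ v' ∈ polyhedron e r, S ⊆ tight r v' ∧ v' ≠ v := by
  obtain ⟨z, hz, ht, hlz, -⟩ := h.exists_edge_dir hv hd hl hS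
  obtain ⟨t, htp, hmem⟩ := exists_small_step hv hz fun ℓ hℓ => by
    rw [hS] at hℓ
    rcases hℓ with rfl | hℓ
    · linarith
    · exact (ht ℓ hℓ).le
  refine ⟨_, hmem, fun ℓ hℓ => tight_add_smul t (hS ▸ Set.mem_insert_of_mem l hℓ) (ht ℓ hℓ), ?_⟩
  intro hcon
  have : r l (v + t • z) = r l v := by rw [hcon]
  simp [hlz] at this
  exact htp.ne' this

/-- An edge at a vertex is a ray, or it contains exactly one further vertex. -/
theorem ray_or_segment [Finite ι] (h : IsSimplePolyhedron e r d) {S : Set ι} {v : V} {l : ι}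
    (hv : v ∈ polyhedron e r) (hd : (tight r v).ncard = d) (hl : l ∉ S)
    (hS : tight r v = insert l S) :
    ((∃ z : V, e z = 0 ∧ (∀ ℓ ∈ S, r ℓ z = 0) ∧ r l z = -1 ∧ ∀ ℓ, r ℓ z ≤ 0) ∧
      ∀ v' ∈ polyhedron e r, S ⊆ tight r v' → (tight r v').ncard = d → v' = v) ∨
    ∃ v' ∈ polyhedron e r, S ⊆ tight r v' ∧ (tight r v').ncard = d ∧ v' ≠ v ∧
      ∀ v'' ∈ polyhedron e r, S ⊆ tight r v'' → (tight r v'').ncard = d → v'' = v ∨ v'' = v' := by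
  obtain ⟨z, hz, ht, hlz, hpar⟩ := h.exists_edge_dir hv hd hl hS
  have hdS : d = S.ncard + 1 := by
    rw [← hd, hS, Set.ncard_insert_of_notMem hl (Set.toFinite _)]
  have hlv : r l v = 0 := (hS ▸ Set.mem_insert l S : l ∈ tight r v)
  -- the label picked up at a further vertex
  have hnew : ∀ v' ∈ polyhedron e r, S ⊆ tight r v' → (tight r v').ncard = d → v' ≠ v →
      ∃ t : ℝ, v' = v + t • z ∧ ∃ k, 0 < r k z ∧ k ∈ tight r v' := by
    intro v' hv' hSv' hd' hne
    obtain ⟨t, ht0, rfl⟩ := hpar v' hv' hSv'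
    have htp : 0 < t := by
      rcases ht0.eq_or_lt with rfl | h'
      · simp at hne
      · exact h'
    -- `S` has only `d - 1` elements while the vertex has `d` tight inequalities.
    obtain ⟨k, hk, hkS⟩ : ∃ k ∈ tight r (v + t • z), k ∉ S := by
      by_contra! hcon
      have := Set.ncard_le_ncard (show tight r (v + t • z) ⊆ S from hcon) (Set.toFinite _)
      omega
    refine ⟨t, rfl, k, ?_, hk⟩
    have hk0 : r k v + t * r k z = 0 := by simpa [mem_tight] using hk
    have hkl : k ≠ l := by
      rintro rfl
      rw [hlv, hlz] at hk0
      linarith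
    have hkv : r k v < 0 := by
      refine lt_of_le_of_ne (hv.2 k) fun h' => ?_
      have : k ∈ tight r v := h'
      rw [hS] at this
      exact this.elim hkl hkS
    by_contra! hle
    have := mul_nonpos_of_nonneg_of_nonpos htp.le hle
    linarith
  by_cases hp : ∃ ℓ, 0 < r ℓ z
  · right
    obtain ⟨t, htp, hmem, k, hk, hkt⟩ := exists_ratio_step hv hz (fun ℓ hℓ => by
      rw [hS] at hℓ
      rcases hℓ with rfl | hℓ
      · linarith
      · exact (ht ℓ hℓ).le) hp
    have hSt : S ⊆ tight r (v + t • z) := fun ℓ hℓ =>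
      tight_add_smul t (hS ▸ Set.mem_insert_of_mem l hℓ) (ht ℓ hℓ)
    have hkS : k ∉ S := fun hcon => hk.ne' (ht k hcon)
    refine ⟨_, hmem, hSt, ?_, ?_, ?_⟩
    · refine le_antisymm (h.nondeg _ hmem) ?_
      rw [hdS, ← Set.ncard_insert_of_notMem hkS (Set.toFinite _)]
      exact Set.ncard_le_ncard (Set.insert_subset hkt hSt) (Set.toFinite _)
    · intro hcon
      have : r l (v + t • z) = r l v := by rw [hcon]
      simp [hlz] at this
      exact htp.ne' this
    · intro v'' hv'' hSv'' hd''
      by_cases hne : v'' = v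
      · exact Or.inl hne
      · right
        obtain ⟨t', rfl, k', hk', hkt'⟩ := hnew v'' hv'' hSv'' hd'' hne
        have e1 : r k v + t * r k z = 0 := by simpa [mem_tight] using hkt
        have e2 : r k' v + t' * r k' z = 0 := by simpa [mem_tight] using hkt'
        have e3 : r k' v + t * r k' z ≤ 0 := by simpa using hmem.2 k'
        have e4 : r k v + t' * r k z ≤ 0 := by simpa using hv''.2 k
        -- Each of the two end points satisfies the inequality that blocks the other, which bounds
        -- either parameter by the other one.
        have h1 : t ≤ t' := le_of_mul_le_mul_right (by linarith) hk'
        have h2 : t' ≤ t := le_of_mul_le_mul_right (by linarith) hk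
        rw [le_antisymm h1 h2]
  · left
    push Not at hp
    refine ⟨⟨z, hz, ht, hlz, hp⟩, fun v' hv' hSv' hd' => ?_⟩
    by_contra hne
    obtain ⟨-, -, k, hk, -⟩ := hnew v' hv' hSv' hd' hne
    exact absurd hk (not_lt.2 (hp k))

end IsSimplePolyhedron

end Polyhedron

/-! ## The two polyhedra -/

/-- The left-hand side of `∑ y_j = 1`. -/
noncomputable def eqP (n : ℕ) : PPoint n →ₗ[ℝ] ℝ :=
  ∑ j, LinearMap.proj j ∘ₗ LinearMap.fst ℝ (Fin n → ℝ) ℝ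

/-- The left-hand side of `∑ x_i = 1`. -/
noncomputable def eqQ (m : ℕ) : QPoint m →ₗ[ℝ] ℝ :=
  ∑ i, LinearMap.proj i ∘ₗ LinearMap.fst ℝ (Fin m → ℝ) (ℝ × ℝ)

/-- The left-hand sides of the inequalities of `P`, in the form `≤ 0`. -/
noncomputable def ineqP {m n : ℕ} (A : Matrix (Fin m) (Fin n) ℝ) :
    Fin m ⊕ Fin n → PPoint n →ₗ[ℝ] ℝ
  | .inl i => (∑ j, A i j • (LinearMap.proj j ∘ₗ LinearMap.fst ℝ (Fin n → ℝ) ℝ)) -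
      LinearMap.snd ℝ (Fin n → ℝ) ℝ
  | .inr j => -(LinearMap.proj j ∘ₗ LinearMap.fst ℝ (Fin n → ℝ) ℝ)

/-- The left-hand sides of the inequalities of `Q'`, in the form `≤ 0`. -/
noncomputable def ineqQ {m n : ℕ} (C : Matrix (Fin m) (Fin n) ℝ) (β : Fin n → ℝ) :
    Fin m ⊕ Fin n → QPoint m →ₗ[ℝ] ℝ
  | .inl i => -(LinearMap.proj i ∘ₗ LinearMap.fst ℝ (Fin m → ℝ) (ℝ × ℝ))
  | .inr j => (∑ i, C i j • (LinearMap.proj i ∘ₗ LinearMap.fst ℝ (Fin m → ℝ) (ℝ × ℝ))) +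
      β j • (LinearMap.fst ℝ ℝ ℝ ∘ₗ LinearMap.snd ℝ (Fin m → ℝ) (ℝ × ℝ)) -
      LinearMap.snd ℝ ℝ ℝ ∘ₗ LinearMap.snd ℝ (Fin m → ℝ) (ℝ × ℝ)

section

variable {m n : ℕ} {A C : Matrix (Fin m) (Fin n) ℝ} {β : Fin n → ℝ}

@[simp] theorem eqP_apply (v : PPoint n) : eqP n v = ∑ j, v.1 j := by
  simp [eqP]

@[simp] theorem eqQ_apply (w : QPoint m) : eqQ m w = ∑ i, w.1 i := by
  simp [eqQ]

@[simp] theorem ineqP_inl (i : Fin m) (v : PPoint n) :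
    ineqP A (.inl i) v = (∑ j, A i j * v.1 j) - v.2 := by
  simp [ineqP]

@[simp] theorem ineqP_inr (j : Fin n) (v : PPoint n) : ineqP A (.inr j) v = -v.1 j := by
  simp [ineqP]

@[simp] theorem ineqQ_inl (i : Fin m) (w : QPoint m) : ineqQ C β (.inl i) w = -w.1 i := by
  simp [ineqQ]

@[simp] theorem ineqQ_inr (j : Fin n) (w : QPoint m) :
    ineqQ C β (.inr j) w = (∑ i, w.1 i * C i j) + β j * w.2.1 - w.2.2 := by
  simp [ineqQ, mul_comm]

theorem polyP_eq : polyP A = polyhedron (eqP n) (ineqP A) := by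
  ext v
  simp [polyP, polyhedron]
  tauto

theorem polyQ_eq : polyQ C β = polyhedron (eqQ m) (ineqQ C β) := by
  ext w
  simp [polyQ, polyhedron]
  tauto

theorem labelP_eq (v : PPoint n) : labelP A v = tight (ineqP A) v := by
  ext l
  cases l <;> simp [labelP, tight]

theorem labelQ_eq (w : QPoint m) : labelQ C β w = tight (ineqQ C β) w := by
  ext l
  cases l <;> simp [labelQ, tight]

/-- Pointedness needs a row of `A`: the sign constraints only give `y = 0`, and a payoff inequality
is required to fix `π₁`. -/
theorem isSimplePolyhedron_P [Nonempty (Fin m)] (h : NondegP A) :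
    IsSimplePolyhedron (eqP n) (ineqP A) n where
  finiteDimensional := inferInstance
  finrank_eq := by simp
  pointed z _ hr := by
    have h1 : z.1 = 0 := by
      ext j
      simpa using hr (.inr j)
    have h2 := hr (.inl (Classical.arbitrary _))
    simp [h1] at h2
    exact Prod.ext h1 h2
  nondeg v hv := by
    rw [← polyP_eq] at hv
    rw [← labelP_eq]
    exact h v hv

/-- For `x = 0` the equations `β_j lam = π₂` for two different values of `β` leave only `lam = π₂ =
0`; for constant `β` the polyhedron would contain a line. -/
theorem isSimplePolyhedron_Q {j j' : Fin n} (hβ : β j ≠ β j') (h : NondegQ C β) :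
    IsSimplePolyhedron (eqQ m) (ineqQ C β) (m + 1) where
  finiteDimensional := inferInstance
  finrank_eq := by simp
  pointed z _ hr := by
    have h1 : z.1 = 0 := by
      ext i
      simpa using hr (.inl i)
    have h2 := hr (.inr j)
    have h3 := hr (.inr j')
    simp [h1] at h2 h3
    have h4 : (β j - β j') * z.2.1 = 0 := by linarith
    have h5 : z.2.1 = 0 := (mul_eq_zero.1 h4).resolve_left (sub_ne_zero.2 hβ)
    have h6 : z.2.2 = 0 := by
      rw [h5] at h2
      linarith
    exact Prod.ext h1 (Prod.ext h5 h6)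
  nondeg w hw := by
    rw [← polyQ_eq] at hw
    rw [← labelQ_eq]
    exact h w hw

/-- This exhibits `ℰ_v` as a face of `Q'`, given by the labels missing at `v`, so that the lemmas on
faces and edges of simple polyhedra apply. -/
theorem mem_fiberP_iff {v : PPoint n} (hv : v ∈ polyP A) {w : QPoint m} :
    w ∈ fiberP A C β v ↔ w ∈ polyhedron (eqQ m) (ineqQ C β) ∧
      (tight (ineqP A) v)ᶜ ⊆ tight (ineqQ C β) w := by
  simp only [fiberP, fullyLabeled, Set.mem_ofPred_eq, hv, true_and, polyQ_eq, labelP_eq, labelQ_eq]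
  refine and_congr_right fun _ => ?_
  rw [Set.compl_subset_iff_union]

theorem mem_fiberQ_iff {w : QPoint m} (hw : w ∈ polyQ C β) {v : PPoint n} :
    v ∈ fiberQ A C β w ↔ v ∈ polyhedron (eqP n) (ineqP A) ∧
      (tight (ineqQ C β) w)ᶜ ⊆ tight (ineqP A) v := by
  simp only [fiberQ, fullyLabeled, Set.mem_ofPred_eq, hw, true_and, polyP_eq, labelP_eq, labelQ_eq]
  refine and_congr_right fun _ => ?_
  rw [Set.compl_subset_iff_union, Set.union_comm]

end

/-! ## Vertices and edges of `𝒩` -/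

/-- The hypotheses of the theorem, except for the choice of best responses. -/
structure IsGameSpace {m n : ℕ} (A C : Matrix (Fin m) (Fin n) ℝ) (β : Fin n → ℝ)
    (jₛ jₑ : Fin n) : Prop where
  simpleP : IsSimplePolyhedron (eqP n) (ineqP A) n
  simpleQ : IsSimplePolyhedron (eqQ m) (ineqQ C β) (m + 1)
  ne : jₛ ≠ jₑ
  min : ∀ j, j ≠ jₛ → β jₛ < β j
  max : ∀ j, j ≠ jₑ → β j < β jₑ

namespace IsGameSpace

variable {m n : ℕ} {A C : Matrix (Fin m) (Fin n) ℝ} {β : Fin n → ℝ} {jₛ jₑ : Fin n}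

theorem vertexP_iff (h : IsGameSpace A C β jₛ jₑ) {v : PPoint n} :
    v ∈ Set.extremePoints ℝ (polyP A) ↔
      v ∈ polyhedron (eqP n) (ineqP A) ∧ (tight (ineqP A) v).ncard = n := by
  rw [polyP_eq, h.simpleP.mem_extremePoints_iff]

theorem vertexQ_iff (h : IsGameSpace A C β jₛ jₑ) {w : QPoint m} :
    w ∈ Set.extremePoints ℝ (polyQ C β) ↔
      w ∈ polyhedron (eqQ m) (ineqQ C β) ∧ (tight (ineqQ C β) w).ncard = m + 1 := by
  rw [polyQ_eq, h.simpleQ.mem_extremePoints_iff]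

/-- Inclusion–exclusion: `n + (m + 1)` tight inequalities cover `m + n` labels. -/
theorem exists_dup (h : IsGameSpace A C β jₛ jₑ) (u : NVert A C β) :
    ∃ l, tight (ineqP A) u.1.1 ∩ tight (ineqQ C β) u.1.2 = {l} := by
  rw [← Set.ncard_eq_one]
  have h1 := (h.vertexP_iff.1 u.2.2.1).2
  have h2 := (h.vertexQ_iff.1 u.2.2.2).2
  have h3 := u.2.1.2.2
  rw [labelP_eq, labelQ_eq] at h3
  have h4 := Set.ncard_union_add_ncard_inter (tight (ineqP A) u.1.1) (tight (ineqQ C β) u.1.2)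
  rw [h3, Set.ncard_univ, h1, h2] at h4
  simp at h4
  omega

/-- The duplicate label. -/
noncomputable def dup (h : IsGameSpace A C β jₛ jₑ) (u : NVert A C β) : Fin m ⊕ Fin n :=
  (h.exists_dup u).choose

theorem inter_eq (h : IsGameSpace A C β jₛ jₑ) (u : NVert A C β) :
    tight (ineqP A) u.1.1 ∩ tight (ineqQ C β) u.1.2 = {h.dup u} :=
  (h.exists_dup u).choose_spec

theorem union_eq (u : NVert A C β) :
    tight (ineqP A) u.1.1 ∪ tight (ineqQ C β) u.1.2 = Set.univ := by
  have h3 := u.2.1.2.2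
  rwa [labelP_eq, labelQ_eq] at h3

/-- The form needed for edges: without the duplicate label, exactly those labels remain that a point
of `ℰ_v` must have. -/
theorem tightQ_eq (h : IsGameSpace A C β jₛ jₑ) (u : NVert A C β) :
    tight (ineqQ C β) u.1.2 = insert (h.dup u) (tight (ineqP A) u.1.1)ᶜ := by
  ext ℓ
  have h1 := Set.ext_iff.1 (h.inter_eq u) ℓ
  have h2 := Set.ext_iff.1 (union_eq u) ℓ
  simp only [Set.mem_inter_iff, Set.mem_singleton_iff, Set.mem_union, Set.mem_univ, iff_true,
    Set.mem_insert_iff, Set.mem_compl_iff] at h1 h2 ⊢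
  tauto

theorem tightP_eq (h : IsGameSpace A C β jₛ jₑ) (u : NVert A C β) :
    tight (ineqP A) u.1.1 = insert (h.dup u) (tight (ineqQ C β) u.1.2)ᶜ := by
  ext ℓ
  have h1 := Set.ext_iff.1 (h.inter_eq u) ℓ
  have h2 := Set.ext_iff.1 (union_eq u) ℓ
  simp only [Set.mem_inter_iff, Set.mem_singleton_iff, Set.mem_union, Set.mem_univ, iff_true,
    Set.mem_insert_iff, Set.mem_compl_iff] at h1 h2 ⊢
  tauto

theorem dup_mem_P (h : IsGameSpace A C β jₛ jₑ) (u : NVert A C β) :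
    h.dup u ∈ tight (ineqP A) u.1.1 := by
  rw [h.tightP_eq u]
  exact Set.mem_insert _ _

theorem dup_mem_Q (h : IsGameSpace A C β jₛ jₑ) (u : NVert A C β) :
    h.dup u ∈ tight (ineqQ C β) u.1.2 := by
  rw [h.tightQ_eq u]
  exact Set.mem_insert _ _

theorem finite_NVert (h : IsGameSpace A C β jₛ jₑ) : Finite (NVert A C β) := by
  have h1 := h.simpleP.finite_extremePoints
  have h2 := h.simpleQ.finite_extremePoints
  rw [← polyP_eq] at h1
  rw [← polyQ_eq] at h2
  exact ((h1.prod h2).subset fun u hu => ⟨hu.2.1, hu.2.2⟩ : Set.Finite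
    {u | u ∈ fullyLabeled A C β ∧ u.1 ∈ Set.extremePoints ℝ (polyP A) ∧
      u.2 ∈ Set.extremePoints ℝ (polyQ C β)}).to_subtype

theorem mem_edgeAt_inQ {u u' : NVert A C β} :
    u'.1 ∈ (edgeAt u .inQ).1 ↔ u'.1.1 = u.1.1 := by
  refine ⟨fun h' => h'.1, fun h' => ⟨h', ?_⟩⟩
  have := u'.2.1
  change (u.1.1, u'.1.2) ∈ fullyLabeled A C β
  rw [← h']
  exact this

theorem mem_edgeAt_inP {u u' : NVert A C β} :
    u'.1 ∈ (edgeAt u .inP).1 ↔ u'.1.2 = u.1.2 := by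
  refine ⟨fun h' => h'.2, fun h' => ⟨?_, h'⟩⟩
  have := u'.2.1
  change (u'.1.1, u.1.2) ∈ fullyLabeled A C β
  rw [← h']
  exact this

/-- Every edge contains a vertex. -/
theorem exists_eq_edgeAt (h : IsGameSpace A C β jₛ jₑ) (e : NEdges A C β) :
    ∃ (u : NVert A C β) (k : EdgeKind), e = edgeAt u k := by
  obtain ⟨e, ⟨⟨v₀, w₀⟩, hu₀⟩, he⟩ := e
  rcases he with ⟨v, hv, rfl⟩ | ⟨w, hw, rfl⟩
  · obtain ⟨hw1, hw2⟩ := (mem_fiberP_iff hv.1).1 hu₀.2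
    obtain ⟨w, h1, h2, h3⟩ := h.simpleQ.exists_vertex_of_face hw1 hw2
    exact ⟨⟨(v, w), (mem_fiberP_iff hv.1).2 ⟨h1, h2⟩, hv, h.vertexQ_iff.2 ⟨h1, h3⟩⟩, .inQ, rfl⟩
  · obtain ⟨hv1, hv2⟩ := (mem_fiberQ_iff hw.1).1 hu₀.1
    obtain ⟨v, h1, h2, h3⟩ := h.simpleP.exists_vertex_of_face hv1 hv2
    exact ⟨⟨(v, w), (mem_fiberQ_iff hw.1).2 ⟨h1, h2⟩, h.vertexP_iff.2 ⟨h1, h3⟩, hw⟩, .inP, rfl⟩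

/-- No edge is of both kinds. -/
theorem edgeAt_inP_ne_inQ (h : IsGameSpace A C β jₛ jₑ) (u u' : NVert A C β) :
    edgeAt u .inP ≠ edgeAt u' .inQ := by
  intro heq
  -- An edge `(ℰ_w, w)` contains two different points of `P`, whereas the `P`-component is constant
  -- on an edge `(v, ℰ_v)`.
  obtain ⟨v, h1, h2, h3⟩ := h.simpleP.exists_ne_of_edge (h.vertexP_iff.1 u.2.2.1).1
    (h.vertexP_iff.1 u.2.2.1).2 (by simpa using h.dup_mem_Q u) (h.tightP_eq u)
  have hv : (v, u.1.2) ∈ (edgeAt u .inP).1 := ⟨(mem_fiberQ_iff u.2.2.2.1).2 ⟨h1, h2⟩, rfl⟩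
  have hu : u.1 ∈ (edgeAt u .inP).1 := mem_edgeAt_inP.2 rfl
  rw [heq] at hv hu
  have hv' : v = u'.1.1 := hv.1
  exact h3 (hv'.trans (mem_edgeAt_inQ.1 hu).symm)

theorem edgeAt_inQ_eq {u u' : NVert A C β} (h : u.1.1 = u'.1.1) :
    edgeAt u .inQ = edgeAt u' .inQ := by
  refine Subtype.ext ?_
  change {u.1.1} ×ˢ fiberP A C β u.1.1 = {u'.1.1} ×ˢ fiberP A C β u'.1.1
  rw [h]

theorem edgeAt_inP_eq {u u' : NVert A C β} (h : u.1.2 = u'.1.2) :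
    edgeAt u .inP = edgeAt u' .inP := by
  refine Subtype.ext ?_
  change fiberQ A C β u.1.2 ×ˢ {u.1.2} = fiberQ A C β u'.1.2 ×ˢ {u'.1.2}
  rw [h]

/-- The edge `(v, ℰ_v)` at a vertex is a ray, or it contains exactly one further vertex. -/
theorem inQ_ray_or_segment (h : IsGameSpace A C β jₛ jₑ) (u : NVert A C β) :
    ((∃ z : QPoint m, eqQ m z = 0 ∧ (∀ ℓ ∉ tight (ineqP A) u.1.1, ineqQ C β ℓ z = 0) ∧
      ineqQ C β (h.dup u) z = -1 ∧ ∀ ℓ, ineqQ C β ℓ z ≤ 0) ∧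
      ∀ u' : NVert A C β, u'.1.1 = u.1.1 → u' = u) ∨
    ∃ u' : NVert A C β, u'.1.1 = u.1.1 ∧ u' ≠ u ∧
      ∀ u'' : NVert A C β, u''.1.1 = u.1.1 → u'' = u ∨ u'' = u' := by
  have hsub : ∀ u' : NVert A C β, u'.1.1 = u.1.1 →
      (tight (ineqP A) u.1.1)ᶜ ⊆ tight (ineqQ C β) u'.1.2 := fun u' hu' =>
    ((mem_fiberP_iff u.2.2.1.1).1 (mem_edgeAt_inQ.2 hu').2).2
  rcases h.simpleQ.ray_or_segment (h.vertexQ_iff.1 u.2.2.2).1 (h.vertexQ_iff.1 u.2.2.2).2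
    (by simpa using h.dup_mem_P u) (h.tightQ_eq u) with ⟨h1, h2⟩ | ⟨w, h1, h2, h3, h4, h5⟩
  · refine Or.inl ⟨h1, fun u' hu' => ?_⟩
    have hv := h.vertexQ_iff.1 u'.2.2.2
    exact Subtype.ext (Prod.ext hu' (h2 _ hv.1 (hsub u' hu') hv.2))
  · refine Or.inr ⟨⟨(u.1.1, w), (mem_fiberP_iff u.2.2.1.1).2 ⟨h1, h2⟩, u.2.2.1,
      h.vertexQ_iff.2 ⟨h1, h3⟩⟩, rfl, ?_, fun u' hu' => ?_⟩
    · intro heq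
      exact h4 (congrArg (fun u : NVert A C β => u.1.2) heq)
    · have hv := h.vertexQ_iff.1 u'.2.2.2
      rcases h5 _ hv.1 (hsub u' hu') hv.2 with h' | h'
      · exact Or.inl (Subtype.ext (Prod.ext hu' h'))
      · exact Or.inr (Subtype.ext (Prod.ext hu' h'))

/-- The edge `(ℰ_w, w)` at a vertex contains exactly one further vertex. -/
theorem inP_segment (h : IsGameSpace A C β jₛ jₑ) (u : NVert A C β) :
    ∃ u' : NVert A C β, u'.1.2 = u.1.2 ∧ u' ≠ u ∧
      ∀ u'' : NVert A C β, u''.1.2 = u.1.2 → u'' = u ∨ u'' = u' := by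
  have hsub : ∀ u' : NVert A C β, u'.1.2 = u.1.2 →
      (tight (ineqQ C β) u.1.2)ᶜ ⊆ tight (ineqP A) u'.1.1 := fun u' hu' =>
    ((mem_fiberQ_iff u.2.2.2.1).1 (mem_edgeAt_inP.2 hu').1).2
  rcases h.simpleP.ray_or_segment (h.vertexP_iff.1 u.2.2.1).1 (h.vertexP_iff.1 u.2.2.1).2
    (by simpa using h.dup_mem_Q u) (h.tightP_eq u) with
      ⟨⟨z, hz, hS, hl, hle⟩, -⟩ | ⟨v, h1, h2, h3, h4, h5⟩
  -- A ray of `P` has `y`-direction zero, as it is nonnegative with sum zero. So it moves `π₁` and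
  -- can keep no payoff inequality tight. Every label `i` must then be supplied by `w`, which means
  -- `x = 0`.
  · exfalso
    have hy : ∀ j, z.1 j = 0 := by
      rw [eqP_apply, Finset.sum_eq_zero_iff_of_nonneg fun j _ => by simpa using hle (.inr j)] at hz
      exact fun j => hz j (Finset.mem_univ j)
    have hpi : z.2 ≠ 0 := by
      intro h0
      cases hd : h.dup u with
      | inl i => simp [hd, hy, h0] at hl
      | inr j => simp [hd, hy] at hl
    have hx : ∀ i, u.1.2.1 i = 0 := by
      intro i
      by_contra hi
      have := hS (.inl i) (by simpa [mem_tight] using hi)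
      simp [hy, hpi] at this
    have := u.2.2.2.1.2.2
    simp [hx] at this
  · refine ⟨⟨(v, u.1.2), (mem_fiberQ_iff u.2.2.2.1).2 ⟨h1, h2⟩,
      h.vertexP_iff.2 ⟨h1, h3⟩, u.2.2.2⟩, rfl, ?_, fun u' hu' => ?_⟩
    · intro heq
      exact h4 (congrArg (fun u : NVert A C β => u.1.1) heq)
    · have hv := h.vertexP_iff.1 u'.2.2.1
      rcases h5 _ hv.1 (hsub u' hu') hv.2 with h' | h'
      · exact Or.inl (Subtype.ext (Prod.ext h' hu'))
      · exact Or.inr (Subtype.ext (Prod.ext h' hu'))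

end IsGameSpace

/-! ## Determinant lemmas -/

section Det

variable {ι R : Type*} [Fintype ι] [DecidableEq ι]

/-- Cramer's rule without division. As a function of row `d` the determinant is the pairing with
column `d` of the adjugate, and a vector annihilated by all other rows is proportional to this
column. -/
theorem det_updateRow_mul_dotProduct [CommRing R] (M : Matrix ι ι R) (d : ι) (z a b : ι → R)
    (hM : ∀ i, i ≠ d → M i ⬝ᵥ z = 0) :
    (M.updateRow d a).det * (b ⬝ᵥ z) = (M.updateRow d b).det * (a ⬝ᵥ z) := by
  have hdet : ∀ c : ι → R, (M.updateRow d c).det = c ⬝ᵥ fun j => M.adjugate j d := by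
    intro c
    rw [Matrix.det_eq_sum_mul_adjugate_row _ d]
    refine Finset.sum_congr rfl fun j _ => ?_
    change _ = c j * M.adjugate j d
    rw [Matrix.adjugate_apply, Matrix.adjugate_apply, Matrix.updateRow_idem,
      Matrix.updateRow_self]
  have hmul : (M.updateRow d a).mulVec z = Pi.single d (a ⬝ᵥ z) := by
    ext i
    by_cases h : i = d
    · subst h
      simp [Matrix.mulVec]
    · simp [Matrix.mulVec, hM i h, h]
  have hz : (M.updateRow d a).det • z = (a ⬝ᵥ z) • fun j => M.adjugate j d := by
    have : (M.updateRow d a).adjugate.mulVec ((M.updateRow d a).mulVec z) =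
        (M.updateRow d a).det • z := by
      rw [Matrix.mulVec_mulVec, Matrix.adjugate_mul, Matrix.smul_mulVec, Matrix.one_mulVec]
    rw [← this, hmul]
    ext j
    rw [Matrix.mulVec_single, Pi.smul_apply, Matrix.col_apply, Matrix.adjugate_apply,
      Matrix.updateRow_idem, ← Matrix.adjugate_apply, Pi.smul_apply]
    simp [mul_comm]
  calc (M.updateRow d a).det * (b ⬝ᵥ z) = b ⬝ᵥ ((M.updateRow d a).det • z) := by
        rw [dotProduct_smul, smul_eq_mul]
    _ = (M.updateRow d b).det * (a ⬝ᵥ z) := by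
        rw [hz, dotProduct_smul, smul_eq_mul, hdet b, mul_comm]

/-- The determinant of a matrix that is triangular with respect to a level function. -/
theorem det_of_level [CommRing R] (M : Matrix ι ι R) (b : ι → ℕ)
    (h : ∀ r c, r ≠ c → b r ≤ b c → M r c = 0) : M.det = ∏ i, M i i := by
  rw [Matrix.det_apply, Finset.sum_eq_single 1]
  · simp
  · intro σ _ hσ
    suffices ∃ i, M (σ i) i = 0 by
      obtain ⟨i, hi⟩ := this
      rw [Finset.prod_eq_zero (f := fun i => M (σ i) i) (Finset.mem_univ i) hi, smul_zero]
    by_contra! hne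
    have hle : ∀ i, b i ≤ b (σ i) := fun i => by
      by_cases hi : σ i = i
      · rw [hi]
      · by_contra! hlt
        exact hne i (h _ _ hi hlt.le)
    obtain ⟨i, hi⟩ : ∃ i, σ i ≠ i := by
      by_contra! hcon
      exact hσ (Equiv.ext hcon)
    have hlt : b i < b (σ i) := by
      by_contra! hlt
      exact hne i (h _ _ hi hlt)
    have := Finset.sum_lt_sum (fun i _ => hle i) ⟨i, Finset.mem_univ i, hlt⟩
    rw [Equiv.sum_comp σ b] at this
    exact lt_irrefl _ this
  · simp

end Det

/-! ## The coefficient matrix of a pair -/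

/-- Indices of the variables `x`, `y`, `π₁`, `π₂`, `lam`, and of the labels and the three further
equations. -/
abbrev Idx (m n : ℕ) : Type := (Fin m ⊕ Fin n) ⊕ Fin 3

/-- The coefficients of the inequalities of `P`. -/
def coefP {m n : ℕ} (A : Matrix (Fin m) (Fin n) ℝ) : Fin m ⊕ Fin n → Idx m n → ℝ
  | .inl i, .inl (.inr j) => A i j
  | .inl _, .inl (.inl _) => 0
  | .inl _, .inr k => if k = 0 then -1 else 0
  | .inr j, c => if c = .inl (.inr j) then -1 else 0

/-- The coefficients of the inequalities of `Q'`. -/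
def coefQ {m n : ℕ} (C : Matrix (Fin m) (Fin n) ℝ) (β : Fin n → ℝ) :
    Fin m ⊕ Fin n → Idx m n → ℝ
  | .inl i, c => if c = .inl (.inl i) then -1 else 0
  | .inr j, .inl (.inl i) => C i j
  | .inr _, .inl (.inr _) => 0
  | .inr j, .inr k => if k = 1 then -1 else if k = 2 then β j else 0

/-- The coefficients of `∑ y_j`. -/
def coefSumP {m n : ℕ} : Idx m n → ℝ
  | .inl (.inr _) => 1
  | _ => 0

/-- The coefficients of `∑ x_i`. -/
def coefSumQ {m n : ℕ} : Idx m n → ℝ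
  | .inl (.inl _) => 1
  | _ => 0

/-- The coordinates of a pair of points. -/
def coords {m n : ℕ} (v : PPoint n) (w : QPoint m) : Idx m n → ℝ
  | .inl (.inl i) => w.1 i
  | .inl (.inr j) => v.1 j
  | .inr k => if k = 0 then v.2 else if k = 1 then w.2.2 else w.2.1

open Classical in
/-- The matrix with the rows `R₁ ℓ` for `ℓ ∈ L` and `R₂ ℓ` for `ℓ ∉ L`, the two sum rows and a last
row `a`. -/
noncomputable def pairMatrix {m n : ℕ} (R₁ R₂ : Fin m ⊕ Fin n → Idx m n → ℝ)
    (L : Set (Fin m ⊕ Fin n)) (a : Idx m n → ℝ) : Matrix (Idx m n) (Idx m n) ℝ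
  | .inl ℓ => if ℓ ∈ L then R₁ ℓ else R₂ ℓ
  | .inr k => if k = 0 then coefSumP else if k = 1 then coefSumQ else a

section

variable {m n : ℕ} {A C : Matrix (Fin m) (Fin n) ℝ} {β : Fin n → ℝ}

theorem coefP_dot (ℓ : Fin m ⊕ Fin n) (v : PPoint n) (w : QPoint m) :
    coefP A ℓ ⬝ᵥ coords v w = ineqP A ℓ v := by
  cases ℓ <;> simp [dotProduct, coefP, coords, Fin.sum_univ_three, sub_eq_add_neg, ite_mul]

theorem coefQ_dot (ℓ : Fin m ⊕ Fin n) (v : PPoint n) (w : QPoint m) :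
    coefQ C β ℓ ⬝ᵥ coords v w = ineqQ C β ℓ w := by
  cases ℓ
  · simp [dotProduct, coefQ, coords]
  · simp [dotProduct, coefQ, coords, Fin.sum_univ_three, mul_comm]
    ring

theorem coefSumP_dot (v : PPoint n) (w : QPoint m) : coefSumP ⬝ᵥ coords v w = eqP n v := by
  simp [dotProduct, coefSumP, coords]

theorem coefSumQ_dot (v : PPoint n) (w : QPoint m) : coefSumQ ⬝ᵥ coords v w = eqQ m w := by
  simp [dotProduct, coefSumQ, coords]

theorem exists_coords_eq (z : Idx m n → ℝ) : ∃ (v : PPoint n) (w : QPoint m), z = coords v w := by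
  refine ⟨(fun j => z (.inl (.inr j)), z (.inr 0)),
    (fun i => z (.inl (.inl i)), z (.inr 2), z (.inr 1)), ?_⟩
  ext c
  rcases c with (i | j) | k
  · rfl
  · rfl
  · fin_cases k <;> rfl

theorem coords_zero : coords (0 : PPoint n) (0 : QPoint m) = 0 := by
  ext c
  rcases c with (i | j) | k <;> simp [coords]

variable {R₁ R₂ : Fin m ⊕ Fin n → Idx m n → ℝ} {L L' : Set (Fin m ⊕ Fin n)}

theorem updateRow_pairMatrix (a b : Idx m n → ℝ) :
    (pairMatrix R₁ R₂ L a).updateRow (.inr 2) b = pairMatrix R₁ R₂ L b := by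
  ext r c
  rcases r with ℓ | k
  · rw [Matrix.updateRow_ne (by simp)]
    rfl
  · fin_cases k
    · rw [Matrix.updateRow_ne (by simp)]
      rfl
    · rw [Matrix.updateRow_ne (by simp)]
      rfl
    · simp [pairMatrix]

/-- Compares two matrices that differ only in the last row; `z` will be the direction of an edge or
a ray. -/
theorem det_pairMatrix_mul (a b z : Idx m n → ℝ) (h₁ : ∀ ℓ ∈ L, R₁ ℓ ⬝ᵥ z = 0)
    (h₂ : ∀ ℓ ∉ L, R₂ ℓ ⬝ᵥ z = 0) (hP : coefSumP ⬝ᵥ z = 0) (hQ : coefSumQ ⬝ᵥ z = 0) :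
    (pairMatrix R₁ R₂ L a).det * (b ⬝ᵥ z) = (pairMatrix R₁ R₂ L b).det * (a ⬝ᵥ z) := by
  have := det_updateRow_mul_dotProduct (pairMatrix R₁ R₂ L a) (.inr 2) z a b fun i hi => by
    rcases i with ℓ | k
    · by_cases hℓ : ℓ ∈ L
      · simpa [pairMatrix, hℓ] using h₁ ℓ hℓ
      · simpa [pairMatrix, hℓ] using h₂ ℓ hℓ
    · fin_cases k
      · exact hP
      · exact hQ
      · simp at hi
  rwa [updateRow_pairMatrix, updateRow_pairMatrix] at this

/-- Exchanging the roles of `P` and `Q'` changes the sign of the determinant. -/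
theorem det_pairMatrix_swap {l : Fin m ⊕ Fin n} (hl : L' = insert l Lᶜ) (hL : l ∈ L) :
    (pairMatrix R₁ R₂ L (R₂ l)).det = -(pairMatrix R₂ R₁ L' (R₁ l)).det := by
  -- Only `l` lies in both label sets, so the two matrices differ just by the exchange of row `l`
  -- and the last row.
  have : pairMatrix R₁ R₂ L (R₂ l) =
      (pairMatrix R₂ R₁ L' (R₁ l)).submatrix (Equiv.swap (.inl l) (.inr 2)) id := by
    ext r c
    rcases r with ℓ | k
    · by_cases h : ℓ = l
      · subst h
        simp [pairMatrix, hL]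
      · rw [Matrix.submatrix_apply, Equiv.swap_apply_of_ne_of_ne (by simpa using h) (by simp)]
        by_cases h' : ℓ ∈ L <;> simp [pairMatrix, hl, h, h']
    · fin_cases k
      · rw [Matrix.submatrix_apply, Equiv.swap_apply_of_ne_of_ne (by simp) (by simp)]
        rfl
      · rw [Matrix.submatrix_apply, Equiv.swap_apply_of_ne_of_ne (by simp) (by simp)]
        rfl
      · simp [pairMatrix, hl]
  rw [this, Matrix.det_permute, Equiv.Perm.sign_swap (by simp)]
  simp

end

/-! ### Opposite determinants at the two ends of an edge -/

namespace IsGameSpace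

variable {m n : ℕ} {A C : Matrix (Fin m) (Fin n) ℝ} {β : Fin n → ℝ} {jₛ jₑ : Fin n}

/-- The coefficient matrix of a vertex of `𝒩`. -/
noncomputable def vertexMatrix (h : IsGameSpace A C β jₛ jₑ) (u : NVert A C β) :
    Matrix (Idx m n) (Idx m n) ℝ :=
  pairMatrix (coefP A) (coefQ C β) (tight (ineqP A) u.1.1) (coefQ C β (h.dup u))

theorem det_vertexMatrix_swap (h : IsGameSpace A C β jₛ jₑ) (u : NVert A C β) :
    (h.vertexMatrix u).det = -(pairMatrix (coefQ C β) (coefP A) (tight (ineqQ C β) u.1.2)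
      (coefP A (h.dup u))).det :=
  det_pairMatrix_swap (h.tightQ_eq u) (h.dup_mem_P u)

/-- A kernel vector splits into a direction for `P` and one for `Q'`, each annihilated by all tight
inequalities of the respective vertex, and both vanish by independence. -/
theorem det_vertexMatrix_ne_zero (h : IsGameSpace A C β jₛ jₑ) (u : NVert A C β) :
    (h.vertexMatrix u).det ≠ 0 := by
  intro h0
  obtain ⟨z, hz, hMz⟩ := Matrix.exists_mulVec_eq_zero_iff.2 h0
  obtain ⟨v, w, rfl⟩ := exists_coords_eq z
  have hrow : ∀ r, h.vertexMatrix u r ⬝ᵥ coords v w = 0 := fun r => congrFun hMz r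
  have hv : v = 0 := by
    refine h.simpleP.eq_zero_of_tight (h.vertexP_iff.1 u.2.2.1).1 (h.vertexP_iff.1 u.2.2.1).2 ?_
      fun ℓ hℓ => ?_
    · rw [← coefSumP_dot v w]
      exact hrow (.inr 0)
    · rw [← coefP_dot ℓ v w]
      simpa [vertexMatrix, pairMatrix, hℓ] using hrow (.inl ℓ)
  have hw : w = 0 := by
    refine h.simpleQ.eq_zero_of_tight (h.vertexQ_iff.1 u.2.2.2).1 (h.vertexQ_iff.1 u.2.2.2).2 ?_
      fun ℓ hℓ => ?_
    · rw [← coefSumQ_dot v w]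
      exact hrow (.inr 1)
    · rw [← coefQ_dot ℓ v w]
      rw [h.tightQ_eq u] at hℓ
      rcases hℓ with rfl | hℓ
      · exact hrow (.inr 2)
      · have hℓ' : ℓ ∉ tight (ineqP A) u.1.1 := hℓ
        simpa [vertexMatrix, pairMatrix, hℓ'] using hrow (.inl ℓ)
  rw [hv, hw, coords_zero] at hz
  exact hz rfl

theorem mul_neg_of_mul_eq {D D' s s' : ℝ} (h : D * s' = D' * s) (hD : D ≠ 0) (hs : s < 0)
    (hs' : 0 < s') : D * D' < 0 := by
  have h1 : 0 < D ^ 2 := by positivity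
  have h2 : D * D' * s = D ^ 2 * s' := by linear_combination (-D) * h
  have h3 : 0 < D ^ 2 * s' := by positivity
  by_contra! hle
  have := mul_nonpos_of_nonneg_of_nonpos hle hs.le
  linarith

/-- The ends of an edge `(v, ℰ_v)` have determinants of opposite signs. -/
theorem det_mul_neg_inQ (h : IsGameSpace A C β jₛ jₑ) {u u' : NVert A C β} (hv : u'.1.1 = u.1.1)
    (hne : u' ≠ u) : (h.vertexMatrix u).det * (h.vertexMatrix u').det < 0 := by
  have hu := h.vertexQ_iff.1 u.2.2.2
  have hu' := h.vertexQ_iff.1 u'.2.2.2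
  -- If the duplicate label of one end were tight at the other end as well, the label sets would be
  -- nested and the vertices equal.
  have hnot : ∀ a b : NVert A C β, b.1.1 = a.1.1 → b ≠ a →
      ineqQ C β (h.dup a) b.1.2 < 0 := by
    intro a b hab hne
    have ha := h.vertexQ_iff.1 a.2.2.2
    have hb := h.vertexQ_iff.1 b.2.2.2
    refine lt_of_le_of_ne (hb.1.2 _) fun h0 => hne (Subtype.ext (Prod.ext hab ?_))
    refine h.simpleQ.eq_of_tight_subset ha.1 ha.2 hb.1 ?_
    rw [h.tightQ_eq a, h.tightQ_eq b, hab]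
    refine Set.insert_subset ?_ (Set.subset_insert _ _)
    rw [← hab, ← h.tightQ_eq b]
    exact h0
  -- The direction `(0, w' - w)` is annihilated by the rows of `P` trivially, and by those of `Q'`
  -- because both ends share all labels missing at `v`.
  have key := det_pairMatrix_mul (R₁ := coefP A) (R₂ := coefQ C β) (L := tight (ineqP A) u.1.1)
    (coefQ C β (h.dup u)) (coefQ C β (h.dup u')) (coords 0 (u'.1.2 - u.1.2))
    (fun ℓ _ => by rw [coefP_dot, map_zero])
    (fun ℓ hℓ => by
      have h1 : ineqQ C β ℓ u.1.2 = 0 := by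
        have : ℓ ∈ tight (ineqQ C β) u.1.2 := by
          rw [h.tightQ_eq u]
          exact Or.inr hℓ
        exact this
      have h2 : ineqQ C β ℓ u'.1.2 = 0 := by
        have : ℓ ∈ tight (ineqQ C β) u'.1.2 := by
          rw [h.tightQ_eq u', hv]
          exact Or.inr hℓ
        exact this
      rw [coefQ_dot, map_sub, h1, h2, sub_zero])
    (by rw [coefSumP_dot, map_zero])
    (by rw [coefSumQ_dot, map_sub, hu.1.1, hu'.1.1, sub_self])
  rw [coefQ_dot, coefQ_dot, map_sub, map_sub] at key
  have h1 : ineqQ C β (h.dup u) u.1.2 = 0 := h.dup_mem_Q u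
  have h2 : ineqQ C β (h.dup u') u'.1.2 = 0 := h.dup_mem_Q u'
  have hM : h.vertexMatrix u' = pairMatrix (coefP A) (coefQ C β) (tight (ineqP A) u.1.1)
      (coefQ C β (h.dup u')) := by
    rw [vertexMatrix, hv]
  rw [hM]
  -- From `u` to `u'` the duplicate label of `u` drops from zero to a negative value, while that of
  -- `u'` rises from a negative value to zero.
  refine mul_neg_of_mul_eq key (h.det_vertexMatrix_ne_zero u) ?_ ?_
  · linarith [hnot u u' hv hne]
  · linarith [hnot u' u hv.symm hne.symm]

/-- The ends of an edge `(ℰ_w, w)` have determinants of opposite signs. -/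
theorem det_mul_neg_inP (h : IsGameSpace A C β jₛ jₑ) {u u' : NVert A C β} (hw : u'.1.2 = u.1.2)
    (hne : u' ≠ u) : (h.vertexMatrix u).det * (h.vertexMatrix u').det < 0 := by
  have hu := h.vertexP_iff.1 u.2.2.1
  have hu' := h.vertexP_iff.1 u'.2.2.1
  have hnot : ∀ a b : NVert A C β, b.1.2 = a.1.2 → b ≠ a →
      ineqP A (h.dup a) b.1.1 < 0 := by
    intro a b hab hne
    have ha := h.vertexP_iff.1 a.2.2.1
    have hb := h.vertexP_iff.1 b.2.2.1
    refine lt_of_le_of_ne (hb.1.2 _) fun h0 => hne (Subtype.ext (Prod.ext ?_ hab))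
    refine h.simpleP.eq_of_tight_subset ha.1 ha.2 hb.1 ?_
    rw [h.tightP_eq a, h.tightP_eq b, hab]
    refine Set.insert_subset ?_ (Set.subset_insert _ _)
    rw [← hab, ← h.tightP_eq b]
    exact h0
  have key := det_pairMatrix_mul (R₁ := coefQ C β) (R₂ := coefP A) (L := tight (ineqQ C β) u.1.2)
    (coefP A (h.dup u)) (coefP A (h.dup u')) (coords (u'.1.1 - u.1.1) 0)
    (fun ℓ _ => by rw [coefQ_dot, map_zero])
    (fun ℓ hℓ => by
      have h1 : ineqP A ℓ u.1.1 = 0 := by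
        have : ℓ ∈ tight (ineqP A) u.1.1 := by
          rw [h.tightP_eq u]
          exact Or.inr hℓ
        exact this
      have h2 : ineqP A ℓ u'.1.1 = 0 := by
        have : ℓ ∈ tight (ineqP A) u'.1.1 := by
          rw [h.tightP_eq u', hw]
          exact Or.inr hℓ
        exact this
      rw [coefP_dot, map_sub, h1, h2, sub_zero])
    (by rw [coefSumP_dot, map_sub, hu.1.1, hu'.1.1, sub_self])
    (by rw [coefSumQ_dot, map_zero])
  rw [coefP_dot, coefP_dot, map_sub, map_sub] at key
  have h1 : ineqP A (h.dup u) u.1.1 = 0 := h.dup_mem_P u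
  have h2 : ineqP A (h.dup u') u'.1.1 = 0 := h.dup_mem_P u'
  have h0 := h.det_vertexMatrix_ne_zero u
  -- Here `w` is constant, so the matrix is read with `Q'` as the leading side; the sign of the
  -- exchange occurs at both ends and cancels in the product.
  rw [h.det_vertexMatrix_swap u, h.det_vertexMatrix_swap u', hw, neg_mul_neg]
  rw [h.det_vertexMatrix_swap u, neg_ne_zero] at h0
  refine mul_neg_of_mul_eq key h0 ?_ ?_
  · linarith [hnot u u' hw hne]
  · linarith [hnot u' u hw.symm hne.symm]

end IsGameSpace

/-! ## The unbounded edges -/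

section

variable {m n : ℕ} {A C : Matrix (Fin m) (Fin n) ℝ} {β : Fin n → ℝ}

theorem prod_ite_one_neg_one {k : ℕ} (i₀ : Fin k) :
    (∏ i, if i = i₀ then (1 : ℝ) else -1) = -(-1) ^ k := by
  have : ∀ i, (if i = i₀ then (1 : ℝ) else -1) = -1 * if i = i₀ then -1 else 1 := by
    intro i
    split_ifs <;> simp
  simp_rw [this, Finset.prod_mul_distrib, Finset.prod_ite_eq' Finset.univ i₀]
  simp

/-- At the labels of a pure vertex, a 4-cycle of rows brings the sum rows to the columns `x_{i₀}`,
`y_{j₀}` and the payoff rows of `i₀`, `j₀` to the columns `π₁`, `π₂`. The result is triangular with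
diagonal entries `±1`, and the 4-cycle is odd. -/
theorem det_pairMatrix_single (i₀ : Fin m) (j₀ : Fin n) {L : Set (Fin m ⊕ Fin n)}
    (hi : ∀ i, Sum.inl i ∈ L ↔ i = i₀) (hj : ∀ j, Sum.inr j ∈ L ↔ j ≠ j₀) :
    (pairMatrix (coefP A) (coefQ C β) L (Pi.single (.inr 2) 1)).det = -(-1) ^ (m + n) := by
  classical
  set M := pairMatrix (coefP A) (coefQ C β) L (Pi.single (.inr 2) 1) with hM
  let a : Idx m n := .inl (.inl i₀)
  let b : Idx m n := .inl (.inr j₀)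
  let τ : Equiv.Perm (Idx m n) :=
    Equiv.swap a (.inr 1) * Equiv.swap (.inr 1) b * Equiv.swap b (.inr 0)
  have hτ : Equiv.Perm.sign τ = -1 := by
    simp only [τ, map_mul]
    rw [Equiv.Perm.sign_swap (by simp [a]), Equiv.Perm.sign_swap (by simp [b]),
      Equiv.Perm.sign_swap (by simp [b])]
    rfl
  have h1 : ∀ i, M (τ (.inl (.inl i))) = if i = i₀ then coefSumQ else coefQ C β (.inl i) := by
    intro i
    split_ifs with h
    · subst h
      simp [τ, Equiv.swap_apply_def, a, b, hM, pairMatrix]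
    · simp [τ, Equiv.swap_apply_def, a, b, h, hM, pairMatrix, hi]
  have h2 : ∀ j, M (τ (.inl (.inr j))) = if j = j₀ then coefSumP else coefP A (.inr j) := by
    intro j
    split_ifs with h
    · subst h
      simp [τ, Equiv.swap_apply_def, a, b, hM, pairMatrix]
    · simp [τ, Equiv.swap_apply_def, a, b, h, hM, pairMatrix, hj]
  have h3 : M (τ (.inr 0)) = coefP A (.inl i₀) := by
    simp [τ, a, b, hM, pairMatrix, hi]
  have h4 : M (τ (.inr 1)) = coefQ C β (.inr j₀) := by
    simp [τ, Equiv.swap_apply_def, a, b, hM, pairMatrix, hj]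
  have h5 : M (τ (.inr 2)) = Pi.single (.inr 2) 1 := by
    simp [τ, Equiv.swap_apply_def, a, b, hM, pairMatrix]
  have hdet : (M.submatrix τ id).det = ∏ c, M (τ c) c := by
    -- Level 2: payoff rows, which may involve all strategies and `lam`. Level 1: sum rows, which
    -- involve the remaining strategies. Level 0: rows with a single nonzero entry.
    refine det_of_level _ (fun c => match c with
      | .inl (.inl i) => if i = i₀ then 1 else 0
      | .inl (.inr j) => if j = j₀ then 1 else 0
      | .inr k => if k = 2 then 0 else 2) ?_
    intro r c hrc hle
    rw [Matrix.submatrix_apply, id]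
    rcases r with (i | j) | k
    · rw [h1]
      rcases c with (i' | j') | k'
      · by_cases hi : i = i₀
        · subst hi
          have : i' ≠ i := fun h' => hrc (by rw [h'])
          simp [this] at hle
        · have : i' ≠ i := fun h' => hrc (by rw [h'])
          simp [hi, coefQ, this]
      · split_ifs <;> simp [coefSumQ, coefQ]
      · split_ifs <;> simp [coefSumQ, coefQ]
    · rw [h2]
      rcases c with (i' | j') | k'
      · split_ifs <;> simp [coefSumP, coefP]
      · by_cases hi : j = j₀
        · subst hi
          have : j' ≠ j := fun h' => hrc (by rw [h'])
          simp [this] at hle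
        · have : j' ≠ j := fun h' => hrc (by rw [h'])
          simp [hi, coefP, this]
      · split_ifs <;> simp [coefSumP, coefP]
    · rcases c with (i' | j') | k'
      · fin_cases k
        · simp at hle
          split_ifs at hle <;> omega
        · simp at hle
          split_ifs at hle <;> omega
        · exact (congrFun h5 _).trans (by simp)
      · fin_cases k
        · simp at hle
          split_ifs at hle <;> omega
        · simp at hle
          split_ifs at hle <;> omega
        · exact (congrFun h5 _).trans (by simp)
      · fin_cases k
        · exact (congrFun h3 _).trans (by
            have : k' ≠ 0 := fun h' => hrc (by rw [h']; rfl)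
            simp [coefP, this])
        · exact (congrFun h4 _).trans (by
            have : k' ≠ 1 := fun h' => hrc (by rw [h']; rfl)
            have h2' : k' ≠ 2 := by
              rintro rfl
              simp at hle
            simp [coefQ, this, h2'])
        · exact (congrFun h5 _).trans (by
            have : k' ≠ 2 := fun h' => hrc (by rw [h']; rfl)
            simp [this])
  have hprod : ∏ c, M (τ c) c = (-1) ^ (m + n) := by
    rw [Fintype.prod_sum_type, Fintype.prod_sum_type, Fin.prod_univ_three, h3, h4, h5]
    have e1 : ∀ i, M (τ (.inl (.inl i))) (.inl (.inl i)) = if i = i₀ then 1 else -1 := by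
      intro i
      rw [h1]
      split_ifs <;> simp [coefSumQ, coefQ]
    have e2 : ∀ j, M (τ (.inl (.inr j))) (.inl (.inr j)) = if j = j₀ then 1 else -1 := by
      intro j
      rw [h2]
      split_ifs <;> simp [coefSumP, coefP]
    simp_rw [e1, e2, prod_ite_one_neg_one]
    simp [coefP, coefQ, pow_add]
  rw [Matrix.det_permute, hτ, hprod] at hdet
  simp at hdet
  linarith

theorem pureVertex_mem {i₀ : Fin m} {j₀ : Fin n} (hi : ∀ i, A i j₀ ≤ A i₀ j₀) :
    pureVertex A i₀ j₀ ∈ polyhedron (eqP n) (ineqP A) := by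
  refine ⟨by simp [pureVertex], fun ℓ => ?_⟩
  cases ℓ with
  | inl i => simpa [pureVertex, Pi.single_apply] using hi i
  | inr j =>
    by_cases h : j = j₀
    · subst h
      simp [pureVertex]
    · simp [pureVertex, h]

end

namespace IsGameSpace

variable {m n : ℕ} {A C : Matrix (Fin m) (Fin n) ℝ} {β : Fin n → ℝ} {jₛ jₑ : Fin n}

/-- The evident labels already number `n`, so non-degeneracy excludes any other; in particular the
best reply to `j₀` is unique. -/
theorem tight_pureVertex (h : IsGameSpace A C β jₛ jₑ) {i₀ : Fin m} {j₀ : Fin n}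
    (hi : ∀ i, A i j₀ ≤ A i₀ j₀) :
    tight (ineqP A) (pureVertex A i₀ j₀) = insert (.inl i₀) (Sum.inr '' {j₀}ᶜ) ∧
      (tight (ineqP A) (pureVertex A i₀ j₀)).ncard = n := by
  have hsub : insert (.inl i₀) (Sum.inr '' {j₀}ᶜ) ⊆ tight (ineqP A) (pureVertex A i₀ j₀) := by
    refine Set.insert_subset ?_ ?_
    · simp [mem_tight, pureVertex, Pi.single_apply]
    · rintro _ ⟨j, hj, rfl⟩
      have : j ≠ j₀ := hj
      simp [mem_tight, pureVertex, this]
  have hn : 0 < n := j₀.pos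
  have hcard : (insert (.inl i₀) (Sum.inr '' ({j₀} : Set (Fin n))ᶜ) : Set (Fin m ⊕ Fin n)).ncard
      = n := by
    rw [Set.ncard_insert_of_notMem (by simp) (Set.toFinite _),
      Set.ncard_image_of_injective _ Sum.inr_injective, Set.ncard_compl]
    simp
    omega
  have hle := h.simpleP.nondeg _ (pureVertex_mem hi)
  have := Set.eq_of_subset_of_ncard_le hsub (by rw [hcard]; exact hle) (Set.toFinite _)
  exact ⟨this.symm, by rw [← this, hcard]⟩

/-- At an index `j₀` that is extremal for `β` (the minimum for `s = -1`, the maximum for `s = 1`)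
there is an unbounded edge. -/
theorem exists_end_vertex (h : IsGameSpace A C β jₛ jₑ) {i₀ : Fin m} {j₀ : Fin n} {s : ℝ}
    (hi : ∀ i, A i j₀ ≤ A i₀ j₀) (hs : ∀ j, j ≠ j₀ → 0 < s * (β j₀ - β j)) (hs0 : s ≠ 0) :
    ∃ u : NVert A C β, u.1.1 = pureVertex A i₀ j₀ ∧
      (∀ u' : NVert A C β, u'.1.1 = u.1.1 → u' = u) ∧
      0 < s * (-1) ^ (m + n) * (h.vertexMatrix u).det := by
  obtain ⟨hL, hcard⟩ := h.tight_pureVertex hi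
  have hvP : pureVertex A i₀ j₀ ∈ Set.extremePoints ℝ (polyP A) :=
    h.vertexP_iff.2 ⟨pureVertex_mem hi, hcard⟩
  have hLi : ∀ i, Sum.inl i ∈ tight (ineqP A) (pureVertex A i₀ j₀) ↔ i = i₀ := by
    intro i
    rw [hL]
    simp
  have hLj : ∀ j, Sum.inr j ∈ tight (ineqP A) (pureVertex A i₀ j₀) ↔ j ≠ j₀ := by
    intro j
    rw [hL]
    simp
  -- With `lam = s * t` far enough out, the term in `β` outweighs the differences of the payoffs, so
  -- `j₀` is optimal against `i₀`. This gives a point of the edge, and hence a vertex on it.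
  obtain ⟨t, ht⟩ : ∃ t : ℝ, ∀ j, j ≠ j₀ → C i₀ j - C i₀ j₀ ≤ t * (s * (β j₀ - β j)) := by
    obtain ⟨t, ht⟩ := Set.Finite.bddAbove (Set.finite_range fun j =>
      (C i₀ j - C i₀ j₀) / (s * (β j₀ - β j)))
    exact ⟨t, fun j hj => (div_le_iff₀ (hs j hj)).1 (ht ⟨j, rfl⟩)⟩
  let w₀ : QPoint m := (Pi.single i₀ 1, s * t, C i₀ j₀ + β j₀ * (s * t))
  have hw₀ : w₀ ∈ polyhedron (eqQ m) (ineqQ C β) := by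
    refine ⟨by simp [w₀], fun ℓ => ?_⟩
    cases ℓ with
    | inl i =>
      by_cases h : i = i₀
      · subst h
        simp [w₀]
      · simp [w₀, h]
    | inr j =>
      by_cases hj : j = j₀
      · subst hj
        simp [w₀, Pi.single_apply]
      · have := ht j hj
        simp [w₀, Pi.single_apply]
        linarith
  have hSw₀ : (tight (ineqP A) (pureVertex A i₀ j₀))ᶜ ⊆ tight (ineqQ C β) w₀ := by
    rintro (i | j) hℓ
    · have : i ≠ i₀ := fun h' => hℓ ((hLi i).2 h')
      simp [mem_tight, w₀, this]
    · have : j = j₀ := by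
        by_contra h'
        exact hℓ ((hLj j).2 h')
      subst this
      simp [mem_tight, w₀, Pi.single_apply]
  obtain ⟨w, hw1, hw2, hw3⟩ := h.simpleQ.exists_vertex_of_face hw₀ hSw₀
  let u : NVert A C β := ⟨(pureVertex A i₀ j₀, w),
    (mem_fiberP_iff hvP.1).2 ⟨hw1, hw2⟩, hvP, h.vertexQ_iff.2 ⟨hw1, hw3⟩⟩
  -- The direction of the ray: extremality of `β j₀` keeps the inequality of `j₀` tight and lets
  -- those of all other columns decrease.
  let z : QPoint m := (0, s, s * β j₀)
  have hz0 : ineqQ C β (.inr j₀) z = 0 := by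
    simp [z]
    ring
  have hzj : ∀ j, j ≠ j₀ → ineqQ C β (.inr j) z < 0 := by
    intro j hj
    have := hs j hj
    simp [z]
    linarith
  have hzi : ∀ i, ineqQ C β (.inl i) z = 0 := by
    intro i
    simp [z]
  have hzle : ∀ ℓ, ineqQ C β ℓ z ≤ 0 := by
    rintro (i | j)
    · exact (hzi i).le
    · by_cases hj : j = j₀
      · rw [hj, hz0]
      · exact (hzj j hj).le
  have hzS : ∀ ℓ ∉ tight (ineqP A) u.1.1, ineqQ C β ℓ z = 0 := by
    rintro (i | j) hℓ
    · exact hzi i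
    · have : j = j₀ := by
        by_contra h'
        exact hℓ ((hLj j).2 h')
      rw [this, hz0]
  have hzne : z ≠ 0 := fun h' => hs0 (congrArg (fun z : QPoint m => z.2.1) h')
  have hze : eqQ m z = 0 := by simp [z]
  have hzl : ineqQ C β (h.dup u) z < 0 := by
    refine lt_of_le_of_ne (hzle _) fun h0 => hzne ?_
    refine h.simpleQ.eq_zero_of_tight (v := w) hw1 hw3 hze fun ℓ hℓ => ?_
    have hℓ' : ℓ ∈ tight (ineqQ C β) u.1.2 := hℓ
    rw [h.tightQ_eq u] at hℓ'
    rcases hℓ' with rfl | hℓ'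
    · exact h0
    · exact hzS ℓ hℓ'
  -- The determinant of `u` is compared with the matrix whose last row reads off `lam`. Its value is
  -- known explicitly, so only the sign of the duplicate inequality on `z` matters.
  have key := det_pairMatrix_mul (R₁ := coefP A) (R₂ := coefQ C β) (L := tight (ineqP A) u.1.1)
    (coefQ C β (h.dup u)) (Pi.single (.inr 2) 1) (coords 0 z)
    (fun ℓ _ => by rw [coefP_dot, map_zero]) (fun ℓ hℓ => by rw [coefQ_dot, hzS ℓ hℓ])
    (by rw [coefSumP_dot, map_zero]) (by rw [coefSumQ_dot, hze])
  rw [coefQ_dot, single_one_dotProduct, det_pairMatrix_single i₀ j₀ hLi hLj] at key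
  have hc : coords (0 : PPoint n) z (.inr 2) = s := by simp [coords, z]
  rw [hc] at key
  refine ⟨u, rfl, ?_, ?_⟩
  · rcases h.inQ_ray_or_segment u with ⟨-, h'⟩ | ⟨u', hu', hne, -⟩
    · exact h'
    · exfalso
      have hw' := h.vertexQ_iff.1 u'.2.2.2
      have hopp := h.det_mul_neg_inQ hu' hne
      -- At a second end the determinant would have the opposite sign, and the same identity would
      -- make its duplicate inequality grow along `z`; but no inequality grows along `z`.
      have key' := det_pairMatrix_mul (R₁ := coefP A) (R₂ := coefQ C β)
        (L := tight (ineqP A) u.1.1) (coefQ C β (h.dup u)) (coefQ C β (h.dup u')) (coords 0 z)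
        (fun ℓ _ => by rw [coefP_dot, map_zero]) (fun ℓ hℓ => by rw [coefQ_dot, hzS ℓ hℓ])
        (by rw [coefSumP_dot, map_zero]) (by rw [coefSumQ_dot, hze])
      rw [coefQ_dot, coefQ_dot] at key'
      have hM : h.vertexMatrix u' = pairMatrix (coefP A) (coefQ C β) (tight (ineqP A) u.1.1)
          (coefQ C β (h.dup u')) := by
        rw [vertexMatrix, hu']
      rw [← hM] at key'
      change (h.vertexMatrix u).det * _ = _ at key'
      have h1 : 0 ≤ (h.vertexMatrix u).det ^ 2 := sq_nonneg _
      have h2 := hzle (h.dup u')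
      have h3 : (h.vertexMatrix u).det ^ 2 * ineqQ C β (h.dup u') z =
          (h.vertexMatrix u).det * (h.vertexMatrix u').det * ineqQ C β (h.dup u) z := by
        linear_combination (h.vertexMatrix u).det * key'
      have h4 := mul_pos_of_neg_of_neg hopp hzl
      have h5 := mul_nonpos_of_nonneg_of_nonpos h1 h2
      linarith
  · change (h.vertexMatrix u).det * s = _ at key
    have h1 : s * (-1) ^ (m + n) * (h.vertexMatrix u).det =
        -((-1) ^ (m + n) * (-1) ^ (m + n)) * ineqQ C β (h.dup u) z := by
      linear_combination (-1) ^ (m + n) * key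
    rw [h1, ← mul_pow]
    simpa using hzl

/-- The only unbounded edges are those at the two pure vertices. -/
theorem eq_pureVertex_of_ray (h : IsGameSpace A C β jₛ jₑ) (u : NVert A C β)
    (hu : ∀ u' : NVert A C β, u'.1.1 = u.1.1 → u' = u) :
    ∃ j₀, (j₀ = jₛ ∨ j₀ = jₑ) ∧
      ∀ i₀, (∀ i, A i j₀ ≤ A i₀ j₀) → u.1.1 = pureVertex A i₀ j₀ := by
  rcases h.inQ_ray_or_segment u with ⟨⟨z, hz, hS, hl, hle⟩, -⟩ | ⟨u', hu', hne, -⟩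
  swap
  · exact absurd (hu u' hu') hne
  have hv := (h.vertexP_iff.1 u.2.2.1).1
  have hx : ∀ i, z.1 i = 0 := by
    rw [eqQ_apply, Finset.sum_eq_zero_iff_of_nonneg fun i _ => by simpa using hle (.inl i)] at hz
    exact fun i => hz i (Finset.mem_univ i)
  have hzj : ∀ j, ineqQ C β (.inr j) z = β j * z.2.1 - z.2.2 := by
    intro j
    simp [hx]
  have hlam : z.2.1 ≠ 0 ∨ z.2.2 ≠ 0 := by
    by_contra! hcon
    cases hd : h.dup u with
    | inl i => simp [hd, hx] at hl
    | inr j => rw [hd, hzj, hcon.1, hcon.2] at hl; simp at hl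
  -- A column used by `y` must stay optimal along the ray, and there only `β_j lam - π₂` counts. So
  -- the support of `y` lies where `β_j lam` is maximal, a single index whichever sign `lam` has.
  have hsupp : ∀ j, u.1.1.1 j ≠ 0 → β j * z.2.1 = z.2.2 := by
    intro j hj
    have := hS (.inr j) (by simpa [mem_tight] using hj)
    rw [hzj] at this
    linarith
  have hsum : ∑ j, u.1.1.1 j = 1 := by simpa using hv.1
  obtain ⟨j₁, -, hj₁⟩ : ∃ j ∈ Finset.univ, u.1.1.1 j ≠ 0 := by
    refine Finset.exists_ne_zero_of_sum_ne_zero ?_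
    rw [hsum]
    exact one_ne_zero
  have hdom : ∀ j, β j * z.2.1 ≤ β j₁ * z.2.1 := by
    intro j
    have := hle (.inr j)
    rw [hzj] at this
    rw [hsupp j₁ hj₁]
    linarith
  have hlam0 : z.2.1 ≠ 0 := by
    rcases hlam with h' | h'
    · exact h'
    · intro h0
      have := hsupp j₁ hj₁
      rw [h0, mul_zero] at this
      exact h' this.symm
  have huniq : ∀ j, u.1.1.1 j ≠ 0 → j = j₁ := by
    intro j hj
    have h1 : β j = β j₁ := mul_right_cancel₀ hlam0 ((hsupp j hj).trans (hsupp j₁ hj₁).symm)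
    rcases lt_or_gt_of_ne hlam0 with hneg | hpos
    · have h2 : j₁ = jₛ := by
        by_contra hne
        have := mul_lt_mul_of_neg_right (h.min j₁ hne) hneg
        linarith [hdom jₛ]
      by_contra hne
      rw [h2] at h1 hne
      linarith [h.min j hne]
    · have h2 : j₁ = jₑ := by
        by_contra hne
        have := mul_lt_mul_of_pos_right (h.max j₁ hne) hpos
        linarith [hdom jₑ]
      by_contra hne
      rw [h2] at h1 hne
      linarith [h.max j hne]
  have hext : j₁ = jₛ ∨ j₁ = jₑ := by
    rcases lt_or_gt_of_ne hlam0 with hneg | hpos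
    · left
      by_contra hne
      have := mul_lt_mul_of_neg_right (h.min j₁ hne) hneg
      linarith [hdom jₛ]
    · right
      by_contra hne
      have := mul_lt_mul_of_pos_right (h.max j₁ hne) hpos
      linarith [hdom jₑ]
  refine ⟨j₁, hext, fun i₀ hi₀ => ?_⟩
  have hy : u.1.1.1 = Pi.single j₁ 1 := by
    have h1 : ∀ j, j ≠ j₁ → u.1.1.1 j = 0 := fun j hj => by
      by_contra h'
      exact hj (huniq j h')
    ext j
    by_cases hj : j = j₁
    · subst hj
      rw [Pi.single_eq_same, ← hsum, Finset.sum_eq_single j (fun j' _ hj' => h1 j' hj') (by simp)]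
    · rw [h1 j hj, Pi.single_eq_of_ne hj]
  -- A strategy `i` with `x_i ≠ 0` misses its label in `w`, so it has it in `v`: `π₁` is an entry of
  -- column `j₁`, and by feasibility the largest.
  have hpi : u.1.1.2 = A i₀ j₁ := by
    obtain ⟨i, -, hi⟩ : ∃ i ∈ Finset.univ, u.1.2.1 i ≠ 0 := by
      refine Finset.exists_ne_zero_of_sum_ne_zero ?_
      rw [u.2.2.2.1.2.2]
      exact one_ne_zero
    have hiL : Sum.inl i ∈ tight (ineqP A) u.1.1 := by
      by_contra h'
      have : Sum.inl i ∈ tight (ineqQ C β) u.1.2 := by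
        rw [h.tightQ_eq u]
        exact Or.inr h'
      rw [mem_tight, ineqQ_inl, neg_eq_zero] at this
      exact hi this
    have h1 : A i j₁ - u.1.1.2 = 0 := by simpa [mem_tight, hy, Pi.single_apply] using hiL
    have h2 : A i₀ j₁ - u.1.1.2 ≤ 0 := by simpa [hy, Pi.single_apply] using hv.2 (.inl i₀)
    linarith [hi₀ i]
  exact Prod.ext hy hpi

end IsGameSpace

/-! ## Determinants of lists of equations and variables -/

section CoeffMatrix

variable {κ : Type} {N : ℕ}

theorem coeffMatrix_map {κ' : Type} (φ : κ → κ') (R : List (κ' → ℝ)) (cs : List κ) :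
    coeffMatrix N (R.map (· ∘ φ)) cs = coeffMatrix N R (cs.map φ) := by
  ext r c
  simp only [coeffMatrix, List.getElem?_map]
  cases R[(r : ℕ)]? <;> cases cs[(c : ℕ)]? <;> rfl

/-- The basic transposition from which all exchanges of column blocks are built. The length
condition keeps both columns inside the matrix, which cuts off longer lists. -/
theorem det_coeffMatrix_swap (R : List (κ → ℝ)) (a d : List κ) (x y : κ) (hN : a.length + 2 ≤ N) :
    (coeffMatrix N R (a ++ x :: y :: d)).det = -(coeffMatrix N R (a ++ y :: x :: d)).det := by
  let σ : Equiv.Perm (Fin N) := Equiv.swap ⟨a.length, by omega⟩ ⟨a.length + 1, by omega⟩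
  have hσ : coeffMatrix N R (a ++ x :: y :: d) =
      (coeffMatrix N R (a ++ y :: x :: d)).submatrix id σ := by
    ext r c
    have : (a ++ x :: y :: d)[(c : ℕ)]? = (a ++ y :: x :: d)[(σ c : ℕ)]? := by
      by_cases h1 : c = ⟨a.length, by omega⟩
      · subst h1
        simp [σ]
      by_cases h2 : c = ⟨a.length + 1, by omega⟩
      · subst h2
        simp [σ]
      rw [Equiv.swap_apply_of_ne_of_ne h1 h2]
      have h1' : (c : ℕ) ≠ a.length := fun h => h1 (Fin.ext h)
      have h2' : (c : ℕ) ≠ a.length + 1 := fun h => h2 (Fin.ext h)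
      rcases lt_or_ge (c : ℕ) a.length with h | h
      · rw [List.getElem?_append_left h, List.getElem?_append_left h]
      · obtain ⟨k, hk⟩ := Nat.exists_eq_add_of_le (show a.length + 2 ≤ c by omega)
        rw [hk, List.getElem?_append_right (by omega), List.getElem?_append_right (by omega)]
        have : a.length + 2 + k - a.length = k + 2 := by omega
        rw [this]
        simp
    simp only [coeffMatrix, Matrix.submatrix_apply, id, this]
  rw [hσ, Matrix.det_permute', Equiv.Perm.sign_swap (by simp)]
  simp

theorem det_coeffMatrix_move (R : List (κ → ℝ)) (b : List κ) : ∀ (a d : List κ) (x : κ),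
    a.length + b.length + 1 ≤ N →
    (coeffMatrix N R (a ++ b ++ x :: d)).det =
      (-1) ^ b.length * (coeffMatrix N R (a ++ x :: (b ++ d))).det := by
  induction b with
  | nil => simp
  | cons y b ih =>
    intro a d x hN
    rw [List.length_cons] at hN
    have hN' : (a ++ [y]).length + b.length + 1 ≤ N := by
      simp
      omega
    have h1 := ih (a ++ [y]) d x hN'
    have h2 := det_coeffMatrix_swap (N := N) R a (b ++ d) y x (by omega)
    simp only [List.append_assoc, List.cons_append, List.nil_append, List.length_cons] at h1 h2 ⊢
    rw [h1, h2, pow_succ]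
    ring

/-- Exchanging two consecutive blocks of columns. -/
theorem det_coeffMatrix_block (R : List (κ → ℝ)) (b c : List κ) : ∀ a d : List κ,
    a.length + b.length + c.length ≤ N →
    (coeffMatrix N R (a ++ b ++ c ++ d)).det =
      (-1) ^ (b.length * c.length) * (coeffMatrix N R (a ++ c ++ b ++ d)).det := by
  induction c with
  | nil => simp
  | cons x c ih =>
    intro a d hN
    rw [List.length_cons] at hN
    have h1 := det_coeffMatrix_move (N := N) R b a (c ++ d) x (by omega)
    have hN' : (a ++ [x]).length + b.length + c.length ≤ N := by
      simp
      omega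
    have h2 := ih (a ++ [x]) d hN'
    simp only [List.append_assoc, List.cons_append, List.nil_append, List.length_cons] at h1 h2 ⊢
    rw [h1, h2, mul_add, pow_add]
    ring

/-- Block triangularity; it merges the determinants of `E(v)` and `E(w)` into one over all
variables. -/
theorem det_coeffMatrix_append {N₁ N₂ : ℕ} (R₁ R₂ : List (κ → ℝ)) (c₁ c₂ : List κ)
    (hR : R₁.length = N₁) (hc : c₁.length = N₁) (h : ∀ f ∈ R₂, ∀ z ∈ c₁, f z = 0) :
    (coeffMatrix (N₁ + N₂) (R₁ ++ R₂) (c₁ ++ c₂)).det =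
      (coeffMatrix N₁ R₁ c₁).det * (coeffMatrix N₂ R₂ c₂).det := by
  rw [← Matrix.det_submatrix_equiv_self finSumFinEquiv]
  have : (coeffMatrix (N₁ + N₂) (R₁ ++ R₂) (c₁ ++ c₂)).submatrix finSumFinEquiv finSumFinEquiv =
      Matrix.fromBlocks (coeffMatrix N₁ R₁ c₁)
        (Matrix.of fun r c => (coeffMatrix (N₁ + N₂) (R₁ ++ R₂) (c₁ ++ c₂))
          (finSumFinEquiv (.inl r)) (finSumFinEquiv (.inr c))) 0 (coeffMatrix N₂ R₂ c₂) := by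
    ext r c
    rcases r with r | r <;> rcases c with c | c
    · change coeffMatrix (N₁ + N₂) (R₁ ++ R₂) (c₁ ++ c₂) _ _ = coeffMatrix N₁ R₁ c₁ r c
      simp [coeffMatrix, List.getElem?_append_left, hR, hc]
    · rfl
    · have h1 : (c₁ ++ c₂)[(c : ℕ)]? = some (c₁[(c : ℕ)]'(by omega)) := by
        rw [List.getElem?_append_left (by omega), List.getElem?_eq_getElem]
      have h2 : (R₁ ++ R₂)[N₁ + (r : ℕ)]? = R₂[(r : ℕ)]? := by
        rw [List.getElem?_append_right (by omega), hR, Nat.add_sub_cancel_left]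
      change coeffMatrix (N₁ + N₂) (R₁ ++ R₂) (c₁ ++ c₂) _ _ = 0
      simp only [coeffMatrix, finSumFinEquiv_apply_left, finSumFinEquiv_apply_right,
        Fin.val_castAdd, Fin.val_natAdd, h1, h2]
      cases hr : R₂[(r : ℕ)]? with
      | none => rfl
      | some f => exact h f (List.mem_of_getElem? hr) _ (List.getElem_mem _)
    · have h1 : (c₁ ++ c₂)[N₁ + (c : ℕ)]? = c₂[(c : ℕ)]? := by
        rw [List.getElem?_append_right (by omega), hc, Nat.add_sub_cancel_left]
      have h2 : (R₁ ++ R₂)[N₁ + (r : ℕ)]? = R₂[(r : ℕ)]? := by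
        rw [List.getElem?_append_right (by omega), hR, Nat.add_sub_cancel_left]
      change coeffMatrix (N₁ + N₂) (R₁ ++ R₂) (c₁ ++ c₂) _ _ = coeffMatrix N₂ R₂ c₂ r c
      simp [coeffMatrix, h1, h2]
  rw [this, Matrix.det_fromBlocks_zero₂₁]

/-- A matrix written with respect to an enumeration of its index type. -/
theorem det_coeffMatrix_enum [Fintype κ] [DecidableEq κ] (M : Matrix κ κ ℝ) (l : List κ)
    (hnd : l.Nodup) (hmem : ∀ z, z ∈ l) (hN : l.length = N) :
    (coeffMatrix N (l.map fun a c => M a c) l).det = M.det := by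
  subst hN
  rw [← Matrix.det_submatrix_equiv_self (hnd.getEquivOfForallMemList l hmem) M]
  congr 1
  ext r c
  simp [coeffMatrix]

end CoeffMatrix

theorem mem_sortedList {k : ℕ} {p : Fin k → Prop} {i : Fin k} : i ∈ sortedList p ↔ p i := by
  simp [sortedList]

theorem nodup_sortedList {k : ℕ} (p : Fin k → Prop) : (sortedList p).Nodup :=
  (List.nodup_finRange k).filter _

theorem length_sortedList_add {k : ℕ} (p : Fin k → Prop) :
    (sortedList p).length + (sortedList fun i => ¬ p i).length = k := by
  classical
  have := List.length_eq_length_filter_add (l := List.finRange k) fun i => decide (p i)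
  simp only [List.length_finRange] at this
  simp only [sortedList]
  convert! this.symm using 4
  ext
  simp

theorem sortedList_eq_nil {k : ℕ} {p : Fin k → Prop} (h : ∀ i, ¬ p i) : sortedList p = [] :=
  List.eq_nil_iff_forall_not_mem.2 fun i hi => h i (mem_sortedList.1 hi)

theorem sortedList_eq_singleton {k : ℕ} {p : Fin k → Prop} {i₀ : Fin k} (h : ∀ i, p i ↔ i = i₀) :
    sortedList p = [i₀] := by
  have : p = fun i => i = i₀ := funext fun i => propext (h i)
  subst this
  refine List.perm_singleton.1 ((List.perm_ext_iff_of_nodup (nodup_sortedList _) (by simp)).2 ?_)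
  intro i
  simp [mem_sortedList]

theorem neg_one_pow_eq_of_even_add {a b : ℕ} (h : Even (a + b)) : (-1 : ℝ) ^ a = (-1) ^ b := by
  rw [Nat.even_add] at h
  exact neg_one_pow_congr h

/-- Here `k = |X| = |Y|`, `a = |-X|`, `b = |-Y|`. Apart from the final `m + n + 1`, each summand is
the exponent from one block exchange in `det_matrixE`. In the companion lemma `|Y| = |X| + 1`,
because the duplicate label lies in `Y`. -/
theorem parity_dup_inl (k a b : ℕ) {m n : ℕ} (hm : k + a = m) (hn : k + b = n) :
    Even (k + b + ((k + (b + 1)) * k + (k * b + (k + (1 + a)))) + (m + n + 1)) := by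
  subst hm hn
  simp only [Nat.even_add, Nat.even_mul, Nat.not_even_one, iff_false]
  by_cases hk : Even k <;> by_cases ha : Even a <;> by_cases hb : Even b <;> simp [hk, ha, hb]

theorem parity_dup_inr (k a b : ℕ) {m n : ℕ} (hm : k + a = m) (hn : k + 1 + b = n) :
    Even (k + 1 + b + ((k + 1 + (b + 1)) * k + ((k + 1) * b + (b + (k + 1) + (k + 1 + a)))) +
      (m + n)) := by
  subst hm hn
  simp only [Nat.even_add, Nat.even_mul, Nat.not_even_one, iff_false]
  by_cases hk : Even k <;> by_cases ha : Even a <;> by_cases hb : Even b <;> simp [hk, ha, hb]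

/-! ## The sign of a vertex -/

/-- The variables of `P` among all variables. -/
def PVar.toIdx {m n : ℕ} : PVar n → Idx m n
  | .y j => .inl (.inr j)
  | .pi1 => .inr 0

/-- The variables of `Q'` among all variables. -/
def QVar.toIdx {m n : ℕ} : QVar m → Idx m n
  | .lam => .inr 2
  | .x i => .inl (.inl i)
  | .pi2 => .inr 1

section

variable {m n : ℕ} {A C : Matrix (Fin m) (Fin n) ℝ} {β : Fin n → ℝ}

theorem sumRowP_eq : sumRowP = (coefSumP : Idx m n → ℝ) ∘ PVar.toIdx := by
  ext z
  cases z <;> rfl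

theorem payRowP_eq (i : Fin m) : payRowP A i = coefP A (.inl i) ∘ PVar.toIdx := by
  ext z
  cases z <;> simp [payRowP, coefP, PVar.toIdx]

theorem zeroRowP_eq (j : Fin n) : zeroRowP j = coefP A (.inr j) ∘ PVar.toIdx := by
  ext z
  cases z <;> simp [zeroRowP, coefP, PVar.toIdx]

theorem sumColQ_eq : sumColQ = (coefSumQ : Idx m n → ℝ) ∘ QVar.toIdx := by
  ext z
  cases z <;> rfl

theorem payColQ_eq (j : Fin n) : payColQ C β j = coefQ C β (.inr j) ∘ QVar.toIdx := by
  ext z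
  cases z <;> simp [payColQ, coefQ, QVar.toIdx]

theorem zeroColQ_eq (i : Fin m) : zeroColQ i = coefQ C β (.inl i) ∘ QVar.toIdx := by
  ext z
  cases z <;> simp [zeroColQ, coefQ, QVar.toIdx]

/-- The determinant of `E(u)`, as the determinant of a list of equations in all variables. -/
theorem det_matrixE_eq (u : PPoint n × QPoint m) (X Xc Dx : List (Fin m)) (Y Yc Dy : List (Fin n))
    (hX : sortedList (inX A u) = X) (hXc : sortedList (fun i => ¬ inX A u i) = Xc)
    (hDx : sortedList (fun i => inX A u i ∧ Sum.inl i ∈ labelQ C β u.2) = Dx)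
    (hY : sortedList (inY C β u) = Y) (hYc : sortedList (fun j => ¬ inY C β u j) = Yc)
    (hDy : sortedList (fun j => inY C β u j ∧ Sum.inr j ∈ labelP A u.1) = Dy)
    (hlen : X.length + Dy.length + Yc.length = n) :
    (matrixE A C β u).det = (coeffMatrix (n + 1 + (m + 2))
      ([coefSumP] ++ X.map (fun i => coefP A (Sum.inl i)) ++ Dy.map (fun i => coefP A (Sum.inr i)) ++ Yc.map (fun i => coefP A (Sum.inr i)) ++
        ([coefSumQ] ++ Y.map (fun i => coefQ C β (Sum.inr i)) ++ Dx.map (fun i => coefQ C β (Sum.inl i)) ++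
          Xc.map (fun i => coefQ C β (Sum.inl i))))
      (Y.map (Sum.inl ∘ Sum.inr) ++ Yc.map (Sum.inl ∘ Sum.inr) ++ [Sum.inr 0] ++
        ([Sum.inr 2] ++ X.map (Sum.inl ∘ Sum.inl) ++ Xc.map (Sum.inl ∘ Sum.inl) ++
          [Sum.inr 1]))).det := by
  have hYlen := length_sortedList_add (inY C β u)
  rw [hY, hYc] at hYlen
  rw [matrixE, Matrix.det_fromBlocks_zero₂₁, matrixEv, matrixEw, Matrix.transpose_transpose,
    hX, hXc, hDx, hY, hYc, hDy]
  rw [det_coeffMatrix_append (N₁ := n + 1) (N₂ := m + 2) _ _ _ _ (by simp; omega) (by simp; omega)]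
  · congr 2
    · convert! coeffMatrix_map (N := n + 1) (PVar.toIdx (m := m)) ([coefSumP] ++
        X.map (fun i => coefP A (Sum.inl i)) ++ Dy.map (fun i => coefP A (Sum.inr i)) ++ Yc.map (fun i => coefP A (Sum.inr i))) _ using 2
      · simp [sumRowP_eq (m := m), funext (payRowP_eq (A := A)), funext (zeroRowP_eq (A := A)),
          Function.comp_def]
      · simp [Function.comp_def, PVar.toIdx]
    · convert! coeffMatrix_map (N := m + 2) (QVar.toIdx (n := n)) ([coefSumQ] ++
        Y.map (fun i => coefQ C β (Sum.inr i)) ++ Dx.map (fun i => coefQ C β (Sum.inl i)) ++ Xc.map (fun i => coefQ C β (Sum.inl i))) _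
        using 2
      · simp [sumColQ_eq (n := n), funext (payColQ_eq (C := C) (β := β)),
          funext (zeroColQ_eq (C := C) (β := β)), Function.comp_def]
      · simp [Function.comp_def, QVar.toIdx]
  · intro f hf z hz
    have hz' : (∃ j, z = .inl (.inr j)) ∨ z = .inr 0 := by
      simp only [List.mem_append, List.mem_map, List.mem_singleton] at hz
      rcases hz with (⟨j, -, rfl⟩ | ⟨j, -, rfl⟩) | rfl
      · exact Or.inl ⟨j, rfl⟩
      · exact Or.inl ⟨j, rfl⟩
      · exact Or.inr rfl
    have hf' : f = coefSumQ ∨ ∃ ℓ, f = coefQ C β ℓ := by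
      simp only [List.mem_append, List.mem_map, List.mem_singleton] at hf
      rcases hf with ((rfl | ⟨j, -, rfl⟩) | ⟨i, -, rfl⟩) | ⟨i, -, rfl⟩
      · exact Or.inl rfl
      · exact Or.inr ⟨_, rfl⟩
      · exact Or.inr ⟨_, rfl⟩
      · exact Or.inr ⟨_, rfl⟩
    rcases hf' with rfl | ⟨i | j, rfl⟩ <;> rcases hz' with ⟨j, rfl⟩ | rfl <;>
      simp [coefSumQ, coefQ]

end

namespace IsGameSpace

variable {m n : ℕ} {A C : Matrix (Fin m) (Fin n) ℝ} {β : Fin n → ℝ} {jₛ jₑ : Fin n}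

/-- `E(u)` contains the same equations as the matrix of the vertex. Once the columns follow the
order of the rows, it is that matrix written in an enumeration of its index set, so only the parity
of the block exchanges has to be found. If the duplicate label lies in `Y`, its row in `E(u)` is the
one of `P`, and the exchanged form of the matrix is used; the extra sign makes the two cases agree.
-/
theorem det_matrixE (h : IsGameSpace A C β jₛ jₑ) (u : NVert A C β) :
    (matrixE A C β u.1).det = -(-1) ^ (m + n) * (h.vertexMatrix u).det := by
  classical
  have hXlen := length_sortedList_add (inX A u.1)
  have hYlen := length_sortedList_add (inY C β u.1)
  have hcard := (h.vertexP_iff.1 u.2.2.1).2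
  have hinter := Set.ext_iff.1 (h.inter_eq u)
  have hunion := Set.ext_iff.1 (union_eq u)
  simp only [Set.mem_inter_iff, Set.mem_singleton_iff, Set.mem_union, Set.mem_univ,
    iff_true] at hinter hunion
  have hXiff : ∀ i, inX A u.1 i ↔ Sum.inl i ∈ tight (ineqP A) u.1.1 := fun i => by
    rw [inX, labelP_eq]
  have hYiff : ∀ j, inY C β u.1 j ↔ Sum.inr j ∈ tight (ineqQ C β) u.1.2 := fun j => by
    rw [inY, labelQ_eq]
  have hXm : ∀ i, i ∈ sortedList (inX A u.1) ↔ Sum.inl i ∈ tight (ineqP A) u.1.1 := fun i => by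
    rw [mem_sortedList, hXiff]
  have hXcm : ∀ i, i ∈ sortedList (fun i => ¬ inX A u.1 i) ↔
      Sum.inl i ∉ tight (ineqP A) u.1.1 := fun i => by
    rw [mem_sortedList, hXiff]
  have hYm : ∀ j, j ∈ sortedList (inY C β u.1) ↔ Sum.inr j ∈ tight (ineqQ C β) u.1.2 :=
    fun j => by rw [mem_sortedList, hYiff]
  have hYcm : ∀ j, j ∈ sortedList (fun j => ¬ inY C β u.1 j) ↔
      Sum.inr j ∉ tight (ineqQ C β) u.1.2 := fun j => by
    rw [mem_sortedList, hYiff]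
  have hXn := nodup_sortedList (inX A u.1)
  have hXcn := nodup_sortedList (fun i => ¬ inX A u.1 i)
  have hYn := nodup_sortedList (inY C β u.1)
  have hYcn := nodup_sortedList (fun j => ¬ inY C β u.1 j)
  -- `L(v)` consists of `X`, of `-Y` and, if it lies in `Y`, the duplicate label. Counting shows
  -- that `E(v)` is square, and later compares `|Y|` with `|X|`.
  have hL : ∀ Dy : List (Fin n), (∀ j, j ∈ Dy ↔ Sum.inr j = h.dup u) → Dy.Nodup →
      (sortedList (inX A u.1)).length + Dy.length +
        (sortedList fun j => ¬ inY C β u.1 j).length = n := by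
    intro Dy hDy hDyn
    let l : List (Fin m ⊕ Fin n) := (sortedList (inX A u.1)).map .inl ++ Dy.map .inr ++
      (sortedList fun j => ¬ inY C β u.1 j).map .inr
    have hnd : l.Nodup := by
      refine ((hXn.map Sum.inl_injective).append (hDyn.map Sum.inr_injective) ?_).append
        (hYcn.map Sum.inr_injective) ?_
      · intro a ha hb
        obtain ⟨i, -, rfl⟩ := List.mem_map.1 ha
        simp at hb
      · intro a ha hb
        obtain ⟨j, hj, rfl⟩ := List.mem_map.1 hb
        rw [List.mem_append] at ha
        rcases ha with ha | ha
        · simp at ha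
        · have : j ∈ Dy := by simpa using ha
          rw [hYcm] at hj
          exact hj ((hinter _).2 ((hDy j).1 this)).2
    have hset : tight (ineqP A) u.1.1 = (l.toFinset : Set (Fin m ⊕ Fin n)) := by
      ext ℓ
      simp only [List.coe_toFinset, Set.mem_ofPred_eq, l, List.mem_append, List.mem_map]
      have h1 := hinter ℓ
      have h2 := hunion ℓ
      cases ℓ with
      | inl i => simp [hXm]
      | inr j =>
        simp [hDy, hYcm]
        tauto
    rw [hset, Set.ncard_coe_finset, List.toFinset_card_of_nodup hnd] at hcard
    simpa [l, add_assoc] using hcard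
  set X := sortedList (inX A u.1) with hX
  set Xc := sortedList (fun i => ¬ inX A u.1 i) with hXc
  set Y := sortedList (inY C β u.1) with hY
  set Yc := sortedList (fun j => ¬ inY C β u.1 j) with hYc
  have disj : ∀ {α γ : Type} {l₁ l₂ : List α} {f : α → γ}, Function.Injective f →
      (∀ a ∈ l₁, a ∉ l₂) → (l₁.map f).Disjoint (l₂.map f) := by
    intro α γ l₁ l₂ f hf hd a ha hb
    obtain ⟨x, hx, rfl⟩ := List.mem_map.1 ha
    obtain ⟨y, hy, hxy⟩ := List.mem_map.1 hb
    rw [hf hxy] at hy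
    exact hd x hx hy
  cases hd : h.dup u with
  | inl i₀ =>
    rw [hd] at hinter
    have hDx : sortedList (fun i => inX A u.1 i ∧ Sum.inl i ∈ labelQ C β u.1.2) = [i₀] := by
      refine sortedList_eq_singleton fun i => ?_
      rw [hXiff, labelQ_eq, hinter, Sum.inl.injEq]
    have hDy : sortedList (fun j => inY C β u.1 j ∧ Sum.inr j ∈ labelP A u.1.1) = [] := by
      refine sortedList_eq_nil fun j => ?_
      rw [hYiff, labelP_eq, and_comm, hinter]
      simp
    have hlen := hL [] (by simp [hd]) List.nodup_nil
    rw [det_matrixE_eq u.1 X Xc [i₀] Y Yc [] rfl rfl hDx rfl rfl hDy hlen]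
    set a : List (Idx m n) := X.map (Sum.inl ∘ Sum.inl) with ha
    set b : List (Idx m n) := Y.map (Sum.inl ∘ Sum.inr) with hb
    set a' : List (Idx m n) := Xc.map (Sum.inl ∘ Sum.inl) with ha'
    set b' : List (Idx m n) := Yc.map (Sum.inl ∘ Sum.inr) with hb'
    have la : a.length = X.length := by simp [ha]
    have lb : b.length = Y.length := by simp [hb]
    have la' : a'.length = Xc.length := by simp [ha']
    have lb' : b'.length = Yc.length := by simp [hb']
    simp only [List.length_nil, add_zero] at hlen
    have hR : ([coefSumP] ++ X.map (fun i => coefP A (Sum.inl i)) ++ ([] : List (Fin n)).map (fun i => coefP A (Sum.inr i)) ++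
        Yc.map (fun i => coefP A (Sum.inr i)) ++ ([coefSumQ] ++ Y.map (fun i => coefQ C β (Sum.inr i)) ++
        [i₀].map (fun i => coefQ C β (Sum.inl i)) ++ Xc.map (fun i => coefQ C β (Sum.inl i)))) =
        ([Sum.inr 0] ++ a ++ b' ++ [Sum.inr 1] ++ b ++ [Sum.inr 2] ++ a').map (fun a c => h.vertexMatrix u a c) := by
      have e1 : ∀ i ∈ X, h.vertexMatrix u (.inl (.inl i)) = coefP A (.inl i) := fun i hi => by
        simp [vertexMatrix, pairMatrix, (hXm i).1 hi]
      have e2 : ∀ i ∈ Xc, h.vertexMatrix u (.inl (.inl i)) = coefQ C β (.inl i) := fun i hi => by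
        simp [vertexMatrix, pairMatrix, (hXcm i).1 hi]
      have e3 : ∀ j ∈ Yc, h.vertexMatrix u (.inl (.inr j)) = coefP A (.inr j) := fun j hj => by
        have := (hunion (.inr j)).resolve_right ((hYcm j).1 hj)
        simp [vertexMatrix, pairMatrix, this]
      have e4 : ∀ j ∈ Y, h.vertexMatrix u (.inl (.inr j)) = coefQ C β (.inr j) := fun j hj => by
        have : Sum.inr j ∉ tight (ineqP A) u.1.1 := fun h' => by
          simpa using (hinter (.inr j)).1 ⟨h', (hYm j).1 hj⟩
        simp [vertexMatrix, pairMatrix, this]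
      have e5 : h.vertexMatrix u (.inr 2) = coefQ C β (.inl i₀) := by
        simp [vertexMatrix, pairMatrix, hd]
      simp only [List.map_append, ha, hb, ha', hb', List.map_map, List.map_cons, List.map_nil,
        e5, List.append_assoc, List.append_nil]
      congr 1
      congr 1
      · exact List.map_congr_left fun i hi => (e1 i hi).symm
      congr 1
      · exact List.map_congr_left fun i hi => (e3 i hi).symm
      congr 1
      congr 1
      · exact List.map_congr_left fun i hi => (e4 i hi).symm
      congr 1
      · exact List.map_congr_left fun i hi => (e2 i hi).symm
    rw [hR]
    set R := ([Sum.inr 0] ++ a ++ b' ++ [Sum.inr 1] ++ b ++ [Sum.inr 2] ++ a').map (fun a c => h.vertexMatrix u a c)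
    -- From the order `y_Y, y_{-Y}, π₁, lam, x_X, x_{-X}, π₂`: `π₁` moves to the front, `x_X` behind
    -- it, then `y_{-Y}` before `y_Y`, and finally `π₂` before `y_Y`. Each payoff row thereby meets
    -- the variable of its own label, and `lam` the row of the duplicate label.
    have s1 := det_coeffMatrix_block (N := n + 1 + (m + 2)) R (b ++ b') [Sum.inr 0] []
      ([Sum.inr 2] ++ a ++ a' ++ [Sum.inr 1]) (by simp; omega)
    have s2 := det_coeffMatrix_block (N := n + 1 + (m + 2)) R (b ++ b' ++ [Sum.inr 2]) a [Sum.inr 0]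
      (a' ++ [Sum.inr 1]) (by simp; omega)
    have s3 := det_coeffMatrix_block (N := n + 1 + (m + 2)) R b b' ([Sum.inr 0] ++ a)
      ([Sum.inr 2] ++ a' ++ [Sum.inr 1]) (by simp; omega)
    have s4 := det_coeffMatrix_block (N := n + 1 + (m + 2)) R (b ++ [Sum.inr 2] ++ a') [Sum.inr 1]
      ([Sum.inr 0] ++ a ++ b') [] (by simp; omega)
    have s5 := det_coeffMatrix_enum (N := n + 1 + (m + 2)) (h.vertexMatrix u)
      ([Sum.inr 0] ++ a ++ b' ++ [Sum.inr 1] ++ b ++ [Sum.inr 2] ++ a') (by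
        have hsll : Function.Injective (Sum.inl ∘ Sum.inl : Fin m → Idx m n) :=
          Sum.inl_injective.comp Sum.inl_injective
        have hslr : Function.Injective (Sum.inl ∘ Sum.inr : Fin n → Idx m n) :=
          Sum.inl_injective.comp Sum.inr_injective
        have d1 := disj hsll (l₁ := X) (l₂ := Xc) fun i hi hi' => (hXcm i).1 hi' ((hXm i).1 hi)
        have d2 := disj hslr (l₁ := Yc) (l₂ := Y) fun i hi hi' => (hYcm i).1 hi ((hYm i).1 hi')
        simp only [List.append_assoc, List.nodup_append', List.disjoint_append_right,
          ha, ha', hb, hb', hXn.map hsll, hXcn.map hsll, hYn.map hslr, hYcn.map hslr, d1, d2]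
        simp [List.disjoint_left])
      (by
        rintro ((i | j) | k)
        · have : Sum.inl i ∈ tight (ineqP A) u.1.1 ∨ Sum.inl i ∉ tight (ineqP A) u.1.1 := em _
          simpa [ha, ha', hb, hb', hXm, hXcm] using this
        · have : Sum.inr j ∈ tight (ineqQ C β) u.1.2 ∨ Sum.inr j ∉ tight (ineqQ C β) u.1.2 := em _
          simpa [ha, ha', hb, hb', hYm, hYcm] using this.symm
        · fin_cases k <;> simp) (by simp; omega)
    change (coeffMatrix _ R _).det = _ at s5
    clear_value R
    simp only [List.append_assoc, List.nil_append, List.append_nil, List.length_append,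
      List.length_cons, List.length_nil, zero_add, mul_one] at s1 s2 s3 s4 s5 ⊢
    rw [s1, s2, s3, s4]
    rw [s5]
    simp only [← mul_assoc, ← pow_add]
    congr 1
    have hp : -(-1 : ℝ) ^ (m + n) = (-1) ^ (m + n + 1) := by rw [pow_succ]; ring
    rw [hp]
    refine neg_one_pow_eq_of_even_add ?_
    have hYX : Y.length = X.length := by omega
    rw [la, lb, la', lb', hYX]
    exact parity_dup_inl _ _ _ hXlen (hYX ▸ hYlen)
  | inr j₀ =>
    rw [hd] at hinter
    have hDx : sortedList (fun i => inX A u.1 i ∧ Sum.inl i ∈ labelQ C β u.1.2) = [] := by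
      refine sortedList_eq_nil fun i => ?_
      rw [hXiff, labelQ_eq, hinter]
      simp
    have hDy : sortedList (fun j => inY C β u.1 j ∧ Sum.inr j ∈ labelP A u.1.1) = [j₀] := by
      refine sortedList_eq_singleton fun j => ?_
      rw [hYiff, labelP_eq, and_comm, hinter, Sum.inr.injEq]
    have hlen := hL [j₀] (by simp [hd]) (List.nodup_singleton _)
    rw [det_matrixE_eq u.1 X Xc [] Y Yc [j₀] rfl rfl hDx rfl rfl hDy hlen]
    set a : List (Idx m n) := X.map (Sum.inl ∘ Sum.inl) with ha
    set b : List (Idx m n) := Y.map (Sum.inl ∘ Sum.inr) with hb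
    set a' : List (Idx m n) := Xc.map (Sum.inl ∘ Sum.inl) with ha'
    set b' : List (Idx m n) := Yc.map (Sum.inl ∘ Sum.inr) with hb'
    have la : a.length = X.length := by simp [ha]
    have lb : b.length = Y.length := by simp [hb]
    have la' : a'.length = Xc.length := by simp [ha']
    have lb' : b'.length = Yc.length := by simp [hb']
    simp only [List.length_singleton] at hlen
    let M := pairMatrix (coefQ C β) (coefP A) (tight (ineqQ C β) u.1.2) (coefP A (.inr j₀))
    have hR : ([coefSumP] ++ X.map (fun i => coefP A (Sum.inl i)) ++ [j₀].map (fun i => coefP A (Sum.inr i)) ++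
        Yc.map (fun i => coefP A (Sum.inr i)) ++ ([coefSumQ] ++ Y.map (fun i => coefQ C β (Sum.inr i)) ++
        ([] : List (Fin m)).map (fun i => coefQ C β (Sum.inl i)) ++ Xc.map (fun i => coefQ C β (Sum.inl i)))) =
        ([Sum.inr 0] ++ a ++ [Sum.inr 2] ++ b' ++ [Sum.inr 1] ++ b ++ a').map (fun a c => M a c) := by
      have e1 : ∀ i ∈ X, M (.inl (.inl i)) = coefP A (.inl i) := fun i hi => by
        have : Sum.inl i ∉ tight (ineqQ C β) u.1.2 := fun h' => by
          simpa using (hinter (.inl i)).1 ⟨(hXm i).1 hi, h'⟩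
        simp [M, pairMatrix, this]
      have e2 : ∀ i ∈ Xc, M (.inl (.inl i)) = coefQ C β (.inl i) := fun i hi => by
        have := (hunion (.inl i)).resolve_left ((hXcm i).1 hi)
        simp [M, pairMatrix, this]
      have e3 : ∀ j ∈ Yc, M (.inl (.inr j)) = coefP A (.inr j) := fun j hj => by
        simp [M, pairMatrix, (hYcm j).1 hj]
      have e4 : ∀ j ∈ Y, M (.inl (.inr j)) = coefQ C β (.inr j) := fun j hj => by
        simp [M, pairMatrix, (hYm j).1 hj]
      have e5 : M (.inr 2) = coefP A (.inr j₀) := by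
        simp [M, pairMatrix]
      simp only [List.map_append, ha, hb, ha', hb', List.map_map, List.map_cons, List.map_nil,
        e5, List.append_assoc, List.nil_append]
      congr 1
      congr 1
      · exact List.map_congr_left fun i hi => (e1 i hi).symm
      congr 1
      congr 1
      · exact List.map_congr_left fun i hi => (e3 i hi).symm
      congr 1
      congr 1
      · exact List.map_congr_left fun i hi => (e4 i hi).symm
      exact List.map_congr_left fun i hi => (e2 i hi).symm
    rw [hR]
    set R := ([Sum.inr 0] ++ a ++ [Sum.inr 2] ++ b' ++ [Sum.inr 1] ++ b ++ a').map (fun a c => M a c)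
    have s1 := det_coeffMatrix_block (N := n + 1 + (m + 2)) R (b ++ b') [Sum.inr 0] []
      ([Sum.inr 2] ++ a ++ a' ++ [Sum.inr 1]) (by simp; omega)
    have s2 := det_coeffMatrix_block (N := n + 1 + (m + 2)) R (b ++ b' ++ [Sum.inr 2]) a [Sum.inr 0]
      (a' ++ [Sum.inr 1]) (by simp; omega)
    have s3 := det_coeffMatrix_block (N := n + 1 + (m + 2)) R b b' ([Sum.inr 0] ++ a)
      ([Sum.inr 2] ++ a' ++ [Sum.inr 1]) (by simp; omega)
    -- Now the duplicate row stands in the block of `P`, so `lam` moves further forward, directly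
    -- behind `x_X`.
    have s4 := det_coeffMatrix_block (N := n + 1 + (m + 2)) R (b' ++ b) [Sum.inr 2]
      ([Sum.inr 0] ++ a) (a' ++ [Sum.inr 1]) (by simp; omega)
    have s5 := det_coeffMatrix_block (N := n + 1 + (m + 2)) R (b ++ a') [Sum.inr 1]
      ([Sum.inr 0] ++ a ++ [Sum.inr 2] ++ b') [] (by simp; omega)
    have s6 := det_coeffMatrix_enum (N := n + 1 + (m + 2)) M
      ([Sum.inr 0] ++ a ++ [Sum.inr 2] ++ b' ++ [Sum.inr 1] ++ b ++ a') (by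
        have hsll : Function.Injective (Sum.inl ∘ Sum.inl : Fin m → Idx m n) :=
          Sum.inl_injective.comp Sum.inl_injective
        have hslr : Function.Injective (Sum.inl ∘ Sum.inr : Fin n → Idx m n) :=
          Sum.inl_injective.comp Sum.inr_injective
        have d1 := disj hsll (l₁ := X) (l₂ := Xc) fun i hi hi' => (hXcm i).1 hi' ((hXm i).1 hi)
        have d2 := disj hslr (l₁ := Yc) (l₂ := Y) fun i hi hi' => (hYcm i).1 hi ((hYm i).1 hi')
        simp only [List.append_assoc, List.nodup_append', List.disjoint_append_right,
          ha, ha', hb, hb', hXn.map hsll, hXcn.map hsll, hYn.map hslr, hYcn.map hslr, d1, d2]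
        simp [List.disjoint_left])
      (by
        rintro ((i | j) | k)
        · have : Sum.inl i ∈ tight (ineqP A) u.1.1 ∨ Sum.inl i ∉ tight (ineqP A) u.1.1 := em _
          simpa [ha, ha', hb, hb', hXm, hXcm] using this
        · have : Sum.inr j ∈ tight (ineqQ C β) u.1.2 ∨ Sum.inr j ∉ tight (ineqQ C β) u.1.2 := em _
          simpa [ha, ha', hb, hb', hYm, hYcm] using this.symm
        · fin_cases k <;> simp) (by simp; omega)
    change (coeffMatrix _ R _).det = _ at s6
    clear_value R
    simp only [List.append_assoc, List.nil_append, List.append_nil, List.length_append,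
      List.length_cons, List.length_nil, zero_add, mul_one] at s1 s2 s3 s4 s5 s6 ⊢
    rw [s1, s2, s3, s4, s5]
    rw [s6, h.det_vertexMatrix_swap u, hd, neg_mul_neg]
    simp only [← mul_assoc, ← pow_add]
    congr 1
    refine neg_one_pow_eq_of_even_add ?_
    have hYX : Y.length = X.length + 1 := by omega
    rw [la, lb, la', lb', hYX]
    exact parity_dup_inr _ _ _ hXlen (hYX ▸ hYlen)

end IsGameSpace

/-! ## The orientation -/

namespace IsGameSpace

variable {m n : ℕ} {A C : Matrix (Fin m) (Fin n) ℝ} {β : Fin n → ℝ} {jₛ jₑ : Fin n}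

/-- The edge of kind `k` at `u` is directed away from `u`. -/
def IsAway (u : NVert A C β) : EdgeKind → Prop
  | .inP => vertexSign u = 1
  | .inQ => vertexSign u ≠ 1

theorem vertexSign_mul (h : IsGameSpace A C β jₛ jₑ) {u u' : NVert A C β}
    (hneg : (h.vertexMatrix u).det * (h.vertexMatrix u').det < 0) :
    vertexSign u * vertexSign u' = -1 := by
  rw [vertexSign, vertexSign, ← sign_mul, h.det_matrixE u, h.det_matrixE u', sign_eq_neg_one_iff]
  have : ((-1 : ℝ) ^ (m + n)) * (-1) ^ (m + n) = 1 := by rw [← mul_pow]; simp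
  linear_combination (exp := 1) hneg + ((h.vertexMatrix u).det * (h.vertexMatrix u').det) * this

/-- Product `-1` excludes the sign zero, so exactly one factor is `+1`. -/
theorem vertexSign_eq_one_iff {u u' : NVert A C β} (hs : vertexSign u * vertexSign u' = -1) :
    vertexSign u = 1 ↔ ¬ vertexSign u' = 1 := by
  revert hs
  generalize vertexSign u = s
  generalize vertexSign u' = s'
  revert s s'
  decide

theorem mem_edgeAt_self (u : NVert A C β) (k : EdgeKind) : u.1 ∈ (edgeAt u k).1 := by
  cases k
  · exact mem_edgeAt_inP.2 rfl
  · exact mem_edgeAt_inQ.2 rfl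

theorem edgeAt_eq_of_mem {u u' : NVert A C β} {k : EdgeKind} (hu : u'.1 ∈ (edgeAt u k).1) :
    edgeAt u' k = edgeAt u k := by
  cases k
  · exact edgeAt_inP_eq (mem_edgeAt_inP.1 hu)
  · exact edgeAt_inQ_eq (mem_edgeAt_inQ.1 hu)

theorem kind_eq (h : IsGameSpace A C β jₛ jₑ) {u u' : NVert A C β} {k k' : EdgeKind}
    (heq : edgeAt u k = edgeAt u' k') : k = k' := by
  cases k <;> cases k'
  · rfl
  · exact absurd heq (h.edgeAt_inP_ne_inQ u u')
  · exact absurd heq.symm (h.edgeAt_inP_ne_inQ u' u)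
  · rfl

theorem vertexSign_mul_of_mem (h : IsGameSpace A C β jₛ jₑ) {u u' : NVert A C β} {k : EdgeKind}
    (hu : u'.1 ∈ (edgeAt u k).1) (hne : u' ≠ u) : vertexSign u * vertexSign u' = -1 := by
  cases k
  · exact h.vertexSign_mul (h.det_mul_neg_inP (mem_edgeAt_inP.1 hu) hne)
  · exact h.vertexSign_mul (h.det_mul_neg_inQ (mem_edgeAt_inQ.1 hu) hne)

/-- The consistency of the local rule: an edge that leaves one end enters the other, because the
signs differ while the kind of the edge is the same. -/
theorem isAway_iff_not (h : IsGameSpace A C β jₛ jₑ) {u u' : NVert A C β} {k : EdgeKind}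
    (hu : u'.1 ∈ (edgeAt u k).1) (hne : u' ≠ u) : IsAway u k ↔ ¬ IsAway u' k := by
  have := vertexSign_eq_one_iff (h.vertexSign_mul_of_mem hu hne)
  cases k <;> simp only [IsAway, ne_eq] <;> tauto

theorem isAway_iff_of_ne {u : NVert A C β} {k k' : EdgeKind} (hk : k' ≠ k) :
    IsAway u k' ↔ ¬ IsAway u k := by
  cases k <;> cases k' <;> simp [IsAway] at hk ⊢

theorem exists_kind_of_adj (h : IsGameSpace A C β jₛ jₑ) {u u' : NVert A C β}
    (hadj : (NGraph A C β).Adj u u') : ∃ k, u'.1 ∈ (edgeAt u k).1 := by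
  obtain ⟨-, e, he, hu, hu'⟩ := hadj
  obtain ⟨u₀, k, hk⟩ := h.exists_eq_edgeAt ⟨e, he⟩
  have hu0 : u.1 ∈ (edgeAt u₀ k).1 := hk ▸ hu
  refine ⟨k, ?_⟩
  rw [edgeAt_eq_of_mem hu0, ← hk]
  exact hu'

theorem adj_of_mem {u u' : NVert A C β} {k : EdgeKind} (hu : u'.1 ∈ (edgeAt u k).1)
    (hne : u' ≠ u) : (NGraph A C β).Adj u u' :=
  ⟨hne.symm, _, (edgeAt u k).2, mem_edgeAt_self u k, hu⟩

theorem ray_or_segment (h : IsGameSpace A C β jₛ jₑ) (u : NVert A C β) (k : EdgeKind) :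
    (k = .inQ ∧ ∀ u' : NVert A C β, u'.1 ∈ (edgeAt u k).1 → u' = u) ∨
    ∃ u' : NVert A C β, u'.1 ∈ (edgeAt u k).1 ∧ u' ≠ u ∧
      ∀ u'' : NVert A C β, u''.1 ∈ (edgeAt u k).1 → u'' = u ∨ u'' = u' := by
  cases k
  · obtain ⟨u', h1, h2, h3⟩ := h.inP_segment u
    exact Or.inr ⟨u', mem_edgeAt_inP.2 h1, h2, fun u'' hu => h3 u'' (mem_edgeAt_inP.1 hu)⟩
  · rcases h.inQ_ray_or_segment u with ⟨-, h1⟩ | ⟨u', h1, h2, h3⟩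
    · exact Or.inl ⟨rfl, fun u' hu => h1 u' (mem_edgeAt_inQ.1 hu)⟩
    · exact Or.inr ⟨u', mem_edgeAt_inQ.2 h1, h2, fun u'' hu => h3 u'' (mem_edgeAt_inQ.1 hu)⟩

/-- The rule is demanded for every description of the edge by a vertex and a kind, since an edge as
a set does not remember from which end it was described. -/
theorem exists_direction (h : IsGameSpace A C β jₛ jₑ) (e : NEdges A C β) :
    ∃ d : Option (NVert A C β) × Option (NVert A C β), IsDirectionOf d e ∧
      ∀ u k, e = edgeAt u k → (IsAway u k → d.1 = some u) ∧ (¬ IsAway u k → d.2 = some u) := by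
  classical
  obtain ⟨u, k, rfl⟩ := h.exists_eq_edgeAt e
  have hself := mem_edgeAt_self u k
  have hmem : ∀ u' k', edgeAt u k = edgeAt u' k' → k' = k ∧ u'.1 ∈ (edgeAt u k).1 := by
    intro u' k' heq
    refine ⟨(h.kind_eq heq).symm, ?_⟩
    rw [heq]
    exact mem_edgeAt_self u' k'
  rcases h.ray_or_segment u k with ⟨-, huniq⟩ | ⟨v, hv, hne, huniq⟩
  · by_cases ha : IsAway u k
    · refine ⟨(some u, none), ⟨by simp, fun u' => ⟨fun hu' => ?_, ?_⟩⟩, fun u' k' heq => ?_⟩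
      · simp [huniq u' hu']
      · rintro (h' | h') <;> simp at h'
        exact h' ▸ hself
      · obtain ⟨rfl, hu'⟩ := hmem u' k' heq
        rw [huniq u' hu']
        exact ⟨fun _ => rfl, fun h' => absurd ha h'⟩
    · refine ⟨(none, some u), ⟨by simp, fun u' => ⟨fun hu' => ?_, ?_⟩⟩, fun u' k' heq => ?_⟩
      · simp [huniq u' hu']
      · rintro (h' | h') <;> simp at h'
        exact h' ▸ hself
      · obtain ⟨rfl, hu'⟩ := hmem u' k' heq
        rw [huniq u' hu']
        exact ⟨fun h' => absurd h' ha, fun _ => rfl⟩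
  · have hopp := h.isAway_iff_not hv hne
    by_cases ha : IsAway u k
    · refine ⟨(some u, some v), ⟨by simpa using hne.symm, fun u' => ⟨fun hu' => ?_, ?_⟩⟩,
        fun u' k' heq => ?_⟩
      · rcases huniq u' hu' with rfl | rfl <;> simp
      · rintro (h' | h') <;> simp at h'
        · exact h' ▸ hself
        · exact h' ▸ hv
      · obtain ⟨rfl, hu'⟩ := hmem u' k' heq
        rcases huniq u' hu' with rfl | rfl
        · exact ⟨fun _ => rfl, fun h' => absurd ha h'⟩
        · exact ⟨fun h' => absurd h' (hopp.1 ha), fun _ => rfl⟩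
    · refine ⟨(some v, some u), ⟨by simpa using hne, fun u' => ⟨fun hu' => ?_, ?_⟩⟩,
        fun u' k' heq => ?_⟩
      · rcases huniq u' hu' with rfl | rfl <;> simp
      · rintro (h' | h') <;> simp at h'
        · exact h' ▸ hv
        · exact h' ▸ hself
      · obtain ⟨rfl, hu'⟩ := hmem u' k' heq
        rcases huniq u' hu' with rfl | rfl
        · exact ⟨fun h' => absurd h' ha, fun _ => rfl⟩
        · exact ⟨fun _ => rfl, fun h' => absurd (by tauto) ha⟩

/-- An orientation of the edges of `𝒩` that is determined by the signs of the vertices. -/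
structure IsSignOrientation
    (dir : NEdges A C β → Option (NVert A C β) × Option (NVert A C β)) : Prop where
  isDirection : ∀ e, IsDirectionOf (dir e) e
  tail : ∀ u k, IsAway u k → (dir (edgeAt u k)).1 = some u
  head : ∀ u k, ¬ IsAway u k → (dir (edgeAt u k)).2 = some u

theorem exists_signOrientation (h : IsGameSpace A C β jₛ jₑ) :
    ∃ dir : NEdges A C β → Option (NVert A C β) × Option (NVert A C β),
      IsSignOrientation dir := by
  choose dir h1 h2 using h.exists_direction
  exact ⟨dir, h1, fun u k hu => (h2 _ u k rfl).1 hu, fun u k hu => (h2 _ u k rfl).2 hu⟩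

section Orientation

variable {dir : NEdges A C β → Option (NVert A C β) × Option (NVert A C β)}

theorem IsSignOrientation.isAway_iff_tail (hd : IsSignOrientation dir) (u : NVert A C β)
    (k : EdgeKind) : IsAway u k ↔ (dir (edgeAt u k)).1 = some u := by
  refine ⟨hd.tail u k, fun h1 => ?_⟩
  by_contra h2
  exact (hd.isDirection _).1 (h1.trans (hd.head u k h2).symm)

theorem IsSignOrientation.not_isAway_iff_head (hd : IsSignOrientation dir) (u : NVert A C β)
    (k : EdgeKind) : ¬ IsAway u k ↔ (dir (edgeAt u k)).2 = some u := by
  refine ⟨hd.head u k, fun h1 h2 => ?_⟩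
  exact (hd.isDirection _).1 ((hd.tail u k h2).trans h1.symm)

theorem IsSignOrientation.directed_of_isAway (hd : IsSignOrientation dir) {u u' : NVert A C β}
    {k : EdgeKind} (hu : u'.1 ∈ (edgeAt u k).1) (hne : u' ≠ u) (ha : IsAway u k) :
    DirectedFromTo dir u u' := by
  refine ⟨edgeAt u k, Prod.ext (hd.tail u k ha) ?_⟩
  rcases ((hd.isDirection _).2 u').1 hu with h1 | h1
  · rw [hd.tail u k ha] at h1
    exact absurd (Option.some.inj h1).symm hne
  · exact h1

theorem IsSignOrientation.directed_of_not_isAway (hd : IsSignOrientation dir)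
    {u u' : NVert A C β} {k : EdgeKind} (hu : u'.1 ∈ (edgeAt u k).1) (hne : u' ≠ u)
    (ha : ¬ IsAway u k) : DirectedFromTo dir u' u := by
  refine ⟨edgeAt u k, Prod.ext ?_ (hd.head u k ha)⟩
  rcases ((hd.isDirection _).2 u').1 hu with h1 | h1
  · exact h1
  · rw [hd.head u k ha] at h1
    exact absurd (Option.some.inj h1).symm hne

/-- An edge contains at most two vertices, so two consecutive steps that do not turn back use edges
of different kinds. -/
theorem kind_ne_of_adj (h : IsGameSpace A C β jₛ jₑ) {a b c : NVert A C β} {k k' : EdgeKind}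
    (hab : b.1 ∈ (edgeAt a k).1) (hbc : c.1 ∈ (edgeAt b k').1) (hba : b ≠ a) (hcb : c ≠ b)
    (hac : c ≠ a) : k' ≠ k := by
  rintro rfl
  rw [edgeAt_eq_of_mem hab] at hbc
  rcases h.ray_or_segment a k' with ⟨-, h1⟩ | ⟨u', -, -, h1⟩
  · exact hba (h1 b hab)
  · have h2 := (h1 b hab).resolve_left hba
    have h3 := (h1 c hbc).resolve_left hac
    exact hcb (h3.trans h2.symm)

/-- All edges of a trail have the direction of the first. -/
theorem directed_trail (h : IsGameSpace A C β jₛ jₑ) (hd : IsSignOrientation dir)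
    {u v : NVert A C β} (p : (NGraph A C β).Walk u v) : p.IsTrail → ∀ k,
    (¬ p.Nil → p.snd.1 ∈ (edgeAt u k).1) →
    (IsAway u k → ∀ d ∈ p.darts, DirectedFromTo dir d.fst d.snd) ∧
      (¬ IsAway u k → ∀ d ∈ p.darts, DirectedFromTo dir d.snd d.fst) := by
  induction p with
  | nil => simp
  | @cons a b v hab p ih =>
    intro ht k hk
    have hk' : b.1 ∈ (edgeAt a k).1 := by simpa using hk
    have hne : b ≠ a := hab.ne.symm
    rw [SimpleGraph.Walk.isTrail_cons] at ht
    -- In passing from `a` to `b` both the sign and the kind of the next edge change, so the next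
    -- edge again leaves (or enters) its first vertex. At the end of the trail `k'` is arbitrary and
    -- chosen only to preserve this.
    obtain ⟨k', hk1, hk2⟩ : ∃ k', (¬ p.Nil → p.snd.1 ∈ (edgeAt b k').1) ∧
        (IsAway a k ↔ IsAway b k') := by
      have hopp := h.isAway_iff_not hk' hne
      cases p with
      | nil =>
        cases k
        · exact ⟨.inQ, by simp, hopp.trans (isAway_iff_of_ne (by simp)).symm⟩
        · exact ⟨.inP, by simp, hopp.trans (isAway_iff_of_ne (by simp)).symm⟩
      | @cons _ c _ hbc p =>
        obtain ⟨k', hc⟩ := h.exists_kind_of_adj hbc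
        have hca : c ≠ a := by
          rintro rfl
          exact ht.2 (by simp [Sym2.eq_swap])
        refine ⟨k', fun _ => by simpa using hc, ?_⟩
        rw [hopp, isAway_iff_of_ne (h.kind_ne_of_adj hk' hc hne hbc.ne.symm hca)]
    obtain ⟨ih1, ih2⟩ := ih ht.1 k' hk1
    constructor
    · intro ha d hdm
      rw [SimpleGraph.Walk.darts_cons, List.mem_cons] at hdm
      rcases hdm with rfl | hdm
      · exact hd.directed_of_isAway hk' hne ha
      · exact ih1 (hk2.1 ha) d hdm
    · intro ha d hdm
      rw [SimpleGraph.Walk.darts_cons, List.mem_cons] at hdm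
      rcases hdm with rfl | hdm
      · exact hd.directed_of_not_isAway hk' hne ha
      · exact ih2 (fun h' => ha (hk2.2 h')) d hdm

theorem directed_cycle (h : IsGameSpace A C β jₛ jₑ) (hd : IsSignOrientation dir)
    {u : NVert A C β} (c : (NGraph A C β).Walk u u) (hc : c.IsTrail) :
    (∀ d ∈ c.darts, DirectedFromTo dir d.fst d.snd) ∨
      ∀ d ∈ c.darts, DirectedFromTo dir d.snd d.fst := by
  by_cases hnil : c.Nil
  · left
    intro d hdm
    cases hnil
    simp at hdm
  · obtain ⟨k, hk⟩ := h.exists_kind_of_adj (c.adj_snd hnil)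
    obtain ⟨h1, h2⟩ := h.directed_trail hd c hc k fun _ => hk
    by_cases ha : IsAway u k
    · exact Or.inl (h1 ha)
    · exact Or.inr (h2 ha)

end Orientation

/-- The vertices on unbounded edges are connected. -/
theorem reachable_of_ray (h : IsGameSpace A C β jₛ jₑ) {s t : NVert A C β}
    (hs : ∀ u : NVert A C β, u.1.1 = s.1.1 → u = s)
    (hst : ∀ u : NVert A C β, (∀ u' : NVert A C β, u'.1.1 = u.1.1 → u' = u) → u = s ∨ u = t) :
    (NGraph A C β).Reachable s t := by
  classical
  have := h.finite_NVert
  have : Fintype (NVert A C β) := Fintype.ofFinite _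
  -- Restricting to the edges in the component of `s` makes handshaking produce a second vertex of
  -- odd degree that is reachable from `s`; odd degree means lying on a ray.
  let H : SimpleGraph (NVert A C β) :=
    { Adj := fun a b => (NGraph A C β).Adj a b ∧ (NGraph A C β).Reachable s a
      symm := ⟨fun a b hab => ⟨hab.1.symm, hab.2.trans hab.1.reachable⟩⟩
      loopless := ⟨fun a ha => ha.1.ne rfl⟩ }
  -- the neighbours of a vertex
  have hnb : ∀ a : NVert A C β, ∃ p : NVert A C β,
      ((∀ u' : NVert A C β, u'.1.1 = a.1.1 → u' = a) ∧
          (∀ b, (NGraph A C β).Adj a b ↔ b = p) ∨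
        ∃ q, q ≠ p ∧ (q.1.1 = a.1.1 ∧ q ≠ a) ∧ ∀ b, (NGraph A C β).Adj a b ↔ b = p ∨ b = q) := by
    intro a
    obtain ⟨p, hp1, hp2, hp3⟩ := h.inP_segment a
    have hap : (NGraph A C β).Adj a p := adj_of_mem (mem_edgeAt_inP.2 hp1) hp2
    refine ⟨p, ?_⟩
    rcases h.inQ_ray_or_segment a with ⟨-, hq⟩ | ⟨q, hq1, hq2, hq3⟩
    · refine Or.inl ⟨hq, fun b => ⟨fun hab => ?_, fun hb => hb ▸ hap⟩⟩
      obtain ⟨k, hk⟩ := h.exists_kind_of_adj hab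
      cases k
      · exact (hp3 b (mem_edgeAt_inP.1 hk)).resolve_left hab.ne.symm
      · exact absurd (hq b (mem_edgeAt_inQ.1 hk)) hab.ne.symm
    · have haq : (NGraph A C β).Adj a q := adj_of_mem (mem_edgeAt_inQ.2 hq1) hq2
      refine Or.inr ⟨q, ?_, ⟨hq1, hq2⟩, fun b => ⟨fun hab => ?_, ?_⟩⟩
      · rintro rfl
        exact hq2 (Subtype.ext (Prod.ext hq1 hp1))
      · obtain ⟨k, hk⟩ := h.exists_kind_of_adj hab
        cases k
        · exact Or.inl ((hp3 b (mem_edgeAt_inP.1 hk)).resolve_left hab.ne.symm)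
        · exact Or.inr ((hq3 b (mem_edgeAt_inQ.1 hk)).resolve_left hab.ne.symm)
      · rintro (rfl | rfl)
        · exact hap
        · exact haq
  have hodd : ∀ a, Odd (H.degree a) → (NGraph A C β).Reachable s a ∧
      ∀ u' : NVert A C β, u'.1.1 = a.1.1 → u' = a := by
    intro a ha
    have hra : (NGraph A C β).Reachable s a := by
      by_contra hcon
      have : H.degree a = 0 := by
        rw [SimpleGraph.degree, Finset.card_eq_zero, Finset.eq_empty_iff_forall_notMem]
        intro b hb
        rw [SimpleGraph.mem_neighborFinset] at hb
        exact hcon hb.2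
      rw [this] at ha
      exact absurd ha (by decide)
    refine ⟨hra, ?_⟩
    obtain ⟨p, hp | ⟨q, hqp, -, hq⟩⟩ := hnb a
    · exact hp.1
    · exfalso
      have : H.neighborFinset a = {p, q} := by
        ext b
        rw [SimpleGraph.mem_neighborFinset]
        simp only [Finset.mem_insert, Finset.mem_singleton, ← hq b]
        exact ⟨fun hb => hb.1, fun hb => ⟨hb, hra⟩⟩
      rw [SimpleGraph.degree, this, Finset.card_pair hqp.symm] at ha
      exact absurd ha (by decide)
  have hsodd : Odd (H.degree s) := by
    obtain ⟨p, hp | ⟨q, -, hq, -⟩⟩ := hnb s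
    · have : H.neighborFinset s = {p} := by
        ext b
        rw [SimpleGraph.mem_neighborFinset, Finset.mem_singleton, ← hp.2 b]
        exact ⟨fun hb => hb.1, fun hb => ⟨hb, .refl s⟩⟩
      rw [SimpleGraph.degree, this, Finset.card_singleton]
      exact odd_one
    · exact absurd (hs q hq.1) hq.2
  obtain ⟨w, hw, hwodd⟩ := H.exists_ne_odd_degree_of_exists_odd_degree s hsodd
  obtain ⟨hrw, hray⟩ := hodd w hwodd
  rcases hst w hray with rfl | rfl
  · exact absurd rfl hw
  · exact hrw

end IsGameSpace

/-! ### The directed path between the two rays -/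

namespace IsGameSpace

variable {m n : ℕ} {A C : Matrix (Fin m) (Fin n) ℝ} {β : Fin n → ℝ} {jₛ jₑ : Fin n}

/-- An edge with an infinite end has a single vertex and so moves in `Q'`; the infinite end is the
tail exactly for sign `+1`. -/
theorem dir_ray {dir : NEdges A C β → Option (NVert A C β) × Option (NVert A C β)}
    (h : IsGameSpace A C β jₛ jₑ) (hd : IsSignOrientation dir) {e : NEdges A C β}
    (he : (dir e).1 = none ∨ (dir e).2 = none) : ∃ u : NVert A C β, e = edgeAt u .inQ ∧
      ((dir e).1 = none ↔ vertexSign u = 1) ∧ ∀ u' : NVert A C β, u'.1.1 = u.1.1 → u' = u := by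
  obtain ⟨u, k, rfl⟩ := h.exists_eq_edgeAt e
  rcases h.ray_or_segment u k with ⟨rfl, huniq⟩ | ⟨v, hv, hne, -⟩
  · refine ⟨u, rfl, ⟨fun h1 => ?_, fun h1 => ?_⟩, fun u' hu' => huniq u' (mem_edgeAt_inQ.2 hu')⟩
    · by_contra h2
      rw [hd.tail u .inQ h2] at h1
      simp at h1
    · have h2 : (dir (edgeAt u .inQ)).2 = some u := hd.head u .inQ fun h2 => h2 h1
      rcases he with he | he
      · exact he
      · rw [h2] at he
        simp at he
  · exfalso
    have h1 := ((hd.isDirection _).2 u).1 (mem_edgeAt_self u k)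
    have h2 := ((hd.isDirection _).2 v).1 hv
    rcases he with he | he
    · simp only [he, reduceCtorEq, false_or] at h1 h2
      rw [h1] at h2
      exact hne (Option.some.inj h2).symm
    · simp only [he, reduceCtorEq, or_false] at h1 h2
      rw [h1] at h2
      exact hne (Option.some.inj h2).symm

/-- The part of the theorem about the path between the two unbounded edges. -/
theorem exists_directed_path {dir : NEdges A C β → Option (NVert A C β) × Option (NVert A C β)}
    (h : IsGameSpace A C β jₛ jₑ) (hd : IsSignOrientation dir) {iₛ iₑ : Fin m}
    (his : ∀ i, A i jₛ ≤ A iₛ jₛ) (hie : ∀ i, A i jₑ ≤ A iₑ jₑ) :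
    ∃ uₛ uₑ : NVert A C β,
      uₛ.1.1 = pureVertex A iₛ jₛ ∧ uₑ.1.1 = pureVertex A iₑ jₑ ∧
      dir (edgeAt uₛ .inQ) = (none, some uₛ) ∧
      dir (edgeAt uₑ .inQ) = (some uₑ, none) ∧
      (∀ e, (dir e).1 = none → e = edgeAt uₛ .inQ) ∧
      (∀ e, (dir e).2 = none → e = edgeAt uₑ .inQ) ∧
      (NGraph A C β).Reachable uₛ uₑ ∧
      ∀ p : (NGraph A C β).Walk uₛ uₑ, p.IsPath →
        ∀ d ∈ p.darts, DirectedFromTo dir d.fst d.snd := by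
  obtain ⟨s, hs1, hs2, hs3⟩ := h.exists_end_vertex (s := -1) his
    (fun j hj => by linarith [h.min j hj]) (by norm_num)
  obtain ⟨t, ht1, ht2, ht3⟩ := h.exists_end_vertex (s := 1) hie
    (fun j hj => by linarith [h.max j hj]) (by norm_num)
  -- The sign relating `det E(u)` to the matrix of the vertex is exactly the one in
  -- `exists_end_vertex`, so the minimum (`s = -1`) yields `+1` and the maximum does not.
  have hsign : vertexSign s = 1 := by
    rw [vertexSign, h.det_matrixE, sign_eq_one_iff]
    linarith
  have htsign : vertexSign t ≠ 1 := by
    rw [vertexSign, h.det_matrixE, Ne, sign_eq_one_iff]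
    linarith
  have hray : ∀ u : NVert A C β, (∀ u' : NVert A C β, u'.1.1 = u.1.1 → u' = u) →
      u = s ∨ u = t := by
    intro u hu
    obtain ⟨j₀, rfl | rfl, hj⟩ := h.eq_pureVertex_of_ray u hu
    · exact Or.inl (hu s (hs1.trans (hj iₛ his).symm)).symm
    · exact Or.inr (hu t (ht1.trans (hj iₑ hie).symm)).symm
  have hsh : (dir (edgeAt s .inQ)).2 = some s := hd.head s .inQ fun h' => h' hsign
  have htt : (dir (edgeAt t .inQ)).1 = some t := hd.tail t .inQ htsign
  refine ⟨s, t, hs1, ht1, Prod.ext ?_ hsh, Prod.ext htt ?_, fun e he => ?_, fun e he => ?_,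
    h.reachable_of_ray hs2 hray, fun p hp => ?_⟩
  · by_contra hne
    obtain ⟨v, hv⟩ := Option.ne_none_iff_exists'.1 hne
    have h1 := ((hd.isDirection _).2 v).2 (Or.inl hv)
    have h2 := hs2 v (mem_edgeAt_inQ.1 h1)
    exact (hd.isDirection _).1 (hv.trans (h2 ▸ hsh.symm))
  · by_contra hne
    obtain ⟨v, hv⟩ := Option.ne_none_iff_exists'.1 hne
    have h1 := ((hd.isDirection _).2 v).2 (Or.inr hv)
    have h2 := ht2 v (mem_edgeAt_inQ.1 h1)
    exact (hd.isDirection _).1 (htt.trans (h2 ▸ hv.symm))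
  · obtain ⟨u, rfl, h1, h2⟩ := h.dir_ray hd (Or.inl he)
    rcases hray u h2 with rfl | rfl
    · rfl
    · exact absurd (h1.1 he) htsign
  · obtain ⟨u, rfl, h1, h2⟩ := h.dir_ray hd (Or.inr he)
    rcases hray u h2 with rfl | rfl
    · exact absurd ((h1.2 hsign).trans he.symm) (hd.isDirection _).1
    · rfl
  -- The path must leave its first vertex along the edge in `P`, because the ray contains no other
  -- vertex.
  · refine (h.directed_trail hd p hp.isTrail .inP fun hnil => ?_).1 hsign
    obtain ⟨k, hk⟩ := h.exists_kind_of_adj (p.adj_snd hnil)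
    cases k
    · exact hk
    · exact absurd (hs2 _ (mem_edgeAt_inQ.1 hk)) (p.adj_snd hnil).ne.symm

end IsGameSpace

/-- The program `prog` decides, for every vertex `u` of a game space, in time bounded by `T`,
whether an edge is directed away from `u`. -/
def DecidesAway (prog : Prog) (T : Polynomial ℕ) : Prop :=
  ∀ {m n : ℕ} {A C : Matrix (Fin m) (Fin n) ℝ} {β : Fin n → ℝ} {jₛ jₑ : Fin n},
    IsGameSpace A C β jₛ jₑ → ∀ (u : NVert A C β) (k : EdgeKind),
    ((IsGameSpace.IsAway u k →
        (prog.run (fun _ => 0) (initState (vertexInput u) k)).1.reg 0 = 1) ∧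
      (¬ IsGameSpace.IsAway u k →
        (prog.run (fun _ => 0) (initState (vertexInput u) k)).1.reg 0 = 0) ∧
      (prog.run (fun _ => 0) (initState (vertexInput u) k)).2 ≤ T.eval (m + n)) ∧
    ∀ I : InputData ℚ m n, I.toReal = vertexInput u →
      (IsGameSpace.IsAway u k → (prog.run ratSize (initState I k)).1.reg 0 = 1) ∧
      (¬ IsGameSpace.IsAway u k → (prog.run ratSize (initState I k)).1.reg 0 = 0) ∧
      (prog.run ratSize (initState I k)).2 ≤ T.eval I.bitLength

/-- Separates the geometry from the machine: any program that evaluates the sign rule at a vertex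
will do. -/
theorem main_of_decidesAway {prog : Prog} {T : Polynomial ℕ} (hprog : DecidesAway prog T) :
      ∀ (m n : ℕ) (A C : Matrix (Fin m) (Fin n) ℝ) (β : Fin n → ℝ),
        NondegP A → NondegQ C β →
        ∀ (iₛ iₑ : Fin m) (jₛ jₑ : Fin n), jₛ ≠ jₑ →
          (∀ j, j ≠ jₛ → β jₛ < β j) → (∀ j, j ≠ jₑ → β j < β jₑ) →
          (∀ i, A i jₛ ≤ A iₛ jₛ) → (∀ i, A i jₑ ≤ A iₑ jₑ) →
          ∃ dir : NEdges A C β → Option (NVert A C β) × Option (NVert A C β),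
            (∀ e, IsDirectionOf (dir e) e) ∧
            (∀ u : NVert A C β,
              (vertexSign u = 1 →
                (dir (edgeAt u .inP)).1 = some u ∧ (dir (edgeAt u .inQ)).2 = some u) ∧
              (vertexSign u ≠ 1 →
                (dir (edgeAt u .inP)).2 = some u ∧ (dir (edgeAt u .inQ)).1 = some u)) ∧
            ComputesDirection prog T dir ∧
            (∀ u u' : NVert A C β, (NGraph A C β).Adj u u' →
              vertexSign u * vertexSign u' = -1) ∧
            (∀ (u : NVert A C β) (c : (NGraph A C β).Walk u u), c.IsCycle →
              (∀ d ∈ c.darts, DirectedFromTo dir d.fst d.snd) ∨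
              (∀ d ∈ c.darts, DirectedFromTo dir d.snd d.fst)) ∧
            (∃ uₛ uₑ : NVert A C β,
              uₛ.1.1 = pureVertex A iₛ jₛ ∧ uₑ.1.1 = pureVertex A iₑ jₑ ∧
              dir (edgeAt uₛ .inQ) = (none, some uₛ) ∧
              dir (edgeAt uₑ .inQ) = (some uₑ, none) ∧
              (∀ e, (dir e).1 = none → e = edgeAt uₛ .inQ) ∧
              (∀ e, (dir e).2 = none → e = edgeAt uₑ .inQ) ∧
              (NGraph A C β).Reachable uₛ uₑ ∧
              ∀ p : (NGraph A C β).Walk uₛ uₑ, p.IsPath →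
                ∀ d ∈ p.darts, DirectedFromTo dir d.fst d.snd) := by
  intro m n A C β hP hQ iₛ iₑ jₛ jₑ hne hmin hmax his hie
  have : Nonempty (Fin m) := ⟨iₛ⟩
  have h : IsGameSpace A C β jₛ jₑ := ⟨isSimplePolyhedron_P hP,
    isSimplePolyhedron_Q (hmin jₑ hne.symm).ne hQ, hne, hmin, hmax⟩
  obtain ⟨dir, hd⟩ := h.exists_signOrientation
  refine ⟨dir, hd.isDirection, fun u => ⟨fun hu => ⟨?_, ?_⟩, fun hu => ⟨?_, ?_⟩⟩, fun u k => ?_,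
    fun u u' hadj => ?_, fun u c hc => h.directed_cycle hd c hc.isCircuit.isTrail,
    h.exists_directed_path hd his hie⟩
  · exact hd.tail u .inP hu
  · exact hd.head u .inQ fun h' => h' hu
  · exact hd.head u .inP hu
  · exact hd.tail u .inQ hu
  · rw [← hd.isAway_iff_tail, ← hd.not_isAway_iff_head]
    exact hprog h u k
  · obtain ⟨k, hk⟩ := h.exists_kind_of_adj hadj
    exact h.vertexSign_mul_of_mem hk hadj.ne.symm

/-! ## The Faddeev–LeVerrier algorithm -/

section FaddeevLeVerrier

open Polynomial

variable {K ι : Type*} [Field K] [Fintype ι] [DecidableEq ι]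

/-- Jacobi's formula for `X - W`. In the Leibniz expansion only diagonal entries have a nonzero
derivative, so the fixed points of each permutation contribute, and they assemble to the diagonal
minors. -/
theorem derivative_det_charmatrix (W : Matrix ι ι K) :
    derivative W.charmatrix.det = W.charmatrix.adjugate.trace := by
  have hder : ∀ r c, derivative (W.charmatrix r c) = if r = c then 1 else 0 := by
    intro r c
    rw [Matrix.charmatrix_apply, Matrix.diagonal_apply]
    split_ifs <;> simp
  have hadj : ∀ i, W.charmatrix.adjugate i i = ∑ σ : Equiv.Perm ι, Equiv.Perm.sign σ •
      ((∏ b ∈ Finset.univ.erase i, W.charmatrix (σ b) b) *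
        derivative (W.charmatrix (σ i) i)) := by
    intro i
    rw [Matrix.adjugate_apply, Matrix.det_apply]
    refine Finset.sum_congr rfl fun σ _ => ?_
    congr 1
    rw [hder]
    split_ifs with h
    · rw [mul_one, ← Finset.mul_prod_erase _ _ (Finset.mem_univ i), h, Matrix.updateRow_self,
        Pi.single_eq_same, one_mul]
      refine Finset.prod_congr rfl fun b hb => ?_
      rw [Matrix.updateRow_ne]
      exact fun h' => (Finset.mem_erase.1 hb).1 (σ.injective (h'.trans h.symm))
    · rw [mul_zero]
      refine Finset.prod_eq_zero (Finset.mem_univ (σ.symm i)) ?_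
      rw [Equiv.apply_symm_apply, Matrix.updateRow_self, Pi.single_eq_of_ne]
      exact fun h' => h ((Equiv.symm_apply_eq σ).1 h').symm
  have htr : W.charmatrix.adjugate.trace = _ := Finset.sum_congr rfl fun i _ => hadj i
  rw [htr, Finset.sum_comm, Matrix.det_apply, derivative_sum]
  refine Finset.sum_congr rfl fun σ _ => ?_
  rw [← Finset.smul_sum, Units.smul_def, Units.smul_def, map_zsmul,
    derivative_prod_finset (f := fun i => W.charmatrix (σ i) i)]

/-- The auxiliary matrices of the Faddeev–LeVerrier algorithm. -/
def flMatrix (W : Matrix ι ι K) : ℕ → Matrix ι ι K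
  | 0 => 1
  | k + 1 => W * flMatrix W k + Matrix.scalar ι (-(W * flMatrix W k).trace / ((k : K) + 1))

/-- The coefficients of `(X - W) * adj (X - W) = charpoly • 1`: a recursion for the coefficient
matrices of the adjugate. -/
theorem coeff_X_mul_adjugate (W : Matrix ι ι K) (j : ℕ) (r c : ι) :
    (X * W.charmatrix.adjugate r c).coeff j =
      (∑ k, W r k * (W.charmatrix.adjugate k c).coeff j) +
        if r = c then W.charpoly.coeff j else 0 := by
  have h : (W.charmatrix * W.charmatrix.adjugate) r c =
      (W.charpoly • (1 : Matrix ι ι K[X])) r c := by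
    rw [Matrix.mul_adjugate]
    rfl
  rw [Matrix.mul_apply, Matrix.smul_apply, Matrix.one_apply] at h
  simp only [Matrix.charmatrix_apply, sub_mul, Finset.sum_sub_distrib, Matrix.diagonal_apply,
    ite_mul, zero_mul, Finset.sum_ite_eq, Finset.mem_univ, if_true] at h
  have h' := congrArg (fun p => p.coeff j) h
  simp only [coeff_sub, finsetSum_coeff, coeff_C_mul] at h'
  rw [sub_eq_iff_eq_add'] at h'
  rw [h']
  split_ifs <;> simp

/-- Above the size of the matrix the recursion has no contribution from the characteristic
polynomial, so the coefficients vanish by descent from any common degree bound `B`. -/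
theorem coeff_adjugate_eq_zero (W : Matrix ι ι K) {j : ℕ} (hj : Fintype.card ι ≤ j) (r c : ι) :
    (W.charmatrix.adjugate r c).coeff j = 0 := by
  obtain ⟨B, hB⟩ : ∃ B, ∀ r c, (W.charmatrix.adjugate r c).natDegree ≤ B :=
    ⟨∑ r, ∑ c, (W.charmatrix.adjugate r c).natDegree, fun r c =>
      (Finset.single_le_sum (f := fun c => (W.charmatrix.adjugate r c).natDegree)
        (fun _ _ => Nat.zero_le _) (Finset.mem_univ c)).trans
      (Finset.single_le_sum (f := fun r => ∑ c, (W.charmatrix.adjugate r c).natDegree)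
        (fun _ _ => Nat.zero_le _) (Finset.mem_univ r))⟩
  have key : ∀ t j, Fintype.card ι ≤ j → B < j + t → ∀ r c,
      (W.charmatrix.adjugate r c).coeff j = 0 := by
    intro t
    induction t with
    | zero => exact fun j _ hj r c => coeff_eq_zero_of_natDegree_lt ((hB r c).trans_lt hj)
    | succ t ih =>
      intro j hj ht r c
      rw [← coeff_X_mul, coeff_X_mul_adjugate, Finset.sum_eq_zero fun k _ => by
        rw [ih (j + 1) (by omega) (by omega), mul_zero], zero_add]
      split_ifs
      · refine coeff_eq_zero_of_natDegree_lt ?_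
        rw [Matrix.charpoly_natDegree_eq_dim]
        omega
      · rfl
  exact key (B + 1) j hj (by omega) r c

theorem sum_coeff_X_mul_adjugate (W : Matrix ι ι K) (j : ℕ) :
    ∑ i, (X * W.charmatrix.adjugate i i).coeff j = j * W.charpoly.coeff j := by
  have h := derivative_det_charmatrix W
  change derivative W.charpoly = _ at h
  rw [← finsetSum_coeff, ← Finset.mul_sum]
  change (X * W.charmatrix.adjugate.trace).coeff j = _
  rw [← h]
  cases j with
  | zero => simp
  | succ j =>
    rw [coeff_X_mul, coeff_derivative]
    push_cast
    ring

/-- The auxiliary matrices are the coefficients of the adjugate from the top down, the scalars those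
of the characteristic polynomial `p`. The trace of the recursion equals `tr (W * M_k) + N * p_j`,
and by Jacobi's formula also `j * p_j`, where `j = N - 1 - k`; so `tr (W * M_k) = -(k + 1) * p_j`.
-/
theorem flMatrix_eq [CharZero K] (W : Matrix ι ι K) : ∀ k < Fintype.card ι,
    (∀ r c, flMatrix W k r c =
      (W.charmatrix.adjugate r c).coeff (Fintype.card ι - 1 - k)) ∧
    -(W * flMatrix W k).trace / ((k : K) + 1) = W.charpoly.coeff (Fintype.card ι - 1 - k) := by
  have step : ∀ k < Fintype.card ι, (∀ r c, flMatrix W k r c =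
      (W.charmatrix.adjugate r c).coeff (Fintype.card ι - 1 - k)) →
      -(W * flMatrix W k).trace / ((k : K) + 1) =
        W.charpoly.coeff (Fintype.card ι - 1 - k) := by
    intro k hk hM
    have hk1 : (k : K) + 1 ≠ 0 := Nat.cast_add_one_ne_zero k
    rw [div_eq_iff hk1]
    have h := sum_coeff_X_mul_adjugate W (Fintype.card ι - 1 - k)
    simp only [coeff_X_mul_adjugate, Finset.sum_add_distrib, if_true, Finset.sum_const,
      Finset.card_univ, nsmul_eq_mul] at h
    have htr : (W * flMatrix W k).trace = ∑ i, ∑ l, W i l *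
        (W.charmatrix.adjugate l i).coeff (Fintype.card ι - 1 - k) := by
      simp only [Matrix.trace, Matrix.diag_apply, Matrix.mul_apply, hM]
    rw [htr]
    have hcast : ((Fintype.card ι - 1 - k : ℕ) : K) = (Fintype.card ι : K) - 1 - k := by
      rw [Nat.cast_sub (by omega), Nat.cast_sub (by omega), Nat.cast_one]
    rw [hcast] at h
    linear_combination -h
  intro k
  induction k with
  | zero =>
    intro hk
    have : ∀ r c, flMatrix W 0 r c =
        (W.charmatrix.adjugate r c).coeff (Fintype.card ι - 1 - 0) := by
      intro r c
      have hcoeff : W.charpoly.coeff (Fintype.card ι) = 1 := by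
        rw [← Matrix.charpoly_natDegree_eq_dim W]
        exact W.charpoly_monic
      rw [← coeff_X_mul, coeff_X_mul_adjugate, show Fintype.card ι - 1 - 0 + 1 = Fintype.card ι
        by omega, Finset.sum_eq_zero fun k _ => by
        rw [coeff_adjugate_eq_zero W le_rfl, mul_zero], zero_add, hcoeff]
      rfl
    exact ⟨this, step 0 hk this⟩
  | succ k ih =>
    intro hk
    obtain ⟨h1, h2⟩ := ih (by omega)
    have : ∀ r c, flMatrix W (k + 1) r c =
        (W.charmatrix.adjugate r c).coeff (Fintype.card ι - 1 - (k + 1)) := by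
      intro r c
      rw [← coeff_X_mul, coeff_X_mul_adjugate, show Fintype.card ι - 1 - (k + 1) + 1 =
        Fintype.card ι - 1 - k by omega, flMatrix, h2, Matrix.add_apply, Matrix.mul_apply]
      simp only [h1, Matrix.scalar_apply, Matrix.diagonal_apply]
    exact ⟨this, step (k + 1) hk this⟩

/-- The Faddeev–LeVerrier algorithm computes the determinant. -/
theorem flMatrix_det [CharZero K] (W : Matrix ι ι K) {k : ℕ} (hk : k + 1 = Fintype.card ι) :
    -(W * flMatrix W k).trace / ((k : K) + 1) = (-1) ^ Fintype.card ι * W.det := by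
  rw [(flMatrix_eq W k (by omega)).2, show Fintype.card ι - 1 - k = 0 by omega,
    Matrix.det_eq_sign_charpoly_coeff, ← mul_assoc, ← mul_pow]
  simp

end FaddeevLeVerrier

/-! ## Reasoning about programs -/

namespace Prog

/-- The registers that a program may change. -/
def regs : Prog → List ℕ
  | .skip => []
  | .setReg r _ => [r]
  | .regOp _ r _ _ => [r]
  | .setCell _ _ => []
  | .cellOp _ _ _ _ => []
  | .seq p q => p.regs ++ q.regs
  | .ifRegLt _ _ p q => p.regs ++ q.regs
  | .ifCellPos _ p q => p.regs ++ q.regs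
  | .forReg r _ p => r :: p.regs

/-- The arrays that a program may change. -/
def arrs : Prog → List ℕ
  | .skip => []
  | .setReg _ _ => []
  | .regOp _ _ _ _ => []
  | .setCell d _ => [d.arr]
  | .cellOp _ d _ _ => [d.arr]
  | .seq p q => p.arrs ++ q.arrs
  | .ifRegLt _ _ p q => p.arrs ++ q.arrs
  | .ifCellPos _ p q => p.arrs ++ q.arrs
  | .forReg _ _ p => p.arrs

/-- The registers that hold the bounds of the loops of a program. -/
def bounds : Prog → List ℕ
  | .seq p q => p.bounds ++ q.bounds
  | .ifRegLt _ _ p q => p.bounds ++ q.bounds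
  | .ifCellPos _ p q => p.bounds ++ q.bounds
  | .forReg _ b p => b :: p.bounds
  | _ => []

/-- A polynomial bound for the number of steps, in terms of a common bound for the numbers of
iterations of the loops. -/
noncomputable def steps : Prog → Polynomial ℕ
  | .seq p q => p.steps + q.steps
  | .ifRegLt _ _ p q => 1 + p.steps + q.steps
  | .ifCellPos _ p q => 1 + p.steps + q.steps
  | .forReg _ _ p => 1 + Polynomial.X * (1 + p.steps)
  | _ => 1

variable {K : Type}

/-- Two configurations agree outside the given registers and arrays. -/
structure Agree (R M : List ℕ) (s t : MState K) : Prop where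
  reg : ∀ r ∉ R, t.reg r = s.reg r
  mem : ∀ a ∉ M, t.mem a = s.mem a

theorem Agree.refl (R M : List ℕ) (s : MState K) : Agree R M s s := ⟨fun _ _ => rfl, fun _ _ => rfl⟩

theorem Agree.trans {R M : List ℕ} {s t u : MState K} (h : Agree R M s t) (h' : Agree R M t u) :
    Agree R M s u :=
  ⟨fun r hr => (h'.reg r hr).trans (h.reg r hr), fun a ha => (h'.mem a ha).trans (h.mem a ha)⟩

theorem Agree.mono {R M R' M' : List ℕ} {s t : MState K} (h : Agree R M s t) (hR : R ⊆ R')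
    (hM : M ⊆ M') : Agree R' M' s t :=
  ⟨fun r hr => h.reg r fun h' => hr (hR h'), fun a ha => h.mem a fun h' => ha (hM h')⟩

theorem agree_setReg (r v : ℕ) (s : MState K) : Agree [r] [] s (s.setReg r v) :=
  ⟨fun _ hr => Function.update_of_ne (fun h => hr (by simp [h])) _ _, fun _ _ => rfl⟩

theorem agree_write (d : Cell) (v : K) (s : MState K) : Agree [] [d.arr] s (s.write d v) := by
  refine ⟨fun _ _ => rfl, fun a ha => ?_⟩
  funext i j
  simp only [List.mem_singleton] at ha
  simp [MState.write, ha]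

variable [Field K] [LinearOrder K]

/-- The final configuration. -/
def exec (p : Prog) (s : MState K) : MState K := (p.run (fun _ => 0) s).1

theorem run_forReg_fst (sz : K → ℕ) (r b : ℕ) (p : Prog) (s : MState K)
    (hp : ∀ s, (p.run sz s).1 = p.exec s) : ((forReg r b p).run sz s).1 =
      Nat.rec s (fun k t => p.exec (t.setReg r k)) (s.reg b) := by
  rw [run]
  induction s.reg b with
  | zero => rfl
  | succ k ih =>
    dsimp only
    rw [hp, ih]

/-- The size function affects the cost only, so correctness need be shown just once, for all cost
measures. -/
theorem run_fst (sz : K → ℕ) (p : Prog) : ∀ s, (p.run sz s).1 = p.exec s := by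
  induction p with
  | seq p q hp hq =>
    intro s
    simp only [exec, run] at *
    rw [hp, hq]
  | ifRegLt a b p q hp hq =>
    intro s
    simp only [exec, run] at *
    split_ifs
    exacts [hp s, hq s]
  | ifCellPos a p q hp hq =>
    intro s
    simp only [exec, run] at *
    split_ifs
    exacts [hp s, hq s]
  | forReg r b p hp =>
    intro s
    rw [run_forReg_fst sz r b p s hp, exec, run_forReg_fst _ r b p s fun _ => rfl]
  | _ => exact fun _ => rfl

theorem exec_seq (p q : Prog) (s : MState K) : (seq p q).exec s = q.exec (p.exec s) := rfl

theorem exec_setReg (r c : ℕ) (s : MState K) : (setReg r c).exec s = s.setReg r c := rfl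

theorem exec_regOp (op : RegOp) (r a b : ℕ) (s : MState K) :
    (regOp op r a b).exec s = s.setReg r (op.eval (s.reg a) (s.reg b)) := rfl

theorem exec_setCell (d : Cell) (c : ℤ) (s : MState K) :
    (setCell d c).exec s = s.write d (c : K) := rfl

theorem exec_cellOp (op : FieldOp) (d a b : Cell) (s : MState K) :
    (cellOp op d a b).exec s = s.write d (op.eval (s.read a) (s.read b)) := rfl

theorem exec_ifRegLt (a b : ℕ) (p q : Prog) (s : MState K) :
    (ifRegLt a b p q).exec s = if s.reg a < s.reg b then p.exec s else q.exec s := by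
  rw [exec, run]
  split_ifs <;> rfl

theorem exec_ifCellPos (a : Cell) (p q : Prog) (s : MState K) :
    (ifCellPos a p q).exec s = if 0 < s.read a then p.exec s else q.exec s := by
  rw [exec, run]
  split_ifs <;> rfl

/-- The configuration after `k` iterations of a loop. -/
def iter (r : ℕ) (p : Prog) (s : MState K) : ℕ → MState K
  | 0 => s
  | k + 1 => p.exec ((iter r p s k).setReg r k)

theorem exec_forReg (r b : ℕ) (p : Prog) (s : MState K) :
    (forReg r b p).exec s = iter r p s (s.reg b) := by
  rw [exec, run_forReg_fst _ r b p s fun _ => rfl]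
  induction s.reg b with
  | zero => rfl
  | succ k ih =>
    dsimp only
    rw [ih, iter]

/-- All field elements written during the execution satisfy `G`. -/
def Safe (G : K → Prop) : Prog → MState K → Prop
  | .skip, _ => True
  | .setReg _ _, _ => True
  | .regOp _ _ _ _, _ => True
  | .setCell _ c, _ => G (c : K)
  | .cellOp op _ a b, s => G (op.eval (s.read a) (s.read b))
  | .seq p q, s => p.Safe G s ∧ q.Safe G (p.exec s)
  | .ifRegLt a b p q, s => if s.reg a < s.reg b then p.Safe G s else q.Safe G s
  | .ifCellPos a p q, s => if 0 < s.read a then p.Safe G s else q.Safe G s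
  | .forReg r b p, s => ∀ k < s.reg b, p.Safe G ((iter r p s k).setReg r k)

theorem Safe.mono {G G' : K → Prop} (hG : ∀ v, G v → G' v) (p : Prog) :
    ∀ s : MState K, p.Safe G s → p.Safe G' s := by
  induction p with
  | setCell d c => exact fun s => hG _
  | cellOp op d a b => exact fun s => hG _
  | seq p q hp hq => exact fun s h => ⟨hp _ h.1, hq _ h.2⟩
  | ifRegLt a b p q hp hq =>
    intro s h
    rw [Safe] at h ⊢
    split_ifs at h ⊢
    exacts [hp s h, hq s h]
  | ifCellPos a p q hp hq =>
    intro s h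
    rw [Safe] at h ⊢
    split_ifs at h ⊢
    exacts [hp s h, hq s h]
  | forReg r b p hp => exact fun s h k hk => hp _ (h k hk)
  | _ => exact fun _ h => h

theorem agree_iter {r : ℕ} {p : Prog} (hp : ∀ s : MState K, Agree p.regs p.arrs s (p.exec s))
    (s : MState K) (k : ℕ) : Agree (r :: p.regs) p.arrs s (iter r p s k) := by
  induction k with
  | zero => exact Agree.refl _ _ _
  | succ k ih =>
    refine (ih.trans ((agree_setReg r k _).mono ?_ ?_)).trans ((hp _).mono ?_ ?_) <;> simp

/-- A frame rule read off from the syntax: for concrete programs non-interference is settled by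
`decide`. -/
theorem agree_exec (p : Prog) : ∀ s : MState K, Agree p.regs p.arrs s (p.exec s) := by
  induction p with
  | skip => exact fun s => Agree.refl _ _ s
  | setReg r c => exact fun s => agree_setReg r c s
  | regOp op r a b => exact fun s => agree_setReg r _ s
  | setCell d c => exact fun s => agree_write d _ s
  | cellOp op d a b => exact fun s => agree_write d _ s
  | seq p q hp hq =>
    intro s
    refine ((hp s).mono ?_ ?_).trans ((hq _).mono ?_ ?_) <;> simp [regs, arrs]
  | ifRegLt a b p q hp hq =>
    intro s
    rw [exec_ifRegLt]
    split_ifs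
    · refine (hp s).mono ?_ ?_ <;> simp [regs, arrs]
    · refine (hq s).mono ?_ ?_ <;> simp [regs, arrs]
  | ifCellPos a p q hp hq =>
    intro s
    rw [exec_ifCellPos]
    split_ifs
    · refine (hp s).mono ?_ ?_ <;> simp [regs, arrs]
    · refine (hq s).mono ?_ ?_ <;> simp [regs, arrs]
  | forReg r b p hp =>
    intro s
    rw [exec_forReg]
    exact agree_iter hp s _

/-- The cost of a program none of whose loop bounds change. -/
theorem run_snd_le {sz : K → ℕ} {S B : ℕ} (p : Prog) : ∀ s : MState K,
    p.Safe (fun v => sz v ≤ S) s → (∀ b ∈ p.bounds, s.reg b ≤ B) → p.bounds.Disjoint p.regs →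
    (p.run sz s).2 ≤ p.steps.eval B * (1 + S) := by
  induction p with
  | skip => intros; simp [run, steps]
  | setReg r c => intros; simp [run, steps]
  | regOp op r a b => intros; simp [run, steps]
  | setCell d c =>
    intro s hs _ _
    simpa [run, steps, Safe] using hs
  | cellOp op d a b =>
    intro s hs _ _
    simpa [run, steps, Safe] using hs
  | seq p q hp hq =>
    intro s hs hb hd
    simp only [bounds, regs, List.disjoint_append_left, List.disjoint_append_right] at hd
    simp only [run, steps, Polynomial.eval_add, add_mul]
    refine Nat.add_le_add (hp s hs.1 (fun b hb' => hb b (by simp [bounds, hb'])) hd.1.1) ?_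
    rw [run_fst]
    refine hq _ hs.2 (fun b hb' => ?_) hd.2.2
    rw [(agree_exec p s).reg b fun h => hd.1.2 hb' h]
    exact hb b (by simp [bounds, hb'])
  | ifRegLt a b p q hp hq =>
    intro s hs hb hd
    simp only [bounds, regs, List.disjoint_append_left, List.disjoint_append_right] at hd
    simp only [run, steps, Polynomial.eval_add, Polynomial.eval_one, add_mul]
    rw [Safe] at hs
    split_ifs at hs ⊢
    · have := hp s hs (fun b hb' => hb b (by simp [bounds, hb'])) hd.1.1
      dsimp only
      omega
    · have := hq s hs (fun b hb' => hb b (by simp [bounds, hb'])) hd.2.2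
      dsimp only
      omega
  | ifCellPos a p q hp hq =>
    intro s hs hb hd
    simp only [bounds, regs, List.disjoint_append_left, List.disjoint_append_right] at hd
    simp only [run, steps, Polynomial.eval_add, Polynomial.eval_one, add_mul]
    rw [Safe] at hs
    split_ifs at hs ⊢
    · have := hp s hs (fun b hb' => hb b (by simp [bounds, hb'])) hd.1.1
      dsimp only
      omega
    · have := hq s hs (fun b hb' => hb b (by simp [bounds, hb'])) hd.2.2
      dsimp only
      omega
  | forReg r b p hp =>
    intro s hs hb hd
    have hd' : p.bounds.Disjoint p.regs := fun a h h' =>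
      hd (List.mem_cons_of_mem _ h) (List.mem_cons_of_mem _ h')
    -- The configuration in the accumulator is identified with `iter`, through which `Safe` speaks
    -- about the single passes; only then can their costs be added.
    have key : ∀ j ≤ s.reg b, (Nat.rec (motive := fun _ => MState K × ℕ) (s, 1)
        (fun k acc =>
          ((p.run sz (acc.1.setReg r k)).1, acc.2 + (1 + (p.run sz (acc.1.setReg r k)).2))) j) =
        (iter r p s j, (Nat.rec (motive := fun _ => MState K × ℕ) (s, 1)
        (fun k acc =>
          ((p.run sz (acc.1.setReg r k)).1, acc.2 + (1 + (p.run sz (acc.1.setReg r k)).2))) j).2) ∧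
        (Nat.rec (motive := fun _ => MState K × ℕ) (s, 1)
        (fun k acc =>
          ((p.run sz (acc.1.setReg r k)).1, acc.2 + (1 + (p.run sz (acc.1.setReg r k)).2))) j).2 ≤
        (1 + j * (1 + p.steps.eval B)) * (1 + S) := by
      intro j
      induction j with
      | zero => exact fun _ => ⟨rfl, by simp⟩
      | succ j ih =>
        intro hj
        obtain ⟨h1, h2⟩ := ih (by omega)
        refine ⟨Prod.ext ?_ rfl, ?_⟩
        · dsimp only
          rw [h1, run_fst, iter]
        · dsimp only
          rw [h1] at h2 ⊢
          have := hp ((iter r p s j).setReg r j) (hs j (by omega)) (fun b' hb' => ?_) hd'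
          · calc _ ≤ (1 + j * (1 + p.steps.eval B)) * (1 + S) +
                (1 * (1 + S) + p.steps.eval B * (1 + S)) :=
                Nat.add_le_add h2 (Nat.add_le_add (by omega) this)
              _ = _ := by ring
          -- Inner loop bounds are neither the loop variable nor written by the body, so every pass
          -- starts with their original values.
          · have hr : b' ≠ r := by
              rintro rfl
              exact hd (List.mem_cons_of_mem _ hb') List.mem_cons_self
            rw [(agree_setReg r j _).reg b' (by simpa using hr),
              (agree_iter (agree_exec p) s j).reg b' (by
                simpa [hr] using fun h => hd' hb' h)]
            exact hb b' (by simp [bounds, hb'])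
    refine (key _ le_rfl).2.trans (Nat.mul_le_mul_right _ ?_)
    simp only [steps, Polynomial.eval_add, Polynomial.eval_one, Polynomial.eval_mul,
      Polynomial.eval_X]
    exact Nat.add_le_add_left (Nat.mul_le_mul_right _ (hb b (by simp [bounds]))) _

/-- The invariant rule for loops. -/
theorem forReg_spec {G : K → Prop} {r b : ℕ} {p : Prog} {s : MState K}
    (Inv : ℕ → (ℕ → ℕ → ℕ → K) → Prop) (h0 : Inv 0 s.mem)
    (step : ∀ k < s.reg b, ∀ t, Agree (r :: p.regs) p.arrs s t → t.reg r = k → Inv k t.mem →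
      Inv (k + 1) (p.exec t).mem ∧ p.Safe G t) :
    Inv (s.reg b) ((forReg r b p).exec s).mem ∧ (forReg r b p).Safe G s := by
  have hstep : ∀ k < s.reg b, Inv k (iter r p s k).mem → Inv (k + 1) (iter r p s (k + 1)).mem ∧
      p.Safe G ((iter r p s k).setReg r k) := by
    intro k hk h
    refine step k hk _ ((agree_iter (agree_exec p) s k).trans
      ((agree_setReg r k _).mono ?_ ?_)) ?_ h
    · simp
    · simp
    · simp [MState.setReg]
  have key : ∀ j ≤ s.reg b, Inv j (iter r p s j).mem := by
    intro j
    induction j with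
    | zero => exact fun _ => h0
    | succ j ih => exact fun hj => (hstep j hj (ih (by omega))).1
  rw [exec_forReg]
  exact ⟨key _ le_rfl, fun k hk => (hstep k hk (key k hk.le)).2⟩

/-- The program `p` stores `v` in the array `dst` at the position given by the registers 9 and 10,
and changes no other cell of this array. -/
structure Puts (G : K → Prop) (dst : ℕ) (v : K) (p : Prog) (s : MState K) : Prop where
  mem : ∀ i j, (p.exec s).mem dst i j = if i = s.reg 9 ∧ j = s.reg 10 then v else s.mem dst i j
  safe : p.Safe G s

theorem Puts.ifRegLt {G : K → Prop} {dst a b : ℕ} {v w : K} {p q : Prog} {s : MState K}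
    (hp : s.reg a < s.reg b → Puts G dst v p s) (hq : ¬ s.reg a < s.reg b → Puts G dst w q s) :
    Puts G dst (if s.reg a < s.reg b then v else w) (ifRegLt a b p q) s := by
  constructor
  · rw [exec_ifRegLt]
    split_ifs with h
    exacts [(hp h).mem, (hq h).mem]
  · rw [Safe]
    split_ifs with h
    exacts [(hp h).safe, (hq h).safe]

theorem Puts.seq {G : K → Prop} {dst : ℕ} {v : K} {p q : Prog} {s : MState K} (hs : p.Safe G s)
    (hd : dst ∉ p.arrs) (h9 : 9 ∉ p.regs) (h10 : 10 ∉ p.regs) (hq : Puts G dst v q (p.exec s)) :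
    Puts G dst v (seq p q) s := by
  refine ⟨?_, hs, hq.safe⟩
  have h := agree_exec p s
  rw [← h.reg 9 h9, ← h.reg 10 h10, ← h.mem dst hd]
  exact hq.mem

/-- Run `p` for all values of the register 9 below that of `br` and all values of the register
10 below that of `bc`. -/
def fill (br bc : ℕ) (p : Prog) : Prog := forReg 9 br (forReg 10 bc p)

/-- Nested invariants: the cells lexicographically before the current position are filled. Only the
inner bound has to be protected from changes, as the outer one is read once, on entry. -/
theorem fill_spec {G : K → Prop} {br bc dst : ℕ} {p : Prog} {s : MState K} (f : ℕ → ℕ → K)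
    (hr : 9 ∉ p.regs) (hbc : bc ∉ 9 :: 10 :: p.regs)
    (h : ∀ t, Agree (9 :: 10 :: p.regs) p.arrs s t → t.reg 9 < s.reg br → t.reg 10 < s.reg bc →
      Puts G dst (f (t.reg 9) (t.reg 10)) p t) :
    (∀ i j, ((fill br bc p).exec s).mem dst i j =
      if i < s.reg br ∧ j < s.reg bc then f i j else s.mem dst i j) ∧
      (fill br bc p).Safe G s := by
  refine forReg_spec (fun k μ => ∀ i j, μ dst i j =
    if i < k ∧ j < s.reg bc then f i j else s.mem dst i j) (by simp) fun k hk t ht htr hI => ?_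
  have hbc' : t.reg bc = s.reg bc := ht.reg bc hbc
  have := forReg_spec (G := G) (r := 10) (b := bc) (p := p) (s := t) (fun l μ => ∀ i j, μ dst i j =
    if (i < k ∧ j < s.reg bc) ∨ (i = k ∧ j < l) then f i j else s.mem dst i j)
    (by simpa using hI) fun l hl t' ht' htl hI' => ?_
  · refine ⟨fun i j => ?_, this.2⟩
    rw [this.1, hbc']
    have : ((i < k ∧ j < s.reg bc) ∨ (i = k ∧ j < s.reg bc)) ↔ (i < k + 1 ∧ j < s.reg bc) := by
      omega
    simp only [this]
  · have h1 : t'.reg 9 = k := (ht'.reg 9 (by simpa using hr)).trans htr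
    obtain ⟨h2, h3⟩ := h t' (ht.trans (ht'.mono (by simp [regs]) (by simp [arrs])))
      (by omega) (by omega)
    refine ⟨fun i j => ?_, h3⟩
    rw [h2, hI', h1, htl]
    by_cases hij : i = k ∧ j = l
    · rw [if_pos hij, if_pos (by omega), hij.1, hij.2]
    · rw [if_neg hij]
      have : ((i < k ∧ j < s.reg bc) ∨ (i = k ∧ j < l)) ↔
          ((i < k ∧ j < s.reg bc) ∨ (i = k ∧ j < l + 1)) := by omega
      simp only [this]

/-- Sum up, in the array `acc`, the values that `p` computes in the array `tmp` for all values of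
the register `x` below that of `b`. Both arrays are used at the position given by the
register 4. -/
def sum (x b acc tmp : ℕ) (p : Prog) : Prog :=
  seq (setCell ⟨acc, 4, 4⟩ 0)
    (forReg x b (seq p (cellOp .add ⟨acc, 4, 4⟩ ⟨acc, 4, 4⟩ ⟨tmp, 4, 4⟩)))

/-- Register 4 holds zero, so both arrays are used at the origin. `G` is required for all partial
sums because each of them is written. -/
theorem sum_spec {G : K → Prop} {x b acc tmp : ℕ} {p : Prog} {s : MState K} (f : ℕ → K)
    (hacc : acc ∉ p.arrs) (h4 : 4 ∉ x :: p.regs) (hs : s.reg 4 = 0)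
    (hG : ∀ k ≤ s.reg b, G (∑ i ∈ Finset.range k, f i))
    (h : ∀ t, Agree (x :: p.regs) (acc :: p.arrs) s t → t.reg x < s.reg b →
      (p.exec t).mem tmp 0 0 = f (t.reg x) ∧ p.Safe G t) :
    ((sum x b acc tmp p).exec s).mem acc 0 0 = ∑ i ∈ Finset.range (s.reg b), f i ∧
      (sum x b acc tmp p).Safe G s := by
  have := forReg_spec (G := G) (r := x) (b := b)
    (p := seq p (cellOp .add ⟨acc, 4, 4⟩ ⟨acc, 4, 4⟩ ⟨tmp, 4, 4⟩)) (s := s.write ⟨acc, 4, 4⟩ 0)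
    (fun k μ => μ acc 0 0 = ∑ i ∈ Finset.range k, f i) (by simp [MState.write, hs])
    fun k hk t ht htx hI => ?_
  · refine ⟨?_, by simpa [Safe] using hG 0 (Nat.zero_le _), ?_⟩
    · rw [sum, exec_seq, exec_setCell, Int.cast_zero, this.1]
      rfl
    · rw [exec_setCell, Int.cast_zero]
      exact this.2
  · have hst : Agree (x :: p.regs) (acc :: p.arrs) s t := by
      refine ((agree_write _ _ s).mono ?_ ?_).trans (ht.mono ?_ ?_) <;> simp [regs, arrs]
    have ht4 : t.reg 4 = 0 := (hst.reg 4 h4).trans hs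
    obtain ⟨h1, h2⟩ := h t hst (htx ▸ hk)
    have h3 := agree_exec p t
    have h4' : (p.exec t).reg 4 = 0 :=
      (h3.reg 4 fun h => h4 (List.mem_cons_of_mem _ h)).trans ht4
    have hval : (p.exec t).mem acc 0 0 + (p.exec t).mem tmp 0 0 =
        ∑ i ∈ Finset.range (k + 1), f i := by
      rw [h1, h3.mem acc hacc, hI, htx, Finset.sum_range_succ]
    refine ⟨?_, h2, ?_⟩
    · rw [exec_seq, exec_cellOp]
      simp [MState.write, MState.read, FieldOp.eval, h4', hval]
    · simpa [Safe, MState.read, FieldOp.eval, h4', hval] using hG (k + 1) hk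

end Prog

namespace Prog

/-! ## The program -/

/-- The registers 3, 5, 6, 7, 8 hold `m + n`, `m + n + 3`, `1`, `m + n + 1` and `m + n + 2`, the
arrays 8 and 10 the constants `1` and `-1`. -/
def setup : Prog :=
  seq (regOp .add 3 0 1) <| seq (setReg 6 1) <| seq (regOp .add 7 3 6) <|
  seq (regOp .add 8 7 6) <| seq (regOp .add 5 8 6) <|
  seq (setCell ⟨8, 4, 4⟩ 1) (setCell ⟨10, 4, 4⟩ (-1))

/-- Copy a cell into the array `dst`. -/
def put (dst : ℕ) (a : Cell) : Prog := cellOp .add ⟨dst, 9, 10⟩ a ⟨9, 4, 4⟩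

/-- Distinguish whether the registers 9 and 10 are equal. -/
def ifDiag (p q : Prog) : Prog := ifRegLt 9 10 q (ifRegLt 10 9 q p)

/-- The coefficients of the inequalities of `P`. -/
def fillP : Prog :=
  fill 3 5 <| ifRegLt 9 0
    (ifRegLt 10 0 (put 11 ⟨9, 4, 4⟩) <| ifRegLt 10 3
      (seq (regOp .sub 14 10 0) (put 11 ⟨0, 9, 14⟩)) <|
      ifRegLt 10 7 (put 11 ⟨10, 4, 4⟩) (put 11 ⟨9, 4, 4⟩))
    (ifDiag (put 11 ⟨10, 4, 4⟩) (put 11 ⟨9, 4, 4⟩))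

/-- The coefficients of the inequalities of `Q'`. -/
def fillQ : Prog :=
  fill 3 5 <| ifRegLt 9 0
    (ifDiag (put 12 ⟨10, 4, 4⟩) (put 12 ⟨9, 4, 4⟩))
    (seq (regOp .sub 14 9 0) <| ifRegLt 10 0 (put 12 ⟨1, 10, 14⟩) <|
      ifRegLt 10 7 (put 12 ⟨9, 4, 4⟩) <| ifRegLt 10 8 (put 12 ⟨10, 4, 4⟩) (put 12 ⟨2, 4, 14⟩))

/-- The coordinates of the pair of points. -/
def fillCoords : Prog :=
  fill 6 5 <| ifRegLt 10 0 (put 13 ⟨5, 4, 10⟩) <| ifRegLt 10 3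
    (seq (regOp .sub 14 10 0) (put 13 ⟨3, 4, 14⟩)) <|
    ifRegLt 10 7 (put 13 ⟨4, 4, 4⟩) <| ifRegLt 10 8 (put 13 ⟨7, 4, 4⟩) (put 13 ⟨6, 4, 4⟩)

/-- Test whether the inequality in the row `l` of the array `R` has positive slack. -/
def ifSlack (R l : ℕ) (p q : Prog) : Prog :=
  seq (sum 11 5 17 18 (cellOp .mul ⟨18, 4, 4⟩ ⟨R, l, 11⟩ ⟨13, 4, 11⟩)) <|
  seq (cellOp .sub ⟨17, 4, 4⟩ ⟨9, 4, 4⟩ ⟨17, 4, 4⟩) (ifCellPos ⟨17, 4, 4⟩ p q)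

/-- The matrix of the vertex. -/
def fillMatrix : Prog :=
  fill 5 5 <| ifRegLt 9 3 (ifSlack 11 9 (put 14 ⟨12, 9, 10⟩) (put 14 ⟨11, 9, 10⟩)) <|
    ifRegLt 9 7 (ifRegLt 10 0 (put 14 ⟨9, 4, 4⟩) <|
      ifRegLt 10 3 (put 14 ⟨8, 4, 4⟩) (put 14 ⟨9, 4, 4⟩)) <|
    ifRegLt 9 8 (ifRegLt 10 0 (put 14 ⟨8, 4, 4⟩) (put 14 ⟨9, 4, 4⟩)) <|
    -- The row of the duplicate label without a search: the sum over all labels of the rows of `Q'`,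
    -- set to zero unless the label is tight on both sides.
    seq (sum 12 3 19 20 <| ifSlack 11 12 (setCell ⟨20, 4, 4⟩ 0) <|
      ifSlack 12 12 (setCell ⟨20, 4, 4⟩ 0) (cellOp .add ⟨20, 4, 4⟩ ⟨12, 12, 10⟩ ⟨9, 4, 4⟩))
    (put 14 ⟨19, 4, 4⟩)

/-- One step of the Faddeev–LeVerrier algorithm. -/
def flStep : Prog :=
  seq (fill 5 5 <| seq (sum 11 5 17 18 (cellOp .mul ⟨18, 4, 4⟩ ⟨14, 9, 11⟩ ⟨15, 11, 10⟩))
    (put 16 ⟨17, 4, 4⟩)) <|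
  seq (sum 11 5 22 23 (cellOp .add ⟨23, 4, 4⟩ ⟨16, 11, 11⟩ ⟨9, 4, 4⟩)) <|
  -- The divisor is counted as a field element, since registers cannot be converted into field
  -- elements.
  seq (cellOp .add ⟨21, 4, 4⟩ ⟨21, 4, 4⟩ ⟨8, 4, 4⟩) <|
  seq (cellOp .sub ⟨24, 4, 4⟩ ⟨9, 4, 4⟩ ⟨22, 4, 4⟩) <|
  seq (cellOp .div ⟨24, 4, 4⟩ ⟨24, 4, 4⟩ ⟨21, 4, 4⟩)
  (fill 5 5 <| ifDiag (cellOp .add ⟨15, 9, 10⟩ ⟨16, 9, 10⟩ ⟨24, 4, 4⟩) (put 15 ⟨16, 9, 10⟩))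

/-- Evaluate the determinant up to sign. -/
def flLoop : Prog :=
  seq (setCell ⟨21, 4, 4⟩ 0) <|
  seq (fill 5 5 <| ifDiag (put 15 ⟨8, 4, 4⟩) (put 15 ⟨9, 4, 4⟩)) (forReg 13 5 flStep)

/-- Translate the sign of the result into the direction of the edge. -/
def output : Prog :=
  ifCellPos ⟨24, 4, 4⟩ (ifRegLt 2 6 (setReg 0 1) (setReg 0 0))
    (ifRegLt 2 6 (setReg 0 0) (setReg 0 1))

/-- The part of the program that contains the loops. -/
def body : Prog :=
  seq fillP <| seq fillQ <| seq fillCoords <| seq fillMatrix <| seq flLoop output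

theorem body_bounds : ∀ b ∈ body.bounds, b = 3 ∨ b = 5 ∨ b = 6 := by
  decide

theorem body_disjoint : body.bounds.Disjoint body.regs := by
  have : ∀ b ∈ body.bounds, b ∉ body.regs := by decide
  exact fun b h h' => this b h h'

end Prog

/-! ## Bounds for the size of the numbers -/

/-- A grading of the elements of a field that is compatible with the arithmetic operations. -/
structure SizeGrading (K : Type) [Field K] (N : ℕ) : Type where
  Le : ℕ → K → Prop
  mono : ∀ {d e : ℕ} {x : K}, d ≤ e → Le d x → Le e x
  zero : Le 0 0
  one : Le 0 1
  neg : ∀ {d : ℕ} {x : K}, Le d x → Le d (-x)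
  add : ∀ {d : ℕ} {x y : K}, Le d x → Le d y → Le (d + 1) (x + y)
  mul : ∀ {d e : ℕ} {x y : K}, Le d x → Le e y → Le (d + e) (x * y)
  -- Only small integers are ever divisors; general quotients would destroy the common denominator.
  div : ∀ {d k : ℕ} {x : K}, Le d x → k < N → Le (d + 1) (x / ((k : K) + 1))
  natCast : ∀ {k : ℕ}, k ≤ N → Le 1 (k : K)

theorem SizeGrading.sum {K : Type} [Field K] {N : ℕ} (g : SizeGrading K N) {d : ℕ} {f : ℕ → K}
    (k : ℕ) (h : ∀ i < k, g.Le d (f i)) : g.Le (d + k) (∑ i ∈ Finset.range k, f i) := by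
  induction k with
  | zero => exact g.mono (Nat.zero_le _) g.zero
  | succ k ih =>
    rw [Finset.sum_range_succ]
    exact g.add (ih fun i hi => h i (by omega)) (g.mono (Nat.le_add_right d k) (h k (by omega)))

/-! ## Correctness of the program -/

namespace Prog

variable {K : Type} [Field K] [LinearOrder K] {m n : ℕ}

/-- The coefficients of the inequalities of `P`, by numbers of rows and columns. -/
def rowP (I : InputData K m n) (r c : ℕ) : K :=
  if r < m then if c < m then 0 else if c < m + n then padded I.A r (c - m) else
    if c < m + n + 1 then -1 else 0
  else if r < c then 0 else if c < r then 0 else -1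

/-- The coefficients of the inequalities of `Q'`, by numbers of rows and columns. -/
def rowQ (I : InputData K m n) (r c : ℕ) : K :=
  if r < m then if r < c then 0 else if c < r then 0 else -1
  else if c < m then padded I.C c (r - m) else if c < m + n + 1 then 0 else
    if c < m + n + 2 then -1 else padded (fun _ : Fin 1 => I.β) 0 (r - m)

/-- The coordinates of the pair of points. -/
def coord (I : InputData K m n) (c : ℕ) : K :=
  if c < m then padded (fun _ : Fin 1 => I.x) 0 c else
  if c < m + n then padded (fun _ : Fin 1 => I.y) 0 (c - m) else
  if c < m + n + 1 then padded (fun _ _ : Fin 1 => I.pi1) 0 0 else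
  if c < m + n + 2 then padded (fun _ _ : Fin 1 => I.pi2) 0 0 else
    padded (fun _ _ : Fin 1 => I.lam) 0 0

/-- The slack of an inequality. -/
def slack (R : ℕ → ℕ → K) (I : InputData K m n) (r : ℕ) : K :=
  -∑ c ∈ Finset.range (m + n + 3), R r c * coord I c

/-- The matrix of the vertex, by numbers of rows and columns. -/
def entry (I : InputData K m n) (r c : ℕ) : K :=
  if r < m + n then if 0 < slack (rowP I) I r then rowQ I r c else rowP I r c else
  if r < m + n + 1 then if c < m then 0 else if c < m + n then 1 else 0 else
  if r < m + n + 2 then if c < m then 1 else 0 else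
    ∑ l ∈ Finset.range (m + n), if 0 < slack (rowP I) I l then 0 else
      if 0 < slack (rowQ I) I l then 0 else rowQ I l c

/-- The matrix of the vertex. -/
def entryMatrix (I : InputData K m n) : Matrix (Fin (m + n + 3)) (Fin (m + n + 3)) K :=
  Matrix.of fun r c => entry I r c

/-- The configuration holds the input `I`, the dimensions and the constants. -/
structure Holds (g : SizeGrading K (m + n + 3)) (I : InputData K m n) (s : MState K) : Prop where
  r0 : s.reg 0 = m
  r3 : s.reg 3 = m + n
  r4 : s.reg 4 = 0
  r5 : s.reg 5 = m + n + 3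
  r6 : s.reg 6 = 1
  r7 : s.reg 7 = m + n + 1
  r8 : s.reg 8 = m + n + 2
  m0 : s.mem 0 = padded I.A
  m1 : s.mem 1 = padded I.C
  m2 : s.mem 2 = padded (fun _ : Fin 1 => I.β)
  m3 : s.mem 3 = padded (fun _ : Fin 1 => I.y)
  m4 : s.mem 4 = padded (fun _ _ : Fin 1 => I.pi1)
  m5 : s.mem 5 = padded (fun _ : Fin 1 => I.x)
  m6 : s.mem 6 = padded (fun _ _ : Fin 1 => I.lam)
  m7 : s.mem 7 = padded (fun _ _ : Fin 1 => I.pi2)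
  m8 : s.mem 8 0 0 = 1
  m9 : s.mem 9 0 0 = 0
  m10 : s.mem 10 0 0 = -1
  le : ∀ a ≤ 10, ∀ i j, g.Le 1 (s.mem a i j)

variable {g : SizeGrading K (m + n + 3)} {I : InputData K m n} {s : MState K}

-- Registers below 9 and arrays below 11 hold the input and the constants. The filling and summing
-- routines work above these, so the invariant passes through them.
omit [LinearOrder K] in
theorem Holds.of_agree {R M : List ℕ} {t : MState K} (h : Holds g I s) (ht : Agree R M s t)
    (hR : ∀ r ∈ R, 9 ≤ r) (hM : ∀ a ∈ M, 11 ≤ a) : Holds g I t := by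
  have hr : ∀ r < 9, t.reg r = s.reg r := fun r h => ht.reg r fun h' => by
    have := hR r h'
    omega
  have hm : ∀ a < 11, t.mem a = s.mem a := fun a h => ht.mem a fun h' => by
    have := hM a h'
    omega
  exact ⟨(hr 0 (by norm_num)).trans h.r0, (hr 3 (by norm_num)).trans h.r3,
    (hr 4 (by norm_num)).trans h.r4, (hr 5 (by norm_num)).trans h.r5,
    (hr 6 (by norm_num)).trans h.r6, (hr 7 (by norm_num)).trans h.r7,
    (hr 8 (by norm_num)).trans h.r8, (hm 0 (by norm_num)).trans h.m0,
    (hm 1 (by norm_num)).trans h.m1, (hm 2 (by norm_num)).trans h.m2,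
    (hm 3 (by norm_num)).trans h.m3, (hm 4 (by norm_num)).trans h.m4,
    (hm 5 (by norm_num)).trans h.m5, (hm 6 (by norm_num)).trans h.m6,
    (hm 7 (by norm_num)).trans h.m7, hm 8 (by norm_num) ▸ h.m8, hm 9 (by norm_num) ▸ h.m9,
    hm 10 (by norm_num) ▸ h.m10, fun a ha => hm a (by omega) ▸ h.le a ha⟩

theorem Holds.exec {p : Prog} (h : Holds g I s) (hR : ∀ r ∈ p.regs, 9 ≤ r)
    (hM : ∀ a ∈ p.arrs, 11 ≤ a) : Holds g I (p.exec s) :=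
  h.of_agree (agree_exec p s) hR hM

/-- The size bound for all numbers that occur. -/
def maxLe (g : SizeGrading K (m + n + 3)) : K → Prop := g.Le (3 * (m + n + 4) ^ 2)

omit [LinearOrder K] in
theorem maxLe_of_le {d : ℕ} {x : K} (hd : d ≤ 3 * (m + n + 4)) (h : g.Le d x) : maxLe g x :=
  g.mono (hd.trans (by nlinarith)) h

/-- The machine has no copy instruction; a copy adds the zero that is kept at the origin of array 9.
-/
theorem puts_put {dst : ℕ} {a : Cell} (h : Holds g I s) (ha : maxLe g (s.read a)) :
    Puts (maxLe g) dst (s.read a) (put dst a) s := by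
  have h0 : s.read a + s.read ⟨9, 4, 4⟩ = s.read a := by
    rw [show s.read ⟨9, 4, 4⟩ = s.mem 9 (s.reg 4) (s.reg 4) from rfl, h.r4, h.m9, add_zero]
  refine ⟨fun i j => ?_, ?_⟩
  · rw [put, exec_cellOp, FieldOp.eval, h0]
    simp [MState.write]
  · rw [put, Safe, FieldOp.eval, h0]
    exact ha

theorem puts_put_input {dst : ℕ} {a : Cell} (h : Holds g I s) (ha : a.arr ≤ 10) :
    Puts (maxLe g) dst (s.read a) (put dst a) s :=
  puts_put h (maxLe_of_le (by omega) (h.le _ ha _ _))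

theorem Puts.congr {G : K → Prop} {dst : ℕ} {v w : K} {p : Prog} (h : Puts G dst v p s)
    (hvw : v = w) : Puts G dst w p s :=
  hvw ▸ h

theorem puts_zero {dst : ℕ} (h : Holds g I s) : Puts (maxLe g) dst 0 (put dst ⟨9, 4, 4⟩) s :=
  (puts_put_input h (by norm_num)).congr (by simp [MState.read, h.r4, h.m9])

theorem puts_one {dst : ℕ} (h : Holds g I s) : Puts (maxLe g) dst 1 (put dst ⟨8, 4, 4⟩) s :=
  (puts_put_input h (by norm_num)).congr (by simp [MState.read, h.r4, h.m8])

theorem puts_neg_one {dst : ℕ} (h : Holds g I s) :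
    Puts (maxLe g) dst (-1) (put dst ⟨10, 4, 4⟩) s :=
  (puts_put_input h (by norm_num)).congr (by simp [MState.read, h.r4, h.m10])

/-- Copy from a position one of whose coordinates is obtained by a subtraction. -/
theorem puts_sub {dst a b arr row col : ℕ} (h : Holds g I s) (ha : arr ≤ 10) :
    Puts (maxLe g) dst ((s.setReg 14 (s.reg a - s.reg b)).read ⟨arr, row, col⟩)
      (seq (regOp .sub 14 a b) (put dst ⟨arr, row, col⟩)) s := by
  refine Puts.seq trivial (by simp [arrs]) (by simp [regs]) (by simp [regs]) ?_
  exact puts_put_input (h.exec (p := regOp .sub 14 a b) (by simp [regs]) (by simp [arrs])) ha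

theorem Puts.ifDiag {G : K → Prop} {dst : ℕ} {v w : K} {p q : Prog}
    (hp : s.reg 9 = s.reg 10 → Puts G dst v p s) (hq : s.reg 9 ≠ s.reg 10 → Puts G dst w q s) :
    Puts G dst (if s.reg 9 < s.reg 10 then w else if s.reg 10 < s.reg 9 then w else v)
      (ifDiag p q) s :=
  Puts.ifRegLt (fun h => hq h.ne) fun h => Puts.ifRegLt (fun h' => hq h'.ne')
    fun h' => hp (by omega)

theorem fillP_spec (h : Holds g I s) :
    (∀ i j, (fillP.exec s).mem 11 i j =
      if i < m + n ∧ j < m + n + 3 then rowP I i j else s.mem 11 i j) ∧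
      fillP.Safe (maxLe g) s := by
  rw [← h.r5, ← h.r3]
  refine fill_spec (rowP I) (by decide) (by decide) fun t ht _ _ => ?_
  have ht := h.of_agree ht (by decide) (by decide)
  refine Puts.congr (Puts.ifRegLt (fun _ => Puts.ifRegLt (fun _ => puts_zero ht) fun _ =>
    Puts.ifRegLt (fun _ => puts_sub ht (by norm_num)) fun _ =>
    Puts.ifRegLt (fun _ => puts_neg_one ht) fun _ => puts_zero ht)
    fun _ => Puts.ifDiag (fun _ => puts_neg_one ht) fun _ => puts_zero ht) ?_
  simp [rowP, MState.read, MState.setReg, ht.m0, ht.r0, ht.r3, ht.r7]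

theorem fillQ_spec (h : Holds g I s) :
    (∀ i j, (fillQ.exec s).mem 12 i j =
      if i < m + n ∧ j < m + n + 3 then rowQ I i j else s.mem 12 i j) ∧
      fillQ.Safe (maxLe g) s := by
  rw [← h.r5, ← h.r3]
  refine fill_spec (rowQ I) (by decide) (by decide) fun t ht _ _ => ?_
  have ht := h.of_agree ht (by decide) (by decide)
  have ht' : Holds g I ((regOp .sub 14 9 0).exec t) := ht.exec (by decide) (by decide)
  refine Puts.congr (Puts.ifRegLt (fun _ => Puts.ifDiag (fun _ => puts_neg_one ht)
    fun _ => puts_zero ht) fun _ => Puts.seq trivial (by decide) (by decide) (by decide) <|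
    Puts.ifRegLt (fun _ => puts_put_input ht' (by norm_num)) fun _ =>
    Puts.ifRegLt (fun _ => puts_zero ht') fun _ =>
    Puts.ifRegLt (fun _ => puts_neg_one ht') fun _ => puts_put_input ht' (by norm_num)) ?_
  have h10 : ((regOp .sub 14 9 0).exec t).reg 10 = t.reg 10 := rfl
  have h14 : ((regOp .sub 14 9 0).exec t).reg 14 = t.reg 9 - m := by
    rw [← ht.r0]
    rfl
  simp [rowQ, MState.read, ht'.m1, ht'.m2, ht'.r0, ht'.r4, ht'.r7, ht'.r8, h10, h14, ht.r0]

theorem fillCoords_spec (h : Holds g I s) :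
    (∀ i j, (fillCoords.exec s).mem 13 i j =
      if i < 1 ∧ j < m + n + 3 then coord I j else s.mem 13 i j) ∧
      fillCoords.Safe (maxLe g) s := by
  rw [← h.r5, ← h.r6]
  refine fill_spec (fun _ => coord I) (by decide) (by decide) fun t ht _ _ => ?_
  have ht := h.of_agree ht (by decide) (by decide)
  refine Puts.congr (Puts.ifRegLt (fun _ => puts_put_input ht (by norm_num)) fun _ =>
    Puts.ifRegLt (fun _ => puts_sub ht (by norm_num)) fun _ =>
    Puts.ifRegLt (fun _ => puts_put_input ht (by norm_num)) fun _ =>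
    Puts.ifRegLt (fun _ => puts_put_input ht (by norm_num)) fun _ =>
      puts_put_input ht (by norm_num)) ?_
  simp [coord, MState.read, MState.setReg, ht.m3, ht.m4, ht.m5, ht.m6, ht.m7, ht.r0, ht.r3,
    ht.r4, ht.r7, ht.r8]

end Prog

/-! ### Correctness of the slack tests and of the matrix of the vertex -/

namespace Prog

variable {K : Type} [Field K] [LinearOrder K] {m n : ℕ}
  {g : SizeGrading K (m + n + 3)} {I : InputData K m n} {s : MState K}

omit [LinearOrder K] in
theorem Holds.rowP_le (h : Holds g I s) (i j : ℕ) : g.Le 1 (rowP I i j) := by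
  rw [rowP, ← h.m0]
  split_ifs
  all_goals first
    | exact g.mono (Nat.zero_le _) g.zero
    | exact g.neg (g.mono (Nat.zero_le _) g.one)
    | exact h.le _ (by norm_num) _ _

omit [LinearOrder K] in
theorem Holds.rowQ_le (h : Holds g I s) (i j : ℕ) : g.Le 1 (rowQ I i j) := by
  rw [rowQ, ← h.m1, ← h.m2]
  split_ifs
  all_goals first
    | exact g.mono (Nat.zero_le _) g.zero
    | exact g.neg (g.mono (Nat.zero_le _) g.one)
    | exact h.le _ (by norm_num) _ _

omit [LinearOrder K] in
theorem Holds.coord_le (h : Holds g I s) (j : ℕ) : g.Le 1 (coord I j) := by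
  rw [coord, ← h.m3, ← h.m4, ← h.m5, ← h.m6, ← h.m7]
  split_ifs
  all_goals exact h.le _ (by norm_num) _ _

/-- The arrays 11, 12 and 13 hold the coefficients and the coordinates. -/
structure Filled (g : SizeGrading K (m + n + 3)) (I : InputData K m n) (s : MState K) : Prop where
  holds : Holds g I s
  m11 : ∀ i < m + n, ∀ j < m + n + 3, s.mem 11 i j = rowP I i j
  m12 : ∀ i < m + n, ∀ j < m + n + 3, s.mem 12 i j = rowQ I i j
  m13 : ∀ j < m + n + 3, s.mem 13 0 j = coord I j

omit [LinearOrder K] in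
theorem Filled.of_agree {R M : List ℕ} {t : MState K} (h : Filled g I s) (ht : Agree R M s t)
    (hR : ∀ r ∈ R, 9 ≤ r) (hM : ∀ a ∈ M, 14 ≤ a) : Filled g I t := by
  have hm : ∀ a < 14, t.mem a = s.mem a := fun a h => ht.mem a fun h' => by
    have := hM a h'
    omega
  exact ⟨h.holds.of_agree ht hR fun a ha => (by norm_num : 11 ≤ 14).trans (hM a ha),
    hm 11 (by norm_num) ▸ h.m11, hm 12 (by norm_num) ▸ h.m12, hm 13 (by norm_num) ▸ h.m13⟩

/-- The test spoils scratch memory, so the branches start in an intermediate configuration `t`,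
known to agree with `s` elsewhere. The safety of the chosen branch is left to the caller, which
allows tests to be nested. -/
theorem ifSlack_spec {R l : ℕ} {f : ℕ → ℕ → K} (p q : Prog) (h : Filled g I s) (hl : l ≠ 11)
    (hR : R ≠ 17 ∧ R ≠ 18) (hf : ∀ j < m + n + 3, s.mem R (s.reg l) j = f (s.reg l) j)
    (hf' : ∀ j, g.Le 1 (f (s.reg l) j)) : ∃ t, Agree [11] [17, 18] s t ∧
      (ifSlack R l p q).exec s = (if 0 < slack f I (s.reg l) then p.exec t else q.exec t) ∧
      ((if 0 < slack f I (s.reg l) then p.Safe (maxLe g) t else q.Safe (maxLe g) t) →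
        (ifSlack R l p q).Safe (maxLe g) s) := by
  have hprod : ∀ j, g.Le 2 (f (s.reg l) j * coord I j) :=
    fun j => g.mul (hf' j) (h.holds.coord_le j)
  have hsum : ∀ k ≤ m + n + 3,
      maxLe g (∑ j ∈ Finset.range k, f (s.reg l) j * coord I j) := fun k hk =>
    maxLe_of_le (d := 2 + k) (by omega) (g.sum k fun i _ => hprod i)
  have key := sum_spec (G := maxLe g) (x := 11) (b := 5) (acc := 17) (tmp := 18)
    (p := cellOp .mul ⟨18, 4, 4⟩ ⟨R, l, 11⟩ ⟨13, 4, 11⟩) (s := s)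
    (fun j => f (s.reg l) j * coord I j) (by simp [arrs]) (by simp [regs]) h.holds.r4
    (fun k hk => hsum k (h.holds.r5 ▸ hk)) fun t ht htx => ?_
  · obtain ⟨h1, h2⟩ := key
    rw [h.holds.r5] at h1
    have h3 := agree_exec (sum 11 5 17 18 (cellOp .mul ⟨18, 4, 4⟩ ⟨R, l, 11⟩ ⟨13, 4, 11⟩)) s
    set t := (sum 11 5 17 18 (cellOp .mul ⟨18, 4, 4⟩ ⟨R, l, 11⟩ ⟨13, 4, 11⟩)).exec s with htdef
    have h3 : Agree [11] [17, 18] s t := h3.mono (by simp [sum, regs]) (by simp [sum, arrs])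
    have ht := h.of_agree h3 (by simp) (by simp)
    have hval : FieldOp.sub.eval (t.read ⟨9, 4, 4⟩) (t.read ⟨17, 4, 4⟩) =
        slack f I (s.reg l) := by
      simp [MState.read, ht.holds.r4, FieldOp.eval, ht.holds.m9, h1, slack]
    have h4 := (agree_write ⟨17, 4, 4⟩ (slack f I (s.reg l)) t).mono (R' := [11])
      (M' := [17, 18]) (by simp) (by simp)
    have hread : (t.write ⟨17, 4, 4⟩ (slack f I (s.reg l))).read ⟨17, 4, 4⟩ =
        slack f I (s.reg l) := by
      simp [MState.read, MState.write]
    refine ⟨t.write ⟨17, 4, 4⟩ (slack f I (s.reg l)), h3.trans h4, ?_, fun h5 => ⟨h2, ?_, ?_⟩⟩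
    · rw [ifSlack, exec_seq, ← htdef, exec_seq, exec_cellOp, hval, exec_ifCellPos, hread]
    · rw [← htdef, Safe, hval]
      exact g.neg (hsum _ le_rfl)
    · rw [← htdef, exec_cellOp, hval, Safe, hread]
      exact h5
  · have ht4 : t.reg 4 = 0 := (ht.reg 4 (by simp [regs])).trans h.holds.r4
    have htl : t.reg l = s.reg l := ht.reg l (by simp [regs, hl])
    have hval : FieldOp.mul.eval (t.read ⟨R, l, 11⟩) (t.read ⟨13, 4, 11⟩) =
        f (s.reg l) (t.reg 11) * coord I (t.reg 11) := by
      rw [h.holds.r5] at htx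
      simp only [MState.read, FieldOp.eval, ht4, htl]
      rw [ht.mem R (by simp [arrs, hR]), ht.mem 13 (by simp [arrs]), hf _ htx, h.m13 _ htx]
    rw [exec_cellOp, Safe, hval]
    exact ⟨by simp [MState.write, ht4], maxLe_of_le (by omega) (hprod _)⟩

theorem Puts.of_agree {G : K → Prop} {R M : List ℕ} {dst : ℕ} {v : K} {p : Prog} {t : MState K}
    (h : Agree R M s t) (hd : dst ∉ M) (h9 : 9 ∉ R) (h10 : 10 ∉ R) (hp : Puts G dst v p t) :
    ∀ i j, (p.exec t).mem dst i j = if i = s.reg 9 ∧ j = s.reg 10 then v else s.mem dst i j := by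
  rw [← h.reg 9 h9, ← h.reg 10 h10, ← h.mem dst hd]
  exact hp.mem

theorem entry_le (h : Holds g I s) (i j : ℕ) : g.Le (m + n + 4) (entry I i j) := by
  have h0 : g.Le (m + n + 4) 0 := g.mono (Nat.zero_le _) g.zero
  have h1 : g.Le (m + n + 4) 1 := g.mono (Nat.zero_le _) g.one
  rw [entry]
  split_ifs
  all_goals first
    | exact h0
    | exact h1
    | exact g.mono (by omega) (h.rowP_le _ _)
    | exact g.mono (by omega) (h.rowQ_le _ _)
    | skip
  refine g.mono (d := 1 + (m + n)) (by omega) (g.sum _ fun l _ => ?_)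
  split_ifs
  all_goals first
    | exact h.rowQ_le _ _
    | exact g.mono (Nat.zero_le _) g.zero

omit [LinearOrder K] in
theorem maxLe_zero : maxLe g 0 := g.mono (Nat.zero_le _) g.zero

theorem fillMatrix_spec (h : Filled g I s) :
    (∀ i j, (fillMatrix.exec s).mem 14 i j =
      if i < m + n + 3 ∧ j < m + n + 3 then entry I i j else s.mem 14 i j) ∧
      fillMatrix.Safe (maxLe g) s := by
  rw [← h.holds.r5]
  refine fill_spec (entry I) (by decide) (by decide) fun t ht h9 h10 => ?_
  have ht := h.of_agree ht (by decide) (by decide)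
  rw [h.holds.r5] at h9 h10
  have hrow : t.reg 9 < t.reg 3 → Puts (maxLe g) 14 (if 0 < slack (rowP I) I (t.reg 9) then
      rowQ I (t.reg 9) (t.reg 10) else rowP I (t.reg 9) (t.reg 10))
      (ifSlack 11 9 (put 14 ⟨12, 9, 10⟩) (put 14 ⟨11, 9, 10⟩)) t := by
    intro h3
    rw [ht.holds.r3] at h3
    obtain ⟨t', h1, h2, h4⟩ := ifSlack_spec (R := 11) (l := 9) (f := rowP I)
      (put 14 ⟨12, 9, 10⟩) (put 14 ⟨11, 9, 10⟩) ht (by norm_num) (by norm_num) (ht.m11 _ h3)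
      (ht.holds.rowP_le _)
    have ht' := ht.of_agree h1 (by decide) (by decide)
    have hQ : t'.read ⟨12, 9, 10⟩ = rowQ I (t.reg 9) (t.reg 10) := by
      rw [← ht.m12 _ h3 _ h10, MState.read, h1.mem 12 (by decide), h1.reg 9 (by decide),
        h1.reg 10 (by decide)]
    have hP : t'.read ⟨11, 9, 10⟩ = rowP I (t.reg 9) (t.reg 10) := by
      rw [← ht.m11 _ h3 _ h10, MState.read, h1.mem 11 (by decide), h1.reg 9 (by decide),
        h1.reg 10 (by decide)]
    have hQ' := puts_put (dst := 14) (a := ⟨12, 9, 10⟩) ht'.holds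
      (hQ ▸ maxLe_of_le (by omega) (ht.holds.rowQ_le _ _))
    have hP' := puts_put (dst := 14) (a := ⟨11, 9, 10⟩) ht'.holds
      (hP ▸ maxLe_of_le (by omega) (ht.holds.rowP_le _ _))
    rw [hQ] at hQ'
    rw [hP] at hP'
    constructor
    · rw [h2]
      split_ifs
      · exact hQ'.of_agree h1 (by decide) (by decide) (by decide)
      · exact hP'.of_agree h1 (by decide) (by decide) (by decide)
    · refine h4 ?_
      split_ifs
      exacts [hQ'.safe, hP'.safe]
  have hlast : Puts (maxLe g) 14 (∑ l ∈ Finset.range (m + n), if 0 < slack (rowP I) I l then 0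
      else if 0 < slack (rowQ I) I l then 0 else rowQ I l (t.reg 10))
      (seq (sum 12 3 19 20 <| ifSlack 11 12 (setCell ⟨20, 4, 4⟩ 0) <|
      ifSlack 12 12 (setCell ⟨20, 4, 4⟩ 0) (cellOp .add ⟨20, 4, 4⟩ ⟨12, 12, 10⟩ ⟨9, 4, 4⟩))
      (put 14 ⟨19, 4, 4⟩)) t := by
    have hle : ∀ l, g.Le 1 (if 0 < slack (rowP I) I l then 0
      else if 0 < slack (rowQ I) I l then 0 else rowQ I l (t.reg 10)) := by
      intro l
      split_ifs
      all_goals first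
        | exact ht.holds.rowQ_le _ _
        | exact g.mono (Nat.zero_le _) g.zero
    have hsum : ∀ k ≤ t.reg 3, maxLe g (∑ l ∈ Finset.range k, if 0 < slack (rowP I) I l then 0
      else if 0 < slack (rowQ I) I l then 0 else rowQ I l (t.reg 10)) := fun k hk => by
      rw [ht.holds.r3] at hk
      exact maxLe_of_le (d := 1 + k) (by omega) (g.sum k fun i _ => hle i)
    obtain ⟨h1, h2⟩ := sum_spec (G := maxLe g) (x := 12) (b := 3) (acc := 19) (tmp := 20)
      (p := ifSlack 11 12 (setCell ⟨20, 4, 4⟩ 0) <|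
        ifSlack 12 12 (setCell ⟨20, 4, 4⟩ 0) (cellOp .add ⟨20, 4, 4⟩ ⟨12, 12, 10⟩ ⟨9, 4, 4⟩))
      (s := t) (fun l => if 0 < slack (rowP I) I l then 0
      else if 0 < slack (rowQ I) I l then 0 else rowQ I l (t.reg 10)) (by decide) (by decide)
      ht.holds.r4 hsum fun t₁ ht₁ hl => by
        have hF₁ := ht.of_agree ht₁ (by decide) (by decide)
        rw [ht.holds.r3] at hl
        obtain ⟨t₂, a₂, e₂, s₂⟩ := ifSlack_spec (R := 11) (l := 12) (f := rowP I)
          (setCell ⟨20, 4, 4⟩ 0)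
          (ifSlack 12 12 (setCell ⟨20, 4, 4⟩ 0) (cellOp .add ⟨20, 4, 4⟩ ⟨12, 12, 10⟩ ⟨9, 4, 4⟩))
          hF₁ (by norm_num) (by norm_num) (hF₁.m11 _ hl) (ht.holds.rowP_le _)
        have hF₂ := hF₁.of_agree a₂ (by decide) (by decide)
        have h12₂ : t₂.reg 12 = t₁.reg 12 := a₂.reg 12 (by decide)
        obtain ⟨t₃, a₃, e₃, s₃⟩ := ifSlack_spec (R := 12) (l := 12) (f := rowQ I)
          (setCell ⟨20, 4, 4⟩ 0) (cellOp .add ⟨20, 4, 4⟩ ⟨12, 12, 10⟩ ⟨9, 4, 4⟩)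
          hF₂ (by norm_num) (by norm_num) (hF₂.m12 _ (h12₂ ▸ hl)) (ht.holds.rowQ_le _)
        have hF₃ := hF₂.of_agree a₃ (by decide) (by decide)
        have h12₃ : t₃.reg 12 = t₁.reg 12 := (a₃.reg 12 (by decide)).trans h12₂
        have h10₃ : t₃.reg 10 = t.reg 10 := (a₃.reg 10 (by decide)).trans
          ((a₂.reg 10 (by decide)).trans (ht₁.reg 10 (by decide)))
        have hval : FieldOp.add.eval (t₃.read ⟨12, 12, 10⟩) (t₃.read ⟨9, 4, 4⟩) =
            rowQ I (t₁.reg 12) (t.reg 10) := by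
          simp [FieldOp.eval, MState.read, hF₃.holds.r4, hF₃.holds.m9, h12₃, h10₃,
            hF₃.m12 _ hl _ h10]
        rw [e₃] at e₂
        rw [h12₂] at e₂ s₃
        constructor
        · rw [e₂]
          split_ifs
          · simp [exec_setCell, MState.write, hF₂.holds.r4]
          · simp [exec_setCell, MState.write, hF₃.holds.r4]
          · rw [exec_cellOp, hval]
            simp [MState.write, hF₃.holds.r4]
        · refine s₂ ?_
          split_ifs
          · simpa [Safe] using maxLe_zero
          · refine s₃ ?_
            split_ifs
            · simpa [Safe] using maxLe_zero
            · rw [Safe, hval]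
              exact maxLe_of_le (by omega) (ht.holds.rowQ_le _ _)
    have hH := ht.holds.exec (p := sum 12 3 19 20 <| ifSlack 11 12 (setCell ⟨20, 4, 4⟩ 0) <|
      ifSlack 12 12 (setCell ⟨20, 4, 4⟩ 0) (cellOp .add ⟨20, 4, 4⟩ ⟨12, 12, 10⟩ ⟨9, 4, 4⟩))
      (by decide) (by decide)
    refine Puts.seq h2 (by decide) (by decide) (by decide) ?_
    have hr := (show MState.read _ ⟨19, 4, 4⟩ = MState.mem _ 19 _ _ from rfl).trans
      (hH.r4 ▸ h1)
    rw [ht.holds.r3] at hr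
    refine (puts_put hH ?_).congr hr
    rw [hr, ← ht.holds.r3]
    exact hsum _ le_rfl
  refine Puts.congr (Puts.ifRegLt hrow fun _ => Puts.ifRegLt
    (fun _ => Puts.ifRegLt (fun _ => puts_zero ht.holds) fun _ =>
      Puts.ifRegLt (fun _ => puts_one ht.holds) fun _ => puts_zero ht.holds) fun _ =>
    Puts.ifRegLt (fun _ => Puts.ifRegLt (fun _ => puts_one ht.holds) fun _ => puts_zero ht.holds)
      fun _ => hlast) ?_
  simp only [entry, ht.holds.r0, ht.holds.r3, ht.holds.r7, ht.holds.r8]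

end Prog

/-! ### One step of the Faddeev–LeVerrier recursion -/

namespace Prog

variable {K : Type} [Field K] [LinearOrder K] {m n : ℕ}
  {g : SizeGrading K (m + n + 3)} {I : InputData K m n} {s : MState K}

/-- The array `a` holds the matrix `M`. -/
def HoldsMatrix (s : MState K) (a : ℕ) (M : Matrix (Fin (m + n + 3)) (Fin (m + n + 3)) K) : Prop :=
  ∀ i j : Fin (m + n + 3), s.mem a i j = M i j

/-- Degrees: an entry of the product costs `m + n + 4` for the factor from `W` and `m + n + 3` for
the summation, the trace another `m + n + 3`, the division and the final addition one each. This
makes exactly `3 * (m + n + 4)` per step. -/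
theorem flStep_spec {W M : Matrix (Fin (m + n + 3)) (Fin (m + n + 3)) K} {k d : ℕ} {c : K}
    (h : Holds g I s) (hW : HoldsMatrix s 14 W) (hM : HoldsMatrix s 15 M)
    (hk : s.mem 21 0 0 = k) (hkN : k < m + n + 3) (hc : c = -(W * M).trace / ((k : K) + 1))
    (hWle : ∀ i j, g.Le (m + n + 4) (W i j)) (hMle : ∀ i j, g.Le d (M i j))
    (hd : d + 3 * (m + n + 4) ≤ 3 * (m + n + 4) ^ 2) :
    (HoldsMatrix (flStep.exec s) 15 (W * M + Matrix.scalar _ c) ∧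
      (flStep.exec s).mem 21 0 0 = (k + 1 : ℕ) ∧ (flStep.exec s).mem 24 0 0 = c ∧
      ∀ i j, g.Le (d + 3 * (m + n + 4)) ((W * M + Matrix.scalar (Fin (m + n + 3)) c) i j)) ∧
      flStep.Safe (maxLe g) s := by
  have hmax : ∀ {e : ℕ} {v : K}, e ≤ d + 3 * (m + n + 4) → g.Le e v → maxLe g v :=
    fun he hv => g.mono (he.trans hd) hv
  -- products
  set f : ℕ → ℕ → ℕ → K := fun i j x => s.mem 14 i x * s.mem 15 x j with hf
  have hfle : ∀ i < m + n + 3, ∀ j < m + n + 3, ∀ x < m + n + 3,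
      g.Le (m + n + 4 + d) (f i j x) := fun i hi j hj x hx => by
    rw [hf]
    dsimp only
    rw [hW ⟨i, hi⟩ ⟨x, hx⟩, hM ⟨x, hx⟩ ⟨j, hj⟩]
    exact g.mul (hWle _ _) (hMle _ _)
  have hple : ∀ i < m + n + 3, ∀ j < m + n + 3, ∀ k ≤ m + n + 3,
      g.Le (m + n + 4 + d + k) (∑ x ∈ Finset.range k, f i j x) := fun i hi j hj k hk =>
    g.sum k fun x hx => hfle i hi j hj x (hx.trans_le hk)
  have hmul : ∀ i j : Fin (m + n + 3), ∑ x ∈ Finset.range (m + n + 3), f i j x = (W * M) i j := by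
    intro i j
    rw [Matrix.mul_apply, Finset.sum_range]
    exact Finset.sum_congr rfl fun x _ => by rw [← hW, ← hM]
  have hWMle : ∀ i j, g.Le (m + n + 4 + d + (m + n + 3)) ((W * M) i j) := fun i j =>
    hmul i j ▸ hple i i.2 j j.2 _ le_rfl
  have step₁ := fill_spec (G := maxLe g) (br := 5) (bc := 5) (dst := 16)
    (p := seq (sum 11 5 17 18 (cellOp .mul ⟨18, 4, 4⟩ ⟨14, 9, 11⟩ ⟨15, 11, 10⟩))
      (put 16 ⟨17, 4, 4⟩)) (s := s) (fun i j => ∑ x ∈ Finset.range (m + n + 3), f i j x)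
    (by decide) (by decide) fun t ht h9 h10 => by
      have htH := h.of_agree ht (by decide) (by decide)
      rw [h.r5] at h9 h10
      obtain ⟨h1, h2⟩ := sum_spec (G := maxLe g) (x := 11) (b := 5) (acc := 17) (tmp := 18)
        (p := cellOp .mul ⟨18, 4, 4⟩ ⟨14, 9, 11⟩ ⟨15, 11, 10⟩) (s := t)
        (f (t.reg 9) (t.reg 10)) (by decide) (by decide) htH.r4
        (fun k hk => hmax (by rw [htH.r5] at hk; omega)
          (hple _ h9 _ h10 k (htH.r5 ▸ hk))) fun t' ht' htx => by
          rw [htH.r5] at htx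
          have hval : FieldOp.mul.eval (t'.read ⟨14, 9, 11⟩) (t'.read ⟨15, 11, 10⟩) =
              f (t.reg 9) (t.reg 10) (t'.reg 11) := by
            simp only [FieldOp.eval, MState.read, hf]
            rw [ht'.mem 14 (by decide), ht.mem 14 (by decide), ht'.mem 15 (by decide),
              ht.mem 15 (by decide), ht'.reg 9 (by decide), ht'.reg 10 (by decide)]
          rw [exec_cellOp, Safe, hval]
          refine ⟨?_, hmax (by omega) (hfle _ h9 _ h10 _ htx)⟩
          simp [MState.write, (ht'.reg 4 (by decide)).trans htH.r4]
      have htS := htH.exec (p := sum 11 5 17 18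
        (cellOp .mul ⟨18, 4, 4⟩ ⟨14, 9, 11⟩ ⟨15, 11, 10⟩)) (by decide) (by decide)
      refine Puts.seq h2 (by decide) (by decide) (by decide) ?_
      have hr := (show MState.read _ ⟨17, 4, 4⟩ = MState.mem _ 17 _ _ from rfl).trans
        (htS.r4 ▸ h1)
      rw [htH.r5] at hr
      refine (puts_put htS ?_).congr hr
      rw [hr]
      exact hmax (by omega) (hple _ h9 _ h10 _ le_rfl)
  set p₁ := fill 5 5 <| seq (sum 11 5 17 18 (cellOp .mul ⟨18, 4, 4⟩ ⟨14, 9, 11⟩ ⟨15, 11, 10⟩))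
    (put 16 ⟨17, 4, 4⟩) with hp₁
  have a₁ : Agree _ _ s (p₁.exec s) := agree_exec p₁ s
  set s₁ := p₁.exec s with hs₁
  have h₁ : Holds g I s₁ := h.of_agree a₁ (by decide) (by decide)
  have hT : HoldsMatrix s₁ 16 (W * M) := fun i j => by
    rw [step₁.1, h.r5, if_pos ⟨i.2, j.2⟩, hmul]
  -- the trace
  have htr : ∑ x ∈ Finset.range (m + n + 3), s₁.mem 16 x x = (W * M).trace := by
    rw [Finset.sum_range]
    exact Finset.sum_congr rfl fun x _ => hT x x
  have htrle : ∀ k ≤ m + n + 3, g.Le (m + n + 4 + d + (m + n + 3) + k)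
      (∑ x ∈ Finset.range k, s₁.mem 16 x x) := fun k hk => g.sum k fun x hx => by
    rw [hT ⟨x, hx.trans_le hk⟩ ⟨x, hx.trans_le hk⟩]
    exact hWMle _ _
  have step₂ := sum_spec (G := maxLe g) (x := 11) (b := 5) (acc := 22) (tmp := 23)
    (p := cellOp .add ⟨23, 4, 4⟩ ⟨16, 11, 11⟩ ⟨9, 4, 4⟩) (s := s₁) (fun x => s₁.mem 16 x x)
    (by decide) (by decide) h₁.r4
    (fun k hk => by
      rw [h₁.r5] at hk
      exact hmax (by omega) (htrle k hk)) fun t ht htx => by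
      have htH := h₁.of_agree ht (by decide) (by decide)
      rw [h₁.r5] at htx
      have hval : FieldOp.add.eval (t.read ⟨16, 11, 11⟩) (t.read ⟨9, 4, 4⟩) =
          s₁.mem 16 (t.reg 11) (t.reg 11) := by
        simp [FieldOp.eval, MState.read, htH.r4, htH.m9, ht.mem 16 (by decide)]
      rw [exec_cellOp, Safe, hval, hT ⟨_, htx⟩ ⟨_, htx⟩]
      exact ⟨by simp [MState.write, htH.r4], hmax (by omega) (hWMle _ _)⟩
  set p₂ := sum 11 5 22 23 (cellOp .add ⟨23, 4, 4⟩ ⟨16, 11, 11⟩ ⟨9, 4, 4⟩) with hp₂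
  have a₂ : Agree _ _ s₁ (p₂.exec s₁) := agree_exec p₂ s₁
  set s₂ := p₂.exec s₁ with hs₂
  have h₂ : Holds g I s₂ := h₁.of_agree a₂ (by decide) (by decide)
  rw [h₁.r5, htr] at step₂
  have htrle' : g.Le (m + n + 4 + d + (m + n + 3) + (m + n + 3)) (W * M).trace :=
    htr ▸ htrle _ le_rfl
  -- the counter
  have hval₃ : FieldOp.add.eval (s₂.read ⟨21, 4, 4⟩) (s₂.read ⟨8, 4, 4⟩) = ((k + 1 : ℕ) : K) := by
    simp [FieldOp.eval, MState.read, h₂.r4, h₂.m8, a₂.mem 21 (by decide), a₁.mem 21 (by decide),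
      hk]
  have a₃ := agree_write ⟨21, 4, 4⟩ ((k + 1 : ℕ) : K) s₂
  set s₃ := s₂.write ⟨21, 4, 4⟩ ((k + 1 : ℕ) : K) with hs₃
  have h₃ : Holds g I s₃ := h₂.of_agree a₃ (by decide) (by simp)
  have hc₃ : s₃.mem 21 0 0 = ((k + 1 : ℕ) : K) := by simp [hs₃, MState.write, h₂.r4]
  -- the coefficient
  have hval₄ : FieldOp.sub.eval (s₃.read ⟨9, 4, 4⟩) (s₃.read ⟨22, 4, 4⟩) = -(W * M).trace := by
    simp [FieldOp.eval, MState.read, h₃.r4, h₃.m9, a₃.mem 22 (by simp), step₂.1]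
  have a₄ := agree_write ⟨24, 4, 4⟩ (-(W * M).trace) s₃
  set s₄ := s₃.write ⟨24, 4, 4⟩ (-(W * M).trace) with hs₄
  have h₄ : Holds g I s₄ := h₃.of_agree a₄ (by decide) (by simp)
  have hval₅ : FieldOp.div.eval (s₄.read ⟨24, 4, 4⟩) (s₄.read ⟨21, 4, 4⟩) = c := by
    rw [FieldOp.eval, MState.read, MState.read, a₄.mem 21 (by simp), h₄.r4, hc₃, hc]
    simp [hs₄, MState.write, h₃.r4]
  have a₅ := agree_write ⟨24, 4, 4⟩ c s₄
  set s₅ := s₄.write ⟨24, 4, 4⟩ c with hs₅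
  have h₅ : Holds g I s₅ := h₄.of_agree a₅ (by decide) (by simp)
  have hc₅ : s₅.mem 24 0 0 = c := by simp [hs₅, MState.write, h₄.r4]
  have hcle : g.Le (m + n + 4 + d + (m + n + 3) + (m + n + 3) + 1) c := by
    rw [hc]
    exact g.div (g.neg htrle') hkN
  have hT₅ : HoldsMatrix s₅ 16 (W * M) := by
    rw [HoldsMatrix, a₅.mem 16 (by simp), a₄.mem 16 (by simp), a₃.mem 16 (by simp),
      a₂.mem 16 (by decide)]
    exact hT
  -- the new matrix
  set f' : ℕ → ℕ → K := fun i j => if i < j then s₅.mem 16 i j else if j < i then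
    s₅.mem 16 i j else s₅.mem 16 i j + c with hf'
  have hf'val : ∀ i j : Fin (m + n + 3), f' i j = (W * M + Matrix.scalar (Fin (m + n + 3)) c) i j := by
    intro i j
    rw [hf', Matrix.add_apply, Matrix.scalar_apply, Matrix.diagonal_apply]
    dsimp only
    rw [hT₅]
    rcases lt_trichotomy i j with hij | hij | hij
    · rw [if_pos (Fin.lt_def.1 hij), if_neg hij.ne, add_zero]
    · simp [hij]
    · rw [if_neg (Fin.lt_def.1 hij).le.not_gt, if_pos (Fin.lt_def.1 hij), if_neg hij.ne', add_zero]
  have hadd : ∀ i j : Fin (m + n + 3), g.Le (d + 3 * (m + n + 4)) (s₅.mem 16 i j + c) := fun i j =>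
    g.mono (by omega) (g.add (g.mono (by omega) (hT₅ i j ▸ hWMle i j)) hcle)
  have step₆ := fill_spec (G := maxLe g) (br := 5) (bc := 5) (dst := 15)
    (p := ifDiag (cellOp .add ⟨15, 9, 10⟩ ⟨16, 9, 10⟩ ⟨24, 4, 4⟩) (put 15 ⟨16, 9, 10⟩)) (s := s₅)
    f' (by decide) (by decide) fun t ht h9 h10 => by
      have htH := h₅.of_agree ht (by decide) (by decide)
      rw [h₅.r5] at h9 h10
      have hr : t.read ⟨16, 9, 10⟩ = s₅.mem 16 (t.reg 9) (t.reg 10) := by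
        rw [MState.read, ht.mem 16 (by decide)]
      have hput : Puts (maxLe g) 15 (s₅.mem 16 (t.reg 9) (t.reg 10)) (put 15 ⟨16, 9, 10⟩) t := by
        refine (puts_put htH ?_).congr hr
        rw [hr, hT₅ ⟨_, h9⟩ ⟨_, h10⟩]
        exact hmax (by omega) (hWMle _ _)
      refine Puts.ifDiag (fun _ => ⟨?_, ?_⟩) fun _ => hput
      all_goals
        have hval : FieldOp.add.eval (t.read ⟨16, 9, 10⟩) (t.read ⟨24, 4, 4⟩) =
            s₅.mem 16 (t.reg 9) (t.reg 10) + c := by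
          rw [hr, FieldOp.eval, MState.read, ht.mem 24 (by decide), htH.r4, hc₅]
      · rw [exec_cellOp, hval]
        simp [MState.write]
      · rw [Safe, hval]
        exact hmax le_rfl (hadd ⟨_, h9⟩ ⟨_, h10⟩)
  set p₆ := fill 5 5 <| ifDiag (cellOp .add ⟨15, 9, 10⟩ ⟨16, 9, 10⟩ ⟨24, 4, 4⟩)
    (put 15 ⟨16, 9, 10⟩) with hp₆
  have a₆ := agree_exec p₆ s₅
  have e₃ : (cellOp .add ⟨21, 4, 4⟩ ⟨21, 4, 4⟩ ⟨8, 4, 4⟩).exec s₂ = s₃ := by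
    rw [exec_cellOp, hval₃]
  have e₄ : (cellOp .sub ⟨24, 4, 4⟩ ⟨9, 4, 4⟩ ⟨22, 4, 4⟩).exec s₃ = s₄ := by
    rw [exec_cellOp, hval₄]
  have e₅ : (cellOp .div ⟨24, 4, 4⟩ ⟨24, 4, 4⟩ ⟨21, 4, 4⟩).exec s₄ = s₅ := by
    rw [exec_cellOp, hval₅]
  have hexec : flStep.exec s = p₆.exec s₅ := by
    rw [flStep, exec_seq, ← hp₁, ← hs₁, exec_seq, ← hp₂, ← hs₂, exec_seq, e₃, exec_seq, e₄,
      exec_seq, e₅]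
  rw [hexec]
  refine ⟨⟨fun i j => ?_, ?_, ?_, fun i j => ?_⟩, step₁.2, step₂.2, ?_, ?_, ?_, ?_⟩
  · rw [step₆.1, h₅.r5, if_pos ⟨i.2, j.2⟩, hf'val]
  · rw [a₆.mem 21 (by decide), a₅.mem 21 (by simp), a₄.mem 21 (by simp), hc₃]
  · rw [a₆.mem 24 (by decide), hc₅]
  · rw [← hf'val, hf']
    dsimp only
    have := g.mono (e := d + 3 * (m + n + 4)) (by omega) (hT₅ i j ▸ hWMle i j)
    split_ifs
    exacts [this, this, hadd i j]
  · rw [← hp₁, ← hs₁, ← hp₂, ← hs₂, Safe, hval₃]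
    exact hmax (by omega) (g.natCast (by omega))
  · rw [← hp₁, ← hs₁, ← hp₂, ← hs₂, e₃, Safe, hval₄]
    exact hmax (by omega) (g.neg htrle')
  · rw [← hp₁, ← hs₁, ← hp₂, ← hs₂, e₃, e₄, Safe, hval₅]
    exact hmax (by omega) hcle
  · rw [← hp₁, ← hs₁, ← hp₂, ← hs₂, e₃, e₄, e₅]
    exact step₆.2

end Prog

/-! ### The determinant loop and the whole program -/

namespace Prog

variable {K : Type} [Field K] [LinearOrder K] {m n : ℕ}
  {g : SizeGrading K (m + n + 3)} {I : InputData K m n} {s : MState K}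

theorem flLoop_spec [CharZero K] {W : Matrix (Fin (m + n + 3)) (Fin (m + n + 3)) K}
    (h : Holds g I s) (hW : HoldsMatrix s 14 W) (hWle : ∀ i j, g.Le (m + n + 4) (W i j)) :
    (flLoop.exec s).mem 24 0 0 = (-1) ^ (m + n + 3) * W.det ∧ flLoop.Safe (maxLe g) s := by
  have a₁ := agree_write ⟨21, 4, 4⟩ (0 : K) s
  set s₁ := s.write ⟨21, 4, 4⟩ (0 : K) with hs₁
  have h₁ : Holds g I s₁ := h.of_agree a₁ (by decide) (by simp)
  have step₂ := fill_spec (G := maxLe g) (br := 5) (bc := 5) (dst := 15)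
    (p := ifDiag (put 15 ⟨8, 4, 4⟩) (put 15 ⟨9, 4, 4⟩)) (s := s₁)
    (fun i j => if i < j then 0 else if j < i then 0 else 1) (by decide) (by decide)
    fun t ht _ _ => by
      have htH := h₁.of_agree ht (by decide) (by decide)
      exact Puts.ifDiag (fun _ => puts_one htH) fun _ => puts_zero htH
  set p₂ := fill 5 5 <| ifDiag (put 15 ⟨8, 4, 4⟩) (put 15 ⟨9, 4, 4⟩) with hp₂
  have a₂ : Agree _ _ s₁ (p₂.exec s₁) := agree_exec p₂ s₁
  set s₂ := p₂.exec s₁ with hs₂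
  have h₂ : Holds g I s₂ := h₁.of_agree a₂ (by decide) (by decide)
  -- The degree grows linearly with the number of steps, and there are `m + n + 3` of them, so it
  -- stays below the quadratic bound of `maxLe`. The clause on array 24 is vacuous before the first
  -- step; after the last one it gives the constant coefficient of the characteristic polynomial.
  have step₃ := forReg_spec (G := maxLe g) (r := 13) (b := 5) (p := flStep) (s := s₂)
    (fun k μ => (∀ i j : Fin (m + n + 3), μ 15 i j = flMatrix W k i j) ∧ μ 21 0 0 = k ∧
      (∀ l, k = l + 1 → μ 24 0 0 = -(W * flMatrix W l).trace / ((l : K) + 1)) ∧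
      ∀ i j, g.Le (k * (3 * (m + n + 4))) (flMatrix W k i j)) ?_ ?_
  · have e₁ : (setCell ⟨21, 4, 4⟩ 0).exec s = s₁ := by
      rw [exec_setCell, Int.cast_zero]
    refine ⟨?_, by simpa [Safe] using maxLe_zero, ?_, ?_⟩
    · rw [flLoop, exec_seq, e₁, exec_seq, ← hp₂, ← hs₂,
        step₃.1.2.2.1 (m + n + 2) (by rw [h₂.r5]), flMatrix_det, Fintype.card_fin]
      rw [Fintype.card_fin]
    · rw [e₁]
      exact step₂.2
    · rw [e₁, ← hp₂, ← hs₂]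
      exact step₃.2
  · refine ⟨fun i j => ?_, ?_, fun l hl => by omega, fun i j => ?_⟩
    · rw [step₂.1, h₁.r5, if_pos ⟨i.2, j.2⟩, flMatrix, Matrix.one_apply]
      rcases lt_trichotomy i j with hij | hij | hij
      · rw [if_pos (Fin.lt_def.1 hij), if_neg hij.ne]
      · simp [hij]
      · rw [if_neg (Fin.lt_def.1 hij).le.not_gt, if_pos (Fin.lt_def.1 hij), if_neg hij.ne']
    · rw [a₂.mem 21 (by decide), hs₁]
      simp [MState.write, h.r4]
    · rw [flMatrix, Matrix.one_apply]
      split_ifs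
      exacts [g.mono (Nat.zero_le _) g.one, g.mono (Nat.zero_le _) g.zero]
  · intro k hk t ht htk hI
    obtain ⟨h15, h21, -, hle⟩ := hI
    rw [h₂.r5] at hk
    have htH := h₂.of_agree ht (by decide) (by decide)
    have htW : HoldsMatrix t 14 W := by
      rw [HoldsMatrix, ht.mem 14 (by decide), a₂.mem 14 (by decide), a₁.mem 14 (by simp)]
      exact hW
    obtain ⟨⟨g1, g2, g3, g4⟩, g5⟩ := flStep_spec htH htW h15 h21 hk rfl hWle hle
      (by nlinarith)
    refine ⟨⟨g1, g2, fun l hl => ?_, fun i j => ?_⟩, g5⟩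
    · obtain rfl : k = l := by omega
      exact g3
    · rw [add_one_mul]
      exact g4 i j

theorem output_spec {v : K} (h : Holds g I s) (hv : s.mem 24 0 0 = v) :
    (output.exec s).reg 0 = (if 0 < v then if s.reg 2 < 1 then 1 else 0 else
      if s.reg 2 < 1 then 0 else 1) ∧ output.Safe (maxLe g) s := by
  have hr : s.read ⟨24, 4, 4⟩ = v := by rw [MState.read, h.r4, hv]
  constructor
  · rw [output, exec_ifCellPos, hr, exec_ifRegLt, exec_ifRegLt, h.r6]
    split_ifs <;> simp [exec_setReg, MState.setReg]
  · rw [output, Safe, hr]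
    split_ifs <;> rw [Safe] <;> split_ifs <;> trivial

theorem body_spec [CharZero K] (h : Holds g I s) :
    (body.exec s).reg 0 = (if 0 < (-1) ^ (m + n + 3) * (entryMatrix I).det then
      if s.reg 2 < 1 then 1 else 0 else if s.reg 2 < 1 then 0 else 1) ∧
      body.Safe (maxLe g) s := by
  obtain ⟨v₁, w₁⟩ := fillP_spec h
  have a₁ := agree_exec fillP s
  have h₁ := h.of_agree a₁ (by decide) (by decide)
  obtain ⟨v₂, w₂⟩ := fillQ_spec h₁
  have a₂ := agree_exec fillQ (fillP.exec s)
  have h₂ := h₁.of_agree a₂ (by decide) (by decide)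
  obtain ⟨v₃, w₃⟩ := fillCoords_spec h₂
  have a₃ := agree_exec fillCoords (fillQ.exec (fillP.exec s))
  have h₃ : Filled g I (fillCoords.exec (fillQ.exec (fillP.exec s))) := by
    refine ⟨h₂.of_agree a₃ (by decide) (by decide), fun i hi j hj => ?_, fun i hi j hj => ?_,
      fun j hj => ?_⟩
    · rw [a₃.mem 11 (by decide), a₂.mem 11 (by decide), v₁, if_pos ⟨hi, hj⟩]
    · rw [a₃.mem 12 (by decide), v₂, if_pos ⟨hi, hj⟩]
    · rw [v₃, if_pos ⟨one_pos, hj⟩]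
  obtain ⟨v₄, w₄⟩ := fillMatrix_spec h₃
  have a₄ := agree_exec fillMatrix (fillCoords.exec (fillQ.exec (fillP.exec s)))
  have h₄ := h₃.of_agree a₄ (by decide) (by decide)
  obtain ⟨v₅, w₅⟩ := flLoop_spec (W := entryMatrix I) h₄.holds
    (fun i j => by rw [v₄, if_pos ⟨i.2, j.2⟩]; rfl) fun i j => entry_le h i j
  have a₅ := agree_exec flLoop (fillMatrix.exec (fillCoords.exec (fillQ.exec (fillP.exec s))))
  have h₅ := h₄.of_agree (M := flLoop.arrs) a₅ (by decide) (by decide)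
  obtain ⟨v₆, w₆⟩ := output_spec h₅.holds v₅
  rw [a₅.reg 2 (by decide), a₄.reg 2 (by decide), a₃.reg 2 (by decide), a₂.reg 2 (by decide),
    a₁.reg 2 (by decide)] at v₆
  exact ⟨v₆, w₁, w₂, w₃, w₄, w₅, w₆⟩

theorem setup_spec {k : EdgeKind} (hI : ∀ a ≤ 7, ∀ i j, g.Le 1 ((initState I k).mem a i j)) :
    Holds g I (setup.exec (initState I k)) ∧ setup.Safe (maxLe g) (initState I k) ∧
      (setup.exec (initState I k)).reg 2 = (initState I k).reg 2 := by
  have h1 : g.Le 1 1 := g.mono (Nat.zero_le _) g.one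
  have h0 : g.Le 1 0 := g.mono (Nat.zero_le _) g.zero
  have hs := agree_exec setup (initState I k)
  refine ⟨⟨rfl, rfl, rfl, rfl, rfl, rfl, rfl, hs.mem 0 (by decide), hs.mem 1 (by decide),
    hs.mem 2 (by decide), hs.mem 3 (by decide), hs.mem 4 (by decide), hs.mem 5 (by decide),
    hs.mem 6 (by decide), hs.mem 7 (by decide), ?_, ?_, ?_, fun a ha i j => ?_⟩, ?_, rfl⟩
  · simp [setup, exec_seq, exec_setCell, exec_regOp, exec_setReg, MState.write, MState.setReg,
      initState]
  · simp [setup, exec_seq, exec_setCell, exec_regOp, exec_setReg, MState.write, MState.setReg,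
      initState]
  · simp [setup, exec_seq, exec_setCell, exec_regOp, exec_setReg, MState.write, MState.setReg,
      initState]
  · rcases Nat.lt_or_ge 7 a with h | h
    · have : a = 8 ∨ a = 9 ∨ a = 10 := by omega
      rcases this with rfl | rfl | rfl <;>
      · simp only [setup, exec_seq, exec_setCell, exec_regOp, exec_setReg, MState.write,
          MState.setReg, initState, Int.cast_neg, Int.cast_one]
        split_ifs
        all_goals first
          | exact h1
          | exact h0
          | exact g.neg h1
    · rw [hs.mem a (by simp [setup, arrs]; omega)]
      exact hI a h i j
  · refine ⟨trivial, trivial, trivial, trivial, trivial, ?_, ?_⟩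
    · simpa [Safe] using maxLe_of_le (by omega) h1
    · simpa [Safe] using maxLe_of_le (by omega) (g.neg h1)

/-- The whole program. -/
def program : Prog := seq setup body

/-- A polynomial bound for the number of steps. -/
noncomputable def programSteps : Polynomial ℕ := setup.steps + body.steps

/-- Generic in field, grading and size function: the claims for real and for rational data are both
instances. -/
theorem program_spec [CharZero K] {k : EdgeKind} {sz : K → ℕ} {S B : ℕ}
    (hI : ∀ a ≤ 7, ∀ i j, g.Le 1 ((initState I k).mem a i j)) (hS : ∀ v, maxLe g v → sz v ≤ S)
    (hB : m + n + 3 ≤ B) :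
    (program.run sz (initState I k)).1.reg 0 =
      (if 0 < (-1) ^ (m + n + 3) * (entryMatrix I).det then
        if (initState I k).reg 2 < 1 then 1 else 0 else
        if (initState I k).reg 2 < 1 then 0 else 1) ∧
    (program.run sz (initState I k)).2 ≤ programSteps.eval B * (1 + S) := by
  obtain ⟨h1, h2, h3⟩ := setup_spec hI
  obtain ⟨h4, h5⟩ := body_spec h1
  constructor
  · rw [run_fst, program, exec_seq, h4, h3]
  · rw [program, run, programSteps, Polynomial.eval_add, add_mul]
    refine Nat.add_le_add (run_snd_le setup _ (Safe.mono hS _ _ h2)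
      (fun _ h => absurd h (List.not_mem_nil)) fun _ h => absurd h List.not_mem_nil) ?_
    rw [run_fst]
    refine run_snd_le body _ (Safe.mono hS _ _ h5) (fun b hb => ?_) body_disjoint
    rcases body_bounds b hb with rfl | rfl | rfl
    · rw [h1.r3]
      omega
    · rwa [h1.r5]
    · rw [h1.r6]
      omega

end Prog

/-! ## Bounds for the size of rational numbers -/

/-- For real numbers no bounds are needed. -/
def SizeGrading.trivial (K : Type) [Field K] (N : ℕ) : SizeGrading K N where
  Le _ _ := True
  mono _ _ := True.intro
  zero := True.intro
  one := True.intro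
  neg _ := True.intro
  add _ _ := True.intro
  mul _ _ := True.intro
  div _ _ := True.intro
  natCast _ := True.intro

/-- The grading of the rational numbers by powers of a common denominator `D` and of a bound `M`
for the absolute value. -/
def SizeGrading.rat {N D M : ℕ} (hD : ∀ k < N, k + 1 ∣ D) (hM : 2 ≤ M) (hN : N ≤ M) :
    SizeGrading ℚ N where
  Le d q := (∃ z : ℤ, q * D ^ d = z) ∧ |q| ≤ M ^ d
  mono := by
    rintro d e x hde ⟨⟨z, hz⟩, hx⟩
    refine ⟨⟨z * D ^ (e - d), ?_⟩, hx.trans (pow_le_pow_right₀ (by exact_mod_cast (by omega)) hde)⟩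
    push_cast
    rw [← hz, mul_assoc, ← pow_add, Nat.add_sub_cancel' hde]
  zero := ⟨⟨0, by simp⟩, by simp⟩
  one := ⟨⟨1, by simp⟩, by simp⟩
  neg := by
    rintro d x ⟨⟨z, hz⟩, hx⟩
    exact ⟨⟨-z, by push_cast; rw [← hz, neg_mul]⟩, by rwa [abs_neg]⟩
  add := by
    rintro d x y ⟨⟨z, hz⟩, hx⟩ ⟨⟨w, hw⟩, hy⟩
    refine ⟨⟨(z + w) * D, by push_cast; rw [← hz, ← hw]; ring⟩, (abs_add_le x y).trans ?_⟩
    -- A sum may double the absolute value, which one further factor `M` absorbs.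
    have h2 : (2 : ℚ) ≤ M := by exact_mod_cast hM
    have hp : (0 : ℚ) ≤ (M : ℚ) ^ d := by positivity
    rw [pow_succ]
    nlinarith
  mul := by
    rintro d e x y ⟨⟨z, hz⟩, hx⟩ ⟨⟨w, hw⟩, hy⟩
    refine ⟨⟨z * w, by push_cast; rw [← hz, ← hw]; ring⟩, ?_⟩
    rw [abs_mul, pow_add]
    exact mul_le_mul hx hy (abs_nonneg _) (by positivity)
  div := by
    rintro d k x ⟨⟨z, hz⟩, hx⟩ hk
    -- Since `k + 1` divides `D`, one further power of `D` absorbs the division.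
    obtain ⟨c, hc⟩ := hD k hk
    have hk0 : (k : ℚ) + 1 ≠ 0 := Nat.cast_add_one_ne_zero k
    have hk1 : (1 : ℚ) ≤ (k : ℚ) + 1 := by simp
    have hM1 : (1 : ℚ) ≤ M := by exact_mod_cast (by omega)
    refine ⟨⟨z * c, ?_⟩, ?_⟩
    · push_cast
      rw [← hz, pow_succ]
      nth_rewrite 2 [hc]
      push_cast
      field_simp
    · rw [abs_div, abs_of_pos (by positivity : (0 : ℚ) < k + 1)]
      calc |x| / ((k : ℚ) + 1) ≤ |x| := div_le_self (abs_nonneg _) hk1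
        _ ≤ M ^ d := hx
        _ ≤ M ^ (d + 1) := pow_le_pow_right₀ hM1 (Nat.le_succ d)
  natCast := by
    intro k hk
    refine ⟨⟨k * D, by push_cast; ring⟩, ?_⟩
    rw [Nat.abs_cast, pow_one]
    exact_mod_cast hk.trans hN

/-- The reduced denominator divides `D ^ d`, and the numerator is at most `|q|` times the
denominator; hence `a` is counted twice and `b` once. -/
theorem ratSize_le {D M a b d : ℕ} {q : ℚ} (hD : D ≤ 2 ^ a) (hD0 : 0 < D) (hM : M ≤ 2 ^ b)
    (hq : ∃ z : ℤ, q * D ^ d = z) (hq' : |q| ≤ M ^ d) : ratSize q ≤ (2 * a + b) * d + 2 := by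
  obtain ⟨z, hz⟩ := hq
  have hden : q.den ≤ 2 ^ (a * d) := by
    have h1 : q = (z : ℚ) / ((D ^ d : ℕ) : ℤ) := by
      rw [eq_div_iff (by positivity)]
      exact_mod_cast hz
    have h2 : (q.den : ℤ) ∣ ((D ^ d : ℕ) : ℤ) := by
      rw [h1, ← Rat.divInt_eq_div]
      exact Rat.den_dvd _ _
    calc q.den ≤ D ^ d := Nat.le_of_dvd (by positivity) (Int.natCast_dvd_natCast.1 h2)
      _ ≤ (2 ^ a) ^ d := Nat.pow_le_pow_left hD d
      _ = 2 ^ (a * d) := (pow_mul _ _ _).symm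
  have hnum : q.num.natAbs ≤ 2 ^ (b * d + a * d) := by
    have h1 : ((q.num.natAbs : ℕ) : ℚ) = |q| * q.den := by
      rw [Nat.cast_natAbs, Int.cast_abs, ← Rat.mul_den_eq_num, abs_mul, Nat.abs_cast]
    have h2 : (q.num.natAbs : ℚ) ≤ ((M ^ d * 2 ^ (a * d) : ℕ) : ℚ) := by
      rw [h1]
      push_cast
      exact mul_le_mul hq' (by exact_mod_cast hden) (by positivity) (by positivity)
    calc q.num.natAbs ≤ M ^ d * 2 ^ (a * d) := by exact_mod_cast h2
      _ ≤ (2 ^ b) ^ d * 2 ^ (a * d) := Nat.mul_le_mul_right _ (Nat.pow_le_pow_left hM d)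
      _ = 2 ^ (b * d + a * d) := by rw [← pow_mul, ← pow_add]
  have h1 := Nat.size_le.2 (hnum.trans_lt (Nat.pow_lt_pow_succ (by norm_num : 1 < 2)))
  have h2 := Nat.size_le.2 (hden.trans_lt (Nat.pow_lt_pow_succ (by norm_num : 1 < 2)))
  rw [ratSize]
  calc _ ≤ (b * d + a * d + 1) + (a * d + 1) := Nat.add_le_add h1 h2
    _ = _ := by ring

theorem abs_lt_two_pow_ratSize (q : ℚ) : |q| < 2 ^ ratSize q := by
  have h1 : |q| ≤ (q.num.natAbs : ℚ) := by
    rw [Nat.cast_natAbs, Int.cast_abs, ← Rat.mul_den_eq_num, abs_mul, Nat.abs_cast]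
    exact le_mul_of_one_le_right (abs_nonneg _) (by exact_mod_cast q.den_pos)
  have h2 : q.num.natAbs < 2 ^ ratSize q :=
    (Nat.lt_size_self _).trans_le (Nat.pow_le_pow_right (by norm_num) (Nat.le_add_right _ _))
  exact h1.trans_lt (by exact_mod_cast h2)

namespace InputData

variable {m n : ℕ}

/-- The positions of the numbers in the input. -/
abbrev Pos (m n : ℕ) : Type :=
  (Fin m × Fin n) ⊕ (Fin m × Fin n) ⊕ Fin n ⊕ Fin n ⊕ Unit ⊕ Fin m ⊕ Unit ⊕ Unit

/-- The numbers in the input. -/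
def number {K : Type} (I : InputData K m n) : Pos m n → K
  | .inl p => I.A p.1 p.2
  | .inr (.inl p) => I.C p.1 p.2
  | .inr (.inr (.inl j)) => I.β j
  | .inr (.inr (.inr (.inl j))) => I.y j
  | .inr (.inr (.inr (.inr (.inl _)))) => I.pi1
  | .inr (.inr (.inr (.inr (.inr (.inl i))))) => I.x i
  | .inr (.inr (.inr (.inr (.inr (.inr (.inl _)))))) => I.lam
  | .inr (.inr (.inr (.inr (.inr (.inr (.inr _)))))) => I.pi2

theorem bitLength_eq (I : InputData ℚ m n) :
    I.bitLength = m + n + ∑ p, ratSize (I.number p) := by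
  simp [bitLength, number, Fintype.sum_sum_type, Fintype.sum_prod_type]
  ring

theorem mem_initState {K : Type} [Zero K] (I : InputData K m n) (k : EdgeKind) {a : ℕ}
    (ha : a ≤ 7) (i j : ℕ) :
    (initState I k).mem a i j = 0 ∨ ∃ p, (initState I k).mem a i j = I.number p := by
  have hpad : ∀ {r s : ℕ} (M : Fin r → Fin s → K), padded M i j = 0 ∨
      ∃ i' j', padded M i j = M i' j' := by
    intro r s M
    rw [padded]
    split_ifs
    exacts [Or.inr ⟨_, _, rfl⟩, Or.inl rfl]
  interval_cases a
  · exact (hpad I.A).imp_right fun ⟨i, j, h⟩ => ⟨.inl (i, j), h⟩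
  · exact (hpad I.C).imp_right fun ⟨i, j, h⟩ => ⟨.inr (.inl (i, j)), h⟩
  · exact (hpad fun _ : Fin 1 => I.β).imp_right fun ⟨_, j, h⟩ => ⟨.inr (.inr (.inl j)), h⟩
  · exact (hpad fun _ : Fin 1 => I.y).imp_right fun ⟨_, j, h⟩ =>
      ⟨.inr (.inr (.inr (.inl j))), h⟩
  · exact (hpad fun _ _ : Fin 1 => I.pi1).imp_right fun ⟨_, _, h⟩ =>
      ⟨.inr (.inr (.inr (.inr (.inl ())))), h⟩
  · exact (hpad fun _ : Fin 1 => I.x).imp_right fun ⟨_, j, h⟩ =>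
      ⟨.inr (.inr (.inr (.inr (.inr (.inl j))))), h⟩
  · exact (hpad fun _ _ : Fin 1 => I.lam).imp_right fun ⟨_, _, h⟩ =>
      ⟨.inr (.inr (.inr (.inr (.inr (.inr (.inl ())))))), h⟩
  · exact (hpad fun _ _ : Fin 1 => I.pi2).imp_right fun ⟨_, _, h⟩ =>
      ⟨.inr (.inr (.inr (.inr (.inr (.inr (.inr ())))))), h⟩

/-- The bit length of all numbers that occur, in terms of the bit length of the input. -/
noncomputable def sizePoly : Polynomial ℕ :=
  open Polynomial in (2 * ((X + 3) ^ 2 + X) + (X + 3)) * (3 * (X + 4) ^ 2) + 2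

theorem exists_sizeGrading (I : InputData ℚ m n) (k : EdgeKind) :
    ∃ g : SizeGrading ℚ (m + n + 3), (∀ a ≤ 7, ∀ i j, g.Le 1 ((initState I k).mem a i j)) ∧
      ∀ v, Prog.maxLe g v → ratSize v ≤ sizePoly.eval I.bitLength := by
  set N := m + n + 3 with hN
  set L := I.bitLength with hL
  have hmn : m + n + ∑ p, ratSize (I.number p) = L := (I.bitLength_eq).symm
  -- The product of the denominators gives every input number degree one; the factorial covers the
  -- divisions by `1, …, N`.
  set D := N.factorial * ∏ p, (I.number p).den with hD
  have hNL : N ≤ L + 3 := by omega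
  have hM : N ≤ 2 ^ (L + 3) := hNL.trans Nat.lt_two_pow_self.le
  -- The factorial is harmless because the bit length counts the dimensions in unary, so `N ≤ L +
  -- 3`.
  have hDle : D ≤ 2 ^ ((L + 3) ^ 2 + L) := by
    have h1 : N.factorial ≤ 2 ^ ((L + 3) ^ 2) := by
      calc N.factorial ≤ N ^ N := Nat.factorial_le_pow N
        _ ≤ (2 ^ (L + 3)) ^ N := Nat.pow_le_pow_left hM N
        _ ≤ (2 ^ (L + 3)) ^ (L + 3) := Nat.pow_le_pow_right (by positivity) hNL
        _ = 2 ^ ((L + 3) ^ 2) := by rw [← pow_mul, sq]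
    have h2 : ∏ p, (I.number p).den ≤ 2 ^ L := by
      calc ∏ p, (I.number p).den ≤ ∏ p, 2 ^ ratSize (I.number p) := by
            refine Finset.prod_le_prod' fun p _ => (Nat.lt_size_self _).le.trans
              (Nat.pow_le_pow_right (by norm_num) (Nat.le_add_left _ _))
        _ = 2 ^ ∑ p, ratSize (I.number p) := Finset.prod_pow_eq_pow_sum _ _ _
        _ ≤ 2 ^ L := Nat.pow_le_pow_right (by norm_num) (by omega)
    rw [pow_add]
    exact Nat.mul_le_mul h1 h2
  have hD0 : 0 < D := Nat.mul_pos (Nat.factorial_pos _)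
    (Finset.prod_pos fun p _ => (I.number p).den_pos)
  refine ⟨SizeGrading.rat (D := D) (M := 2 ^ (L + 3))
    (fun k hk => (Nat.dvd_factorial (Nat.succ_pos k) hk).mul_right _)
    (by rw [pow_succ]; have := Nat.one_le_two_pow (n := L + 2); omega) hM,
    fun a ha i j => ?_, fun v hv => ?_⟩
  · rcases I.mem_initState k ha i j with h | ⟨p, h⟩ <;> rw [h]
    · exact ⟨⟨0, by simp⟩, by simp⟩
    · constructor
      · obtain ⟨c, hc⟩ : (I.number p).den ∣ D := (Finset.dvd_prod_of_mem
          (fun p => (I.number p).den) (Finset.mem_univ p)).mul_left _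
        refine ⟨(I.number p).num * c, ?_⟩
        rw [pow_one, hc]
        push_cast
        rw [← mul_assoc, Rat.mul_den_eq_num]
      · refine (abs_lt_two_pow_ratSize _).le.trans ?_
        rw [pow_one]
        push_cast
        refine pow_le_pow_right₀ (by norm_num) ?_
        have := Finset.single_le_sum (f := fun p => ratSize (I.number p))
          (fun _ _ => Nat.zero_le _) (Finset.mem_univ p)
        omega
  · refine (ratSize_le hDle hD0 le_rfl hv.1 hv.2).trans ?_
    simp only [sizePoly, Polynomial.eval_add, Polynomial.eval_mul, Polynomial.eval_pow,
      Polynomial.eval_X, Polynomial.eval_ofNat]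
    gcongr
    omega

end InputData

/-! ## The program decides the direction of the edges -/

namespace InputData

variable {m n : ℕ}

theorem padded_cast {r s : ℕ} (M : Fin r → Fin s → ℚ) (i j : ℕ) :
    padded (fun i j => (M i j : ℝ)) i j = ((padded M i j : ℚ) : ℝ) := by
  rw [padded, padded]
  split_ifs <;> simp

theorem rowP_toReal (I : InputData ℚ m n) (r c : ℕ) :
    Prog.rowP I.toReal r c = ((Prog.rowP I r c : ℚ) : ℝ) := by
  have h : padded I.toReal.A r (c - m) = ((padded I.A r (c - m) : ℚ) : ℝ) := padded_cast I.A _ _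
  rw [Prog.rowP, Prog.rowP, h]
  split_ifs <;> simp

theorem rowQ_toReal (I : InputData ℚ m n) (r c : ℕ) :
    Prog.rowQ I.toReal r c = ((Prog.rowQ I r c : ℚ) : ℝ) := by
  have h1 : padded I.toReal.C c (r - m) = ((padded I.C c (r - m) : ℚ) : ℝ) := padded_cast I.C _ _
  have h2 : padded (fun _ : Fin 1 => I.toReal.β) 0 (r - m) =
      ((padded (fun _ : Fin 1 => I.β) 0 (r - m) : ℚ) : ℝ) := padded_cast (fun _ : Fin 1 => I.β) _ _
  rw [Prog.rowQ, Prog.rowQ, h1, h2]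
  split_ifs <;> simp

theorem coord_toReal (I : InputData ℚ m n) (c : ℕ) :
    Prog.coord I.toReal c = ((Prog.coord I c : ℚ) : ℝ) := by
  have h1 := padded_cast (fun _ : Fin 1 => I.x) 0 c
  have h2 := padded_cast (fun _ : Fin 1 => I.y) 0 (c - m)
  have h3 := padded_cast (fun _ _ : Fin 1 => I.pi1) 0 0
  have h4 := padded_cast (fun _ _ : Fin 1 => I.pi2) 0 0
  have h5 := padded_cast (fun _ _ : Fin 1 => I.lam) 0 0
  rw [Prog.coord, Prog.coord]
  split_ifs
  exacts [h1, h2, h3, h4, h5]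

/-- Branches depend on signs only, which the embedding of the rationals preserves; so the matrix
built from rational data is the one of the real vertex. -/
theorem slack_toReal {R : ℕ → ℕ → ℝ} {S : ℕ → ℕ → ℚ} (I : InputData ℚ m n)
    (h : ∀ r c, R r c = (S r c : ℝ)) (r : ℕ) :
    0 < Prog.slack R I.toReal r ↔ 0 < Prog.slack S I r := by
  rw [← Rat.cast_pos (K := ℝ)]
  simp only [Prog.slack, h, coord_toReal]
  push_cast
  rfl

theorem entry_toReal (I : InputData ℚ m n) (r c : ℕ) :
    Prog.entry I.toReal r c = ((Prog.entry I r c : ℚ) : ℝ) := by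
  simp only [Prog.entry, slack_toReal I I.rowP_toReal, slack_toReal I I.rowQ_toReal,
    rowP_toReal, rowQ_toReal]
  split_ifs <;> simp [apply_ite (Rat.cast : ℚ → ℝ)]

theorem det_entryMatrix_toReal (I : InputData ℚ m n) :
    (Prog.entryMatrix I.toReal).det = (((Prog.entryMatrix I).det : ℚ) : ℝ) := by
  rw [show Prog.entryMatrix I.toReal = (Prog.entryMatrix I).map (Rat.castHom ℝ) from
    Matrix.ext fun r c => entry_toReal I r c]
  exact (RingHom.map_det (Rat.castHom ℝ) _).symm

end InputData

/-- The numbers of the rows and columns. -/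
def idxEquiv (m n : ℕ) : Idx m n ≃ Fin (m + n + 3) :=
  (Equiv.sumCongr finSumFinEquiv (Equiv.refl _)).trans finSumFinEquiv

section

variable {m n : ℕ}

@[simp] theorem idxEquiv_x (i : Fin m) : (idxEquiv m n (.inl (.inl i)) : ℕ) = i := rfl

@[simp] theorem idxEquiv_y (j : Fin n) : (idxEquiv m n (.inl (.inr j)) : ℕ) = m + j := rfl

@[simp] theorem idxEquiv_inr (k : Fin 3) : (idxEquiv m n (.inr k) : ℕ) = m + n + k := rfl

theorem idxEquiv_inl (ℓ : Fin m ⊕ Fin n) :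
    (idxEquiv m n (.inl ℓ) : ℕ) = (finSumFinEquiv ℓ : Fin (m + n)) := rfl

theorem padded_of_lt {K : Type} [Zero K] {r s : ℕ} (M : Fin r → Fin s → K) (i : Fin r) (j : Fin s) :
    padded M i j = M i j := by
  rw [padded, dif_pos ⟨i.2, j.2⟩]

theorem padded_zero {K : Type} [Zero K] {s : ℕ} (M : Fin s → K) (j : Fin s) :
    padded (fun _ : Fin 1 => M) 0 j = M j :=
  padded_of_lt (fun _ : Fin 1 => M) 0 j

theorem padded_const {K : Type} [Zero K] (v : K) : padded (fun _ _ : Fin 1 => v) 0 0 = v :=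
  padded_of_lt (fun _ _ : Fin 1 => v) 0 0

end

namespace IsGameSpace

variable {m n : ℕ} {A C : Matrix (Fin m) (Fin n) ℝ} {β : Fin n → ℝ} {jₛ jₑ : Fin n}

theorem rowP_vertexInput (u : NVert A C β) (ℓ : Fin m ⊕ Fin n) (c : Idx m n) :
    Prog.rowP (vertexInput u) (idxEquiv m n (.inl ℓ)) (idxEquiv m n c) = coefP A ℓ c := by
  rcases ℓ with i | j
  · rcases c with (i' | j') | k
    · simp [Prog.rowP, coefP]
    · simpa [Prog.rowP, coefP, vertexInput] using padded_of_lt A i j'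
    · fin_cases k <;> simp [Prog.rowP, coefP]
  · rcases c with (i' | j') | k
    · simp [Prog.rowP, coefP, show ¬ m + (j : ℕ) < i' by omega, show (i' : ℕ) < m + j by omega]
    · rcases lt_trichotomy j j' with h | h | h
      · simp [Prog.rowP, coefP, h, h.ne']
      · simp [Prog.rowP, coefP, h]
      · simp [Prog.rowP, coefP, h, h.ne, h.le.not_gt]
    · simp [Prog.rowP, coefP, show m + (j : ℕ) < m + n + k by omega]

theorem rowQ_vertexInput (u : NVert A C β) (ℓ : Fin m ⊕ Fin n) (c : Idx m n) :
    Prog.rowQ (vertexInput u) (idxEquiv m n (.inl ℓ)) (idxEquiv m n c) = coefQ C β ℓ c := by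
  rcases ℓ with i | j
  · rcases c with (i' | j') | k
    · rcases lt_trichotomy i i' with h | h | h
      · simp [Prog.rowQ, coefQ, h, h.ne']
      · simp [Prog.rowQ, coefQ, h]
      · simp [Prog.rowQ, coefQ, h, h.ne, h.le.not_gt]
    · simp [Prog.rowQ, coefQ, show (i : ℕ) < m + j' by omega]
    · simp [Prog.rowQ, coefQ, show (i : ℕ) < m + n + k by omega]
  · rcases c with (i' | j') | k
    · simpa [Prog.rowQ, coefQ, vertexInput] using padded_of_lt C i' j
    · simp [Prog.rowQ, coefQ, show m + (j' : ℕ) < m + n + 1 by omega]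
    · fin_cases k <;> simp [Prog.rowQ, coefQ, padded_zero, vertexInput] <;> omega

theorem coord_vertexInput (u : NVert A C β) (c : Idx m n) :
    Prog.coord (vertexInput u) (idxEquiv m n c) = coords u.1.1 u.1.2 c := by
  rcases c with (i' | j') | k
  · simp [Prog.coord, coords, padded_zero, vertexInput]
  · simp [Prog.coord, coords, padded_zero, vertexInput]
  · fin_cases k <;> simp [Prog.coord, coords, padded_const, vertexInput] <;> omega

theorem slack_vertexInput {R : ℕ → ℕ → ℝ} {S : Fin m ⊕ Fin n → Idx m n → ℝ} (u : NVert A C β)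
    (h : ∀ ℓ c, R (idxEquiv m n (.inl ℓ)) (idxEquiv m n c) = S ℓ c) (ℓ : Fin m ⊕ Fin n) :
    Prog.slack R (vertexInput u) (idxEquiv m n (.inl ℓ)) = -(S ℓ ⬝ᵥ coords u.1.1 u.1.2) := by
  rw [Prog.slack, Finset.sum_range, ← (idxEquiv m n).sum_comp, dotProduct]
  simp only [h, coord_vertexInput]

/-- Slacks are nonnegative on the polyhedron, so one sign test decides tightness. -/
theorem slackP_pos (u : NVert A C β) (ℓ : Fin m ⊕ Fin n) :
    0 < Prog.slack (Prog.rowP (vertexInput u)) (vertexInput u) (idxEquiv m n (.inl ℓ)) ↔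
      ℓ ∉ tight (ineqP A) u.1.1 := by
  have h := (Set.ext_iff.1 polyP_eq _).1 u.2.1.1
  rw [slack_vertexInput u (rowP_vertexInput u), coefP_dot, mem_tight, neg_pos]
  exact ⟨fun h' => h'.ne, fun h' => (h.2 ℓ).lt_of_ne h'⟩

theorem slackQ_pos (u : NVert A C β) (ℓ : Fin m ⊕ Fin n) :
    0 < Prog.slack (Prog.rowQ (vertexInput u)) (vertexInput u) (idxEquiv m n (.inl ℓ)) ↔
      ℓ ∉ tight (ineqQ C β) u.1.2 := by
  have h := (Set.ext_iff.1 polyQ_eq _).1 u.2.1.2.1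
  rw [slack_vertexInput u (rowQ_vertexInput u), coefQ_dot, mem_tight, neg_pos]
  exact ⟨fun h' => h'.ne, fun h' => (h.2 ℓ).lt_of_ne h'⟩

theorem entry_vertexInput (h : IsGameSpace A C β jₛ jₑ) (u : NVert A C β) (r c : Idx m n) :
    Prog.entry (vertexInput u) (idxEquiv m n r) (idxEquiv m n c) = h.vertexMatrix u r c := by
  classical
  rcases r with ℓ | k
  · rw [Prog.entry, if_pos (idxEquiv_inl ℓ ▸ (finSumFinEquiv ℓ).2)]
    simp only [slackP_pos, rowP_vertexInput, rowQ_vertexInput]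
    rw [vertexMatrix, pairMatrix]
    by_cases hℓ : ℓ ∈ tight (ineqP A) u.1.1 <;> simp [hℓ]
  · fin_cases k
    · rcases c with (i' | j') | k
      · simp [Prog.entry, vertexMatrix, pairMatrix, coefSumP]
      · simp [Prog.entry, vertexMatrix, pairMatrix, coefSumP]
      · simp [Prog.entry, vertexMatrix, pairMatrix, coefSumP]
    · rcases c with (i' | j') | k
      · simp [Prog.entry, vertexMatrix, pairMatrix, coefSumQ]
      · simp [Prog.entry, vertexMatrix, pairMatrix, coefSumQ]
      · have : ¬ m + n + (k : ℕ) < m := by omega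
        simp [Prog.entry, vertexMatrix, pairMatrix, coefSumQ, this]
    · have h1 : Prog.entry (vertexInput u) (idxEquiv m n (.inr 2)) (idxEquiv m n c) =
          ∑ l ∈ Finset.range (m + n),
            if 0 < Prog.slack (Prog.rowP (vertexInput u)) (vertexInput u) l then 0 else
            if 0 < Prog.slack (Prog.rowQ (vertexInput u)) (vertexInput u) l then 0 else
              Prog.rowQ (vertexInput u) l (idxEquiv m n c) := by
        simp [Prog.entry]
      refine h1.trans ?_
      rw [Finset.sum_range, ← finSumFinEquiv.sum_comp]
      simp only [← idxEquiv_inl, slackP_pos, slackQ_pos, rowQ_vertexInput]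
      -- The duplicate label is the only one tight on both sides, so the sum collapses to its row.
      rw [Finset.sum_eq_single (h.dup u)]
      · rw [if_neg (not_not.2 (h.dup_mem_P u)), if_neg (not_not.2 (h.dup_mem_Q u))]
        simp [vertexMatrix, pairMatrix]
      · intro ℓ _ hℓ
        split_ifs with h2 h3
        · exact absurd ((Set.ext_iff.1 (h.inter_eq u) ℓ).1 ⟨h2, h3⟩) hℓ
        · rfl
        · rfl
      · exact fun h' => absurd (Finset.mem_univ _) h'

theorem det_entryMatrix (h : IsGameSpace A C β jₛ jₑ) (u : NVert A C β) :
    (Prog.entryMatrix (vertexInput u)).det = (h.vertexMatrix u).det := by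
  rw [← Matrix.det_submatrix_equiv_self (idxEquiv m n)]
  congr 1
  ext r c
  exact h.entry_vertexInput u r c

/-- The sign `(-1)^N` that Faddeev–LeVerrier attaches to a determinant of size `N = m + n + 3`
equals the factor between the matrix of the vertex and `E(u)`, so the computed number already has
the sign of the vertex. -/
theorem vertexSign_eq_one_iff_entryMatrix (h : IsGameSpace A C β jₛ jₑ) (u : NVert A C β) :
    vertexSign u = 1 ↔ 0 < (-1) ^ (m + n + 3) * (Prog.entryMatrix (vertexInput u)).det := by
  rw [h.det_entryMatrix, vertexSign, h.det_matrixE, sign_eq_one_iff,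
    show -(-1 : ℝ) ^ (m + n) = (-1) ^ (m + n + 3) by ring]

end IsGameSpace

/-- The shift by 3 comes from loops of length `m + n + 3`; the second factor pays for the bits of
each written number and is needed only for rational data. -/
theorem decidesAway_program : DecidesAway Prog.program
    (Prog.programSteps.comp (Polynomial.X + 3) * (1 + InputData.sizePoly)) := by
  intro m n A C β jₛ jₑ h u k
  have hout : ∀ {P : Prop} [Decidable P], (vertexSign u = 1 ↔ P) → ∀ {r v : ℕ},
      r = (match k with | .inP => 0 | .inQ => 1) →
      v = (if P then if r < 1 then 1 else 0 else if r < 1 then 0 else 1) →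
      (IsGameSpace.IsAway u k → v = 1) ∧ (¬ IsGameSpace.IsAway u k → v = 0) := by
    intro P _ hP r v hr hv
    cases k <;> by_cases hs : P <;> simp [IsGameSpace.IsAway, hP, hs, hv, hr]
  refine ⟨?_, fun I hI => ?_⟩
  · obtain ⟨h1, h2⟩ := Prog.program_spec (g := SizeGrading.trivial ℝ _) (I := vertexInput u)
      (k := k) (sz := fun _ => 0) (S := 0) (B := m + n + 3) (fun _ _ _ _ => True.intro)
      (fun _ _ => le_rfl) le_rfl
    obtain ⟨h3, h4⟩ := hout (h.vertexSign_eq_one_iff_entryMatrix u) (by cases k <;> rfl) h1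
    refine ⟨h3, h4, h2.trans ?_⟩
    simp only [Polynomial.eval_mul, Polynomial.eval_comp, Polynomial.eval_add, Polynomial.eval_X,
      Polynomial.eval_ofNat, Polynomial.eval_one]
    gcongr
    exact Nat.zero_le _
  · obtain ⟨g, hg1, hg2⟩ := I.exists_sizeGrading k
    have hB : m + n + 3 ≤ I.bitLength + 3 := by
      rw [I.bitLength_eq]
      omega
    obtain ⟨h1, h2⟩ := Prog.program_spec hg1 hg2 hB
    have hsign := h.vertexSign_eq_one_iff_entryMatrix u
    rw [← hI, I.det_entryMatrix_toReal] at hsign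
    have hcast : (0 : ℝ) < (-1) ^ (m + n + 3) * ((Prog.entryMatrix I).det : ℝ) ↔
        0 < (-1) ^ (m + n + 3) * (Prog.entryMatrix I).det := by
      rw [← Rat.cast_pos (K := ℝ)]
      push_cast
      rfl
    obtain ⟨h3, h4⟩ := hout (hsign.trans hcast) (by cases k <;> rfl) h1
    refine ⟨h3, h4, h2.trans_eq ?_⟩
    simp only [Polynomial.eval_mul, Polynomial.eval_comp, Polynomial.eval_add, Polynomial.eval_X,
      Polynomial.eval_ofNat, Polynomial.eval_one]
theorem mainTheorem9 :
    -- one program and one polynomial time bound serve all game spaces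
    ∃ (prog : Prog) (T : Polynomial ℕ),
      ∀ (m n : ℕ) (A C : Matrix (Fin m) (Fin n) ℝ) (β : Fin n → ℝ),
        NondegP A → NondegQ C β →
        ∀ (iₛ iₑ : Fin m) (jₛ jₑ : Fin n), jₛ ≠ jₑ →
          (∀ j, j ≠ jₛ → β jₛ < β j) → (∀ j, j ≠ jₑ → β j < β jₑ) →
          (∀ i, A i jₛ ≤ A iₛ jₛ) → (∀ i, A i jₑ ≤ A iₑ jₑ) →
          ∃ dir : NEdges A C β → Option (NVert A C β) × Option (NVert A C β),
            -- `dir` is an orientation of the edges of `𝒩`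
            (∀ e, IsDirectionOf (dir e) e) ∧
            -- it is determined by the signs of the vertices
            (∀ u : NVert A C β,
              (vertexSign u = 1 →
                (dir (edgeAt u .inP)).1 = some u ∧ (dir (edgeAt u .inQ)).2 = some u) ∧
              (vertexSign u ≠ 1 →
                (dir (edgeAt u .inP)).2 = some u ∧ (dir (edgeAt u .inQ)).1 = some u)) ∧
            -- it is efficiently computable
            ComputesDirection prog T dir ∧
            -- adjacent vertices have opposite signs
            (∀ u u' : NVert A C β, (NGraph A C β).Adj u u' →
              vertexSign u * vertexSign u' = -1) ∧
            -- every cycle becomes a directed cycle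
            (∀ (u : NVert A C β) (c : (NGraph A C β).Walk u u), c.IsCycle →
              (∀ d ∈ c.darts, DirectedFromTo dir d.fst d.snd) ∨
              (∀ d ∈ c.darts, DirectedFromTo dir d.snd d.fst)) ∧
            -- the path, which is unique and has the unbounded edges at `v_s` and `v_e` as its ends,
            -- is directed from the former to the latter
            (∃ uₛ uₑ : NVert A C β,
              uₛ.1.1 = pureVertex A iₛ jₛ ∧ uₑ.1.1 = pureVertex A iₑ jₑ ∧
              dir (edgeAt uₛ .inQ) = (none, some uₛ) ∧
              dir (edgeAt uₑ .inQ) = (some uₑ, none) ∧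
              (∀ e, (dir e).1 = none → e = edgeAt uₛ .inQ) ∧
              (∀ e, (dir e).2 = none → e = edgeAt uₑ .inQ) ∧
              (NGraph A C β).Reachable uₛ uₑ ∧
              ∀ p : (NGraph A C β).Walk uₛ uₑ, p.IsPath →
                ∀ d ∈ p.darts, DirectedFromTo dir d.fst d.snd) := by
  exact ⟨Prog.program, _, main_of_decidesAway decidesAway_program⟩
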